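/- Let $(M,g)$ be a smooth Riemannian manifold, let $G$ be a compact Lie group with Lie algebra $\mathcal G$, let $P\to M$ be a smooth principal $G$-bundle, and let $Ad(P)=P\times_{Ad}\mathcal G$ carry the fibre metric induced by a fixed $Ad_G$-invariant inner product on $\mathcal G$. For a smooth connection $\nabla$ on $Ad(P)$ let $R^\nabla_{X,Y}=[\nabla_X,\nabla_Y]-\nabla_{[X,Y]}$ be its curvature, and put $\|R^\nabla\|^2=\sum_{i<j}\|R^\nabla_{e_i,e_j}\|^2$ and $\langle i_XR^\nabla,i_YR^\nabla\rangle=\sum_k\langle R^\nabla_{X,e_k},R^\nabla_{Y,e_k}\rangle$, where $(e_i)$ is a $g$-orthonormal basis of the tangent space and $\langle S,U\rangle=\operatorname{trace}(S^T\circ U)$ for endomorphisms $S,U$ of a fibre of $Ad(P)$. Set $$\mathcal{YM}^0_e(\nabla)=\int_M\Big(\exp\big(\tfrac12\|R^\nabla\|^2\big)-1\Big)\,dv,\qquad \mathcal{YM}_e(\nabla)=\int_M\exp\big(\tfrac12\|R^\nabla\|^2\big)\,dv,$$ $$S_{e,\mathcal{YM}^0}(X,Y)=\Big(\exp\big(\tfrac{\|R^\nabla\|^2}2\big)-1\Big)g(X,Y)-\exp\big(\tfrac{\|R^\nabla\|^2}2\big)\langle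 i_XR^\nabla,i_YR^\nabla\rangle,$$ $$S_{e,\mathcal{YM}}(X,Y)=\exp\big(\tfrac{\|R^\nabla\|^2}2\big)\big(g(X,Y)-\langle i_XR^\nabla,i_YR^\nabla\rangle\big).$$ Suppose that $\nabla$ is a normalized exponential Yang–Mills connection or an exponential Yang–Mills connection, that is, a critical point of $\mathcal{YM}^0_e$ or of $\mathcal{YM}_e$ with respect to compactly supported variations $\nabla+tA$; this means that $\frac{d}{dt}\big|_{t=0}$ of the energy of $\nabla+tA$ on $K$ vanishes for every admissible smooth $1$-form $A$ and every compact $K\subset M$ outside of which $A=0$. Here either (a) all smooth connections on $Ad(P)$ are admitted: $\nabla$ is any smooth connection on the vector bundle $Ad(P)$ and $A$ ranges over the smooth $1$-forms with values in $\operatorname{Hom}(Ad(P),Ad(P))$; or (b) only the connections coming from $P$ are admitted: $\nabla$ is induced by a connection on $P$ and $A$ ranges over the smooth $1$-forms with values in $Ad(P)$, acting on $Ad(P)$ by the Lie bracket. Then $R^\nabla$ satisfies the $e$-conservation law: both stress-energy tensors are divergence free, $$\operatorname{div}S_{e,\mathcal{YM}^0}=\operatorname{div}S_{e,\mathcal{YM}}=0,$$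 where $(\operatorname{div}S)(X)=\sum_i(\nabla^M_{e_i}S)(e_i,X)$ and $\nabla^M$ is the Levi-Civita connection of $(M,g)$. -/

import Mathlib

open scoped Manifold ContDiff Bundle Topology
open MeasureTheory

noncomputable section

namespace ExpYangMills

/-- The model space `ℝᵏ`, with its Euclidean norm. -/
abbrev Eu (k : ℕ) : Type := EuclideanSpace ℝ (Fin k)

section LieGroupAd

variable {d : ℕ} {G : Type*} [TopologicalSpace G] [ChartedSpace (Eu d) G]
  [Group G]

/-- The adjoint representation `Ad g`, the differential at the identity of `h ↦ g h g⁻¹`. The Lie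
algebra `T₁G` is, as a vector space, the model space `ℝᵈ` of `G`. -/
def Ad (g : G) : Eu d →L[ℝ] Eu d :=
  mfderiv (𝓡 d) (𝓡 d) (fun h : G ↦ g * h * g⁻¹) 1

/-- The adjoint representation of the Lie algebra on itself: the differential at the identity of
`Ad : G → GL(T₁G)`, so that `ad ξ η` is the Lie bracket `[ξ, η]`. -/
def ad (G : Type*) [TopologicalSpace G] [ChartedSpace (Eu d) G] [Group G] :
    Eu d →L[ℝ] Eu d →L[ℝ] Eu d :=
  mfderiv (𝓡 d) 𝓘(ℝ, Eu d →L[ℝ] Eu d) (Ad : G → Eu d →L[ℝ] Eu d) 1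

lemma Ad_one [LieGroup (𝓡 d) ∞ G] :
    (Ad (1 : G) : Eu d →L[ℝ] Eu d) = ContinuousLinearMap.id ℝ (Eu d) := by
  have : (fun h : G ↦ 1 * h * 1⁻¹) = id := by ext h; simp
  unfold Ad
  rw [this]
  exact mfderiv_id

lemma contMDiff_conj [LieGroup (𝓡 d) ∞ G] (g : G) :
    ContMDiff (𝓡 d) (𝓡 d) ∞ (fun h : G ↦ g * h * g⁻¹) :=
  (contMDiff_const.mul contMDiff_id).mul contMDiff_const

lemma Ad_mul [LieGroup (𝓡 d) ∞ G] (g h : G) :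
    (Ad (g * h) : Eu d →L[ℝ] Eu d) = (Ad g).comp (Ad h) := by
  have e : (fun k : G ↦ (g * h) * k * (g * h)⁻¹) =
      (fun k : G ↦ g * k * g⁻¹) ∘ (fun k : G ↦ h * k * h⁻¹) := by
    ext k; simp [mul_assoc]
  have h1 : ∀ p : G, p = 1 → (mfderiv (𝓡 d) (𝓡 d) (fun k : G ↦ g * k * g⁻¹) p : Eu d →L[ℝ] Eu d) =
      Ad g := by rintro _ rfl; rfl
  have key := mfderiv_comp (I := 𝓡 d) (I' := 𝓡 d) (I'' := 𝓡 d) (1 : G)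
    (g := fun k : G ↦ g * k * g⁻¹) (f := fun k : G ↦ h * k * h⁻¹)
    ((contMDiff_conj g).mdifferentiable (by simp) _)
    ((contMDiff_conj h).mdifferentiable (by simp) _)
  rw [← e] at key
  exact key.trans (congrArg (fun L : Eu d →L[ℝ] Eu d ↦ L.comp (Ad h)) (h1 _ (by simp)))

lemma contMDiff_Ad [LieGroup (𝓡 d) ∞ G] :
    ContMDiff (𝓡 d) 𝓘(ℝ, Eu d →L[ℝ] Eu d) ∞
      (Ad : G → Eu d →L[ℝ] Eu d) := by
  have : IsManifold (𝓡 d) 1 G := IsManifold.of_le (n := ∞) (by simp)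
  intro g₀
  have hf : ContMDiffAt ((𝓡 d).prod (𝓡 d)) (𝓡 d) ∞
      (Function.uncurry (fun g h : G ↦ g * h * g⁻¹)) (g₀, 1) :=
    ((contMDiff_fst.mul contMDiff_snd).mul contMDiff_fst.inv).contMDiffAt
  have := ContMDiffAt.mfderiv (I := 𝓡 d) (I' := 𝓡 d) (m := ∞) (n := ∞) (fun g h : G ↦ g * h * g⁻¹) (fun _ ↦ (1 : G)) hf
    contMDiffAt_const (by simp)
  refine this.congr_of_eventuallyEq (Filter.Eventually.of_forall fun g ↦ ?_)
  have h1 (k : G) : k * 1 * k⁻¹ = 1 := by simp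
  have key := inTangentCoordinates_eq (I := 𝓡 d) (I' := 𝓡 d) (fun _ : G ↦ (1 : G))
    (fun k : G ↦ k * 1 * k⁻¹) (fun k : G ↦ (Ad k : Eu d →L[ℝ] Eu d)) (x₀ := g₀) (x := g)
    (by simp) (by simp)
  refine Eq.trans ?_ key.symm
  simp only [h1]
  ext v : 1
  have c (w : Eu d) := (tangentBundleCore (𝓡 d) G).coordChange_self (achart _ (1 : G)) 1
    (mem_chart_source (Eu d) (1 : G)) w
  exact ((c _).trans (congrArg (Ad g : Eu d →L[ℝ] Eu d) (c v))).symm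

end LieGroupAd

/-! ### Principal bundles, adjoint bundles and connections on them -/

section Principal

variable (n m d : ℕ)
  (M : Type*) [TopologicalSpace M] [ChartedSpace (Eu n) M]
  (G : Type*) [TopologicalSpace G] [ChartedSpace (Eu d) G] [Group G]
  (P : Type*) [TopologicalSpace P] [ChartedSpace (Eu m) P] [MulAction Gᵐᵒᵖ P]

variable {M P} in
/-- A bundle chart of a principal bundle: a `G`-equivariant diffeomorphism
`proj⁻¹(U) → U × G` over the identity of an open set `U = baseSet`. The right action of `g` on `p`
is written `MulOpposite.op g • p`. -/
structure BundleChart (proj : P → M) extends Bundle.Trivialization G proj where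
  contMDiffOn_toFun : ContMDiffOn (𝓡 m) ((𝓡 n).prod (𝓡 d)) ∞ toFun source
  contMDiffOn_invFun : ContMDiffOn ((𝓡 n).prod (𝓡 d)) (𝓡 m) ∞ invFun target
  equivariant : ∀ p ∈ source, ∀ g : G,
    toFun (MulOpposite.op g • p) = ((toFun p).1, (toFun p).2 * g)

/-- A smooth principal `G`-bundle with base `M` and total space `P`, where `G` acts on `P` from
the right. -/
structure PrincipalBundle where
  proj : P → M
  contMDiff_proj : ContMDiff (𝓡 m) (𝓡 n) ∞ proj
  contMDiff_act : ContMDiff ((𝓡 m).prod (𝓡 d)) (𝓡 m) ∞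
    (fun q : P × G ↦ MulOpposite.op q.2 • q.1)
  free : ∀ (p : P) (g : G), MulOpposite.op g • p = p → g = 1
  proj_eq_iff : ∀ p q : P, proj p = proj q ↔ ∃ g : G, q = MulOpposite.op g • p
  exists_chart : ∀ x : M, ∃ φ : BundleChart n m d G proj, x ∈ φ.baseSet

variable {n m d M G P}

namespace BundleChart

variable {proj : P → M}

/-- The local section `x ↦ φ⁻¹(x, 1)` of a bundle chart `φ`. -/
def localSection (φ : BundleChart n m d G proj) (x : M) : P := φ.invFun (x, 1)

/-- The transition function from the bundle chart `φ` to the bundle chart `ψ`: the element `g`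
of `G` such that `s_φ(x) = s_ψ(x) g` for the local sections of these charts. -/
def transition (φ ψ : BundleChart n m d G proj) (x : M) : G := (ψ.toFun (φ.localSection x)).2

lemma mem_target (φ : BundleChart n m d G proj) {x : M} (hx : x ∈ φ.baseSet) (g : G) :
    (x, g) ∈ φ.target := by
  rw [φ.target_eq]; exact ⟨hx, trivial⟩

lemma localSection_mem (φ : BundleChart n m d G proj) {x : M} (hx : x ∈ φ.baseSet) :
    φ.localSection x ∈ φ.source := φ.map_target (φ.mem_target hx 1)

lemma toFun_localSection (φ : BundleChart n m d G proj) {x : M} (hx : x ∈ φ.baseSet) :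
    φ.toFun (φ.localSection x) = (x, 1) := φ.right_inv (φ.mem_target hx 1)

lemma proj_localSection (φ : BundleChart n m d G proj) {x : M} (hx : x ∈ φ.baseSet) :
    proj (φ.localSection x) = x := by
  rw [← φ.proj_toFun _ (φ.localSection_mem hx)]
  exact congrArg Prod.fst (φ.toFun_localSection hx)

lemma localSection_mem' (φ ψ : BundleChart n m d G proj) {x : M} (hx : x ∈ φ.baseSet)
    (hx' : x ∈ ψ.baseSet) : φ.localSection x ∈ ψ.source := by
  rw [ψ.source_eq, Set.mem_preimage, φ.proj_localSection hx]; exact hx'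

lemma transition_self (φ : BundleChart n m d G proj) {x : M} (hx : x ∈ φ.baseSet) :
    φ.transition φ x = 1 := congrArg Prod.snd (φ.toFun_localSection hx)

lemma toFun_localSection' (φ ψ : BundleChart n m d G proj) {x : M} (hx : x ∈ φ.baseSet)
    (hx' : x ∈ ψ.baseSet) : ψ.toFun (φ.localSection x) = (x, φ.transition ψ x) :=
  Prod.ext ((ψ.proj_toFun _ (φ.localSection_mem' ψ hx hx')).trans (φ.proj_localSection hx)) rfl

end BundleChart

namespace PrincipalBundle

variable (Q : PrincipalBundle n m d M G P)

lemma proj_act (p : P) (g : G) : Q.proj (MulOpposite.op g • p) = Q.proj p :=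
  ((Q.proj_eq_iff p _).2 ⟨g, rfl⟩).symm

lemma localSection_eq (φ ψ : BundleChart n m d G Q.proj) {x : M} (hx : x ∈ φ.baseSet)
    (hx' : x ∈ ψ.baseSet) :
    φ.localSection x = MulOpposite.op (φ.transition ψ x) • ψ.localSection x := by
  have h2 : MulOpposite.op (φ.transition ψ x) • ψ.localSection x ∈ ψ.source := by
    rw [ψ.source_eq, Set.mem_preimage, Q.proj_act, ψ.proj_localSection hx']; exact hx'
  refine ψ.injOn (φ.localSection_mem' ψ hx hx') h2 ?_
  refine (φ.toFun_localSection' ψ hx hx').trans ?_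
  refine Eq.trans ?_ (ψ.equivariant _ (ψ.localSection_mem hx') _).symm
  rw [ψ.toFun_localSection hx', one_mul]

lemma transition_mul (φ ψ χ : BundleChart n m d G Q.proj) {x : M} (hx : x ∈ φ.baseSet)
    (hx' : x ∈ ψ.baseSet) (hx'' : x ∈ χ.baseSet) :
    ψ.transition χ x * φ.transition ψ x = φ.transition χ x := by
  have h := Q.localSection_eq φ ψ hx hx'
  have := χ.equivariant _ (ψ.localSection_mem' χ hx' hx'') (φ.transition ψ x)
  rw [← h] at this
  exact (congrArg Prod.snd this).symm

lemma contMDiffOn_transition (φ ψ : BundleChart n m d G Q.proj) :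
    ContMDiffOn (𝓡 n) (𝓡 d) ∞ (φ.transition ψ) (φ.baseSet ∩ ψ.baseSet) := by
  have h1 : ContMDiffOn (𝓡 n) (𝓡 m) ∞ φ.localSection φ.baseSet :=
    φ.contMDiffOn_invFun.comp (contMDiff_id.prodMk contMDiff_const).contMDiffOn
      fun x hx ↦ φ.mem_target hx 1
  have h2 : ContMDiffOn (𝓡 n) ((𝓡 n).prod (𝓡 d)) ∞ (fun x ↦ ψ.toFun (φ.localSection x))
      (φ.baseSet ∩ ψ.baseSet) :=
    ψ.contMDiffOn_toFun.comp (h1.mono Set.inter_subset_left)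
      fun x hx ↦ φ.localSection_mem' ψ hx.1 hx.2
  exact contMDiff_snd.comp_contMDiffOn h2

variable [LieGroup (𝓡 d) ∞ G]

/-- The adjoint bundle `P ×_Ad T₁G`, glued from the sets `U × T₁G`, for the bundle charts of `P`
with domain `U`, by the maps `Ad g` for the transition functions `g` of `P`. -/
def adjointCore : VectorBundleCore ℝ M (Eu d) (BundleChart n m d G Q.proj) where
  baseSet φ := φ.baseSet
  isOpen_baseSet φ := φ.open_baseSet
  indexAt x := (Q.exists_chart x).choose
  mem_baseSet_at x := (Q.exists_chart x).choose_spec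
  coordChange φ ψ x := Ad (φ.transition ψ x)
  coordChange_self φ x hx v := by rw [φ.transition_self hx, Ad_one]; rfl
  continuousOn_coordChange φ ψ :=
    contMDiff_Ad.continuous.comp_continuousOn (Q.contMDiffOn_transition φ ψ).continuousOn
  coordChange_comp φ ψ χ x hx v := by
    rw [← Q.transition_mul φ ψ χ hx.1.1 hx.1.2 hx.2, Ad_mul]; rfl

instance : Q.adjointCore.IsContMDiff (𝓡 n) ∞ where
  contMDiffOn_coordChange φ ψ :=
    contMDiff_Ad.comp_contMDiffOn (Q.contMDiffOn_transition φ ψ)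

end PrincipalBundle

variable (d G) in
/-- An `Ad`-invariant inner product on the Lie algebra of `G`. -/
structure AdInvariantInner where
  form : Eu d →L[ℝ] Eu d →L[ℝ] ℝ
  symm : ∀ ξ η, form ξ η = form η ξ
  pos : ∀ ξ, ξ ≠ 0 → 0 < form ξ ξ
  invariant : ∀ (g : G) (ξ η), form (Ad g ξ) (Ad g η) = form ξ η

lemma AdInvariantInner.isVonNBounded (κ : AdInvariantInner d G) :
    Bornology.IsVonNBounded ℝ {v : Eu d | κ.form v v < 1} := by
  rw [NormedSpace.isVonNBounded_iff]
  have hc : Continuous fun v : Eu d ↦ κ.form v v := by fun_prop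
  rcases (Metric.sphere (0 : Eu d) 1).eq_empty_or_nonempty with h | h
  · refine (Bornology.isBounded_singleton (x := (0 : Eu d))).subset fun v _ ↦ ?_
    by_contra hv
    have : ‖v‖⁻¹ • v ∈ Metric.sphere (0 : Eu d) 1 := by
      simp [norm_smul, inv_mul_cancel₀ (norm_ne_zero_iff.2 hv)]
    rw [h] at this
    exact this
  obtain ⟨u, hu, hmin⟩ := (isCompact_sphere (0 : Eu d) 1).exists_isMinOn h hc.continuousOn
  have hu0 : u ≠ 0 := by rintro rfl; simp at hu
  have hpos := κ.pos u hu0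
  refine (Metric.isBounded_closedBall (x := (0 : Eu d)) (r := 1 + (κ.form u u)⁻¹)).subset
    fun v hv ↦ ?_
  rw [mem_closedBall_zero_iff]
  rcases eq_or_ne v 0 with rfl | hv0
  · rw [norm_zero]; positivity
  have hn : 0 < ‖v‖ := norm_pos_iff.2 hv0
  have h1 : κ.form u u ≤ κ.form (‖v‖⁻¹ • v) (‖v‖⁻¹ • v) := hmin (by
    simp [norm_smul, inv_mul_cancel₀ hn.ne'])
  have h2 : κ.form u u * ‖v‖ ^ 2 ≤ κ.form v v := by
    simp only [map_smul, smul_apply, smul_eq_mul] at h1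
    calc κ.form u u * ‖v‖ ^ 2 ≤ (‖v‖⁻¹ * (‖v‖⁻¹ * κ.form v v)) * ‖v‖ ^ 2 := by gcongr
      _ = κ.form v v := by field_simp
  have h3 : ‖v‖ ^ 2 ≤ (κ.form u u)⁻¹ := by
    rw [← one_div, le_div_iff₀ hpos, mul_comm]
    exact h2.trans (le_of_lt hv)
  nlinarith [sq_nonneg (‖v‖ - 1)]

namespace PrincipalBundle

variable [LieGroup (𝓡 d) ∞ G] (Q : PrincipalBundle n m d M G P) (κ : AdInvariantInner d G)

/-- The fibre at `x` of the adjoint bundle `Ad(P)`; it carries the metric induced by `κ`. -/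
def AdP (_κ : AdInvariantInner d G) (x : M) : Type := Q.adjointCore.Fiber x

instance (x : M) : TopologicalSpace (Q.AdP κ x) :=
  inferInstanceAs (TopologicalSpace (Q.adjointCore.Fiber x))
instance (x : M) : AddCommGroup (Q.AdP κ x) :=
  inferInstanceAs (AddCommGroup (Q.adjointCore.Fiber x))
instance (x : M) : Module ℝ (Q.AdP κ x) :=
  inferInstanceAs (Module ℝ (Q.adjointCore.Fiber x))
instance (x : M) : IsTopologicalAddGroup (Q.AdP κ x) :=
  inferInstanceAs (IsTopologicalAddGroup (Eu d))
instance (x : M) : ContinuousSMul ℝ (Q.AdP κ x) :=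
  inferInstanceAs (ContinuousSMul ℝ (Eu d))
instance (x : M) : FiniteDimensional ℝ (Q.AdP κ x) :=
  inferInstanceAs (FiniteDimensional ℝ (Eu d))
instance : TopologicalSpace (Bundle.TotalSpace (Eu d) (Q.AdP κ)) :=
  inferInstanceAs (TopologicalSpace (Bundle.TotalSpace (Eu d) Q.adjointCore.Fiber))
instance : FiberBundle (Eu d) (Q.AdP κ) :=
  inferInstanceAs (FiberBundle (Eu d) Q.adjointCore.Fiber)
instance : VectorBundle ℝ (Eu d) (Q.AdP κ) :=
  inferInstanceAs (VectorBundle ℝ (Eu d) Q.adjointCore.Fiber)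
instance : ContMDiffVectorBundle ∞ (Eu d) (Q.AdP κ) (𝓡 n) :=
  inferInstanceAs (ContMDiffVectorBundle ∞ (Eu d) Q.adjointCore.Fiber (𝓡 n))

/-- The fibre metric on `Ad(P)` induced by an `Ad`-invariant inner product. -/
def adMetric : Bundle.RiemannianMetric (Q.AdP κ) where
  inner _ := κ.form
  symm _ := κ.symm
  pos _ := κ.pos
  continuousAt _ := by
    have hc : Continuous fun v : Eu d ↦ κ.form v v := by fun_prop
    exact hc.continuousAt
  isVonNBounded _ := κ.isVonNBounded

instance : Bundle.RiemannianBundle (Q.AdP κ) := ⟨Q.adMetric κ⟩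

/-- The coordinate in `T₁G` of an element of `Ad(P)` in the bundle chart `φ` of `P`. -/
def coord (φ : BundleChart n m d G Q.proj) {x : M} (u : Q.AdP κ x) : Eu d :=
  Q.adjointCore.coordChange (Q.adjointCore.indexAt x) φ x u

/-- The action of `ξ ∈ Ad(P)ₓ` on `u ∈ Ad(P)ₓ` through the Lie bracket of the fibre
`Ad(P)ₓ ≅ T₁G`. The bracket commutes with all `Ad g`, hence does not depend on the bundle chart. -/
def bracket {x : M} (ξ u : Q.AdP κ x) : Q.AdP κ x := ad (d := d) G ξ u

/-- A connection on a principal bundle, given by its connection form. -/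
structure Connection [IsManifold (𝓡 m) ∞ P] (Q : PrincipalBundle n m d M G P) where
  form (p : P) : TangentSpace (𝓡 m) p →L[ℝ] Eu d
  contMDiff : ContMDiff (𝓡 m) ((𝓡 m).prod 𝓘(ℝ, Eu m →L[ℝ] Eu d)) ∞
    (fun p ↦ Bundle.TotalSpace.mk' (Eu m →L[ℝ] Eu d)
      (E := fun p : P ↦ TangentSpace (𝓡 m) p →L[ℝ] Bundle.Trivial P (Eu d) p) p (form p))
  /-- The connection form reproduces the generators of fundamental vector fields. -/
  vertical (p : P) (ξ : Eu d) :
    form p (mfderiv (𝓡 d) (𝓡 m) (fun g : G ↦ MulOpposite.op g • p)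
      (1 : G) ξ) = ξ
  equivariant (p : P) (g : G) (v : TangentSpace (𝓡 m) p) :
    form (MulOpposite.op g • p) (mfderiv (𝓡 m) (𝓡 m) (fun q : P ↦ MulOpposite.op g • q) p v) =
      Ad g⁻¹ (form p v)

/-- `∇` is the covariant derivative on `Ad(P)` induced by the connection `θ` on `P`: in every
bundle chart of `P`, with local section `s`, one has `∇_v σ = dσ(v) + [(s^*θ)(v), σ]`. -/
def IsInducedBy [IsManifold (𝓡 n) ∞ M] [IsManifold (𝓡 m) ∞ P] (cov : CovariantDerivative (𝓡 n) (Eu d) (Q.AdP κ)) (θ : Q.Connection) : Prop :=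
  ∀ (σ : Π x : M, Q.AdP κ x) (x : M),
    MDifferentiableAt (𝓡 n) ((𝓡 n).prod 𝓘(ℝ, Eu d))
      (fun y ↦ Bundle.TotalSpace.mk' (Eu d) y (σ y)) x →
    ∀ φ : BundleChart n m d G Q.proj, x ∈ φ.baseSet → ∀ v : TangentSpace (𝓡 n) x,
      Q.coord κ φ (cov σ x v) =
        mvfderiv (𝓡 n) (fun y ↦ Q.coord κ φ (σ y)) x v +
        ad G (θ.form (φ.localSection x) (mfderiv (𝓡 n) (𝓡 m) φ.localSection x v))
          (Q.coord κ φ (σ x))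

end PrincipalBundle

end Principal

/-! ### Riemannian geometry of the base -/

section Riemannian

variable {E : Type*} [NormedAddCommGroup E] [NormedSpace ℝ E] [FiniteDimensional ℝ E]
  {H : Type*} [TopologicalSpace H] {I : ModelWithCorners ℝ E H}
  {M : Type*} [TopologicalSpace M] [ChartedSpace H M] [IsManifold I ∞ M]
  [Bundle.RiemannianBundle (fun x : M ↦ TangentSpace I x)]

instance (x : M) : FiniteDimensional ℝ (TangentSpace I x) :=
  inferInstanceAs (FiniteDimensional ℝ E)

/-- The extension of a tangent vector at `x` to a vector field that is smooth near `x`. -/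
abbrev extendT {x : M} (v : TangentSpace I x) : Π y : M, TangentSpace I y :=
  FiberBundle.extend E v

/-- `MDiffT X x`: the vector field `X` is differentiable at `x`. -/
abbrev MDiffT (X : Π y : M, TangentSpace I y) (x : M) : Prop :=
  MDifferentiableAt I (I.prod 𝓘(ℝ, E))
    (fun y ↦ Bundle.TotalSpace.mk' E y (X y)) x

/-- The right hand side of Koszul's formula for `2⟨∇_X Y, Z⟩`. -/
def koszul (Y X Z : Π y : M, TangentSpace I y) (x : M) : ℝ :=
  mvfderiv I (fun y ↦ inner ℝ (Y y) (Z y)) x (X x)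
  + mvfderiv I (fun y ↦ inner ℝ (X y) (Z y)) x (Y x)
  - mvfderiv I (fun y ↦ inner ℝ (X y) (Y y)) x (Z x)
  + inner ℝ (VectorField.mlieBracket I X Y x) (Z x)
  - inner ℝ (VectorField.mlieBracket I X Z x) (Y x)
  - inner ℝ (VectorField.mlieBracket I Y Z x) (X x)

variable [IsContMDiffRiemannianBundle I ∞ E (fun x : M ↦ TangentSpace I x)]

lemma mdiff_inner {Y X : Π y : M, TangentSpace I y} {x : M}
    (hY : MDiffT Y x) (hX : MDiffT X x) :
    MDifferentiableAt I 𝓘(ℝ, ℝ) (fun y ↦ inner ℝ (Y y) (X y)) x :=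
  MDifferentiableAt.inner_bundle hY hX

lemma koszul_tensorial_Z {Y X : Π y : M, TangentSpace I y} {x : M}
    (hY : MDiffT Y x) (hX : MDiffT X x) :
    TensorialAt I E (koszul Y X · x) x where
  smul {f Z} hf hZ := by
    have e1 : (fun y ↦ inner ℝ (Y y) ((f • Z) y)) = fun y ↦ f y * inner ℝ (Y y) (Z y) := by
      ext y; simp [inner_smul_right]
    have e2 : (fun y ↦ inner ℝ (X y) ((f • Z) y)) = fun y ↦ f y * inner ℝ (X y) (Z y) := by
      ext y; simp [inner_smul_right]
    simp only [koszul]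
    rw [e1, e2, mvfderiv_fun_mul hf (mdiff_inner hY hZ), mvfderiv_fun_mul hf (mdiff_inner hX hZ),
      VectorField.mlieBracket_smul_right hf hZ, VectorField.mlieBracket_smul_right hf hZ]
    simp [inner_smul_right, inner_smul_left, inner_add_left, real_inner_comm]
    ring
  add {Z Z'} hZ hZ' := by
    have e1 : (fun y ↦ inner ℝ (Y y) ((Z + Z') y)) =
        fun y ↦ inner ℝ (Y y) (Z y) + inner ℝ (Y y) (Z' y) := by
      ext y; simp [inner_add_right]
    have e2 : (fun y ↦ inner ℝ (X y) ((Z + Z') y)) =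
        fun y ↦ inner ℝ (X y) (Z y) + inner ℝ (X y) (Z' y) := by
      ext y; simp [inner_add_right]
    simp only [koszul]
    rw [e1, e2, mvfderiv_fun_add (mdiff_inner hY hZ) (mdiff_inner hY hZ'),
      mvfderiv_fun_add (mdiff_inner hX hZ) (mdiff_inner hX hZ'),
      VectorField.mlieBracket_add_right hZ hZ', VectorField.mlieBracket_add_right hZ hZ']
    simp [inner_add_right, inner_add_left]
    ring

lemma koszul_tensorial_X {Y Z : Π y : M, TangentSpace I y} {x : M}
    (hY : MDiffT Y x) (hZ : MDiffT Z x) :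
    TensorialAt I E (koszul Y · Z x) x where
  smul {f X} hf hX := by
    have e1 : (fun y ↦ inner ℝ ((f • X) y) (Y y)) = fun y ↦ f y * inner ℝ (X y) (Y y) := by
      ext y; simp [inner_smul_left]
    have e2 : (fun y ↦ inner ℝ ((f • X) y) (Z y)) = fun y ↦ f y * inner ℝ (X y) (Z y) := by
      ext y; simp [inner_smul_left]
    simp only [koszul]
    rw [e1, e2, mvfderiv_fun_mul hf (mdiff_inner hX hY), mvfderiv_fun_mul hf (mdiff_inner hX hZ),
      VectorField.mlieBracket_smul_left hf hX, VectorField.mlieBracket_smul_left hf hX]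
    simp [inner_smul_right, inner_smul_left, inner_add_left, real_inner_comm]
    ring
  add {X X'} hX hX' := by
    have e1 : (fun y ↦ inner ℝ ((X + X') y) (Y y)) =
        fun y ↦ inner ℝ (X y) (Y y) + inner ℝ (X' y) (Y y) := by
      ext y; simp [inner_add_left]
    have e2 : (fun y ↦ inner ℝ ((X + X') y) (Z y)) =
        fun y ↦ inner ℝ (X y) (Z y) + inner ℝ (X' y) (Z y) := by
      ext y; simp [inner_add_left]
    simp only [koszul]
    rw [e1, e2, mvfderiv_fun_add (mdiff_inner hX hY) (mdiff_inner hX' hY),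
      mvfderiv_fun_add (mdiff_inner hX hZ) (mdiff_inner hX' hZ),
      VectorField.mlieBracket_add_left hX hX', VectorField.mlieBracket_add_left hX hX']
    simp [inner_add_right, inner_add_left]
    ring

lemma koszul_add {Y Y' X Z : Π y : M, TangentSpace I y} {x : M} (hY : MDiffT Y x)
    (hY' : MDiffT Y' x) (hX : MDiffT X x) (hZ : MDiffT Z x) :
    koszul (Y + Y') X Z x = koszul Y X Z x + koszul Y' X Z x := by
  have e1 : (fun y ↦ inner ℝ ((Y + Y') y) (Z y)) =
      fun y ↦ inner ℝ (Y y) (Z y) + inner ℝ (Y' y) (Z y) := by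
    ext y; simp [inner_add_left]
  have e2 : (fun y ↦ inner ℝ (X y) ((Y + Y') y)) =
      fun y ↦ inner ℝ (X y) (Y y) + inner ℝ (X y) (Y' y) := by
    ext y; simp [inner_add_right]
  simp only [koszul]
  rw [e1, e2, mvfderiv_fun_add (mdiff_inner hY hZ) (mdiff_inner hY' hZ),
    mvfderiv_fun_add (mdiff_inner hX hY) (mdiff_inner hX hY'),
    VectorField.mlieBracket_add_left hY hY', VectorField.mlieBracket_add_right hY hY']
  simp [inner_add_right, inner_add_left]
  ring

lemma koszul_smul {f : M → ℝ} {Y X Z : Π y : M, TangentSpace I y} {x : M}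
    (hf : MDifferentiableAt I 𝓘(ℝ, ℝ) f x) (hY : MDiffT Y x) (hX : MDiffT X x) (hZ : MDiffT Z x) :
    koszul (f • Y) X Z x =
      f x * koszul Y X Z x + 2 * (mvfderiv I f x (X x) * inner ℝ (Y x) (Z x)) := by
  have e1 : (fun y ↦ inner ℝ ((f • Y) y) (Z y)) = fun y ↦ f y * inner ℝ (Y y) (Z y) := by
    ext y; simp [inner_smul_left]
  have e2 : (fun y ↦ inner ℝ (X y) ((f • Y) y)) = fun y ↦ f y * inner ℝ (X y) (Y y) := by
    ext y; simp [inner_smul_right]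
  simp only [koszul]
  rw [e1, e2, mvfderiv_fun_mul hf (mdiff_inner hY hZ), mvfderiv_fun_mul hf (mdiff_inner hX hY),
    VectorField.mlieBracket_smul_left hf hY, VectorField.mlieBracket_smul_right hf hY]
  simp [inner_smul_right, inner_smul_left, inner_add_left, real_inner_comm]
  ring

lemma mdiffT_extendT {x : M} (v : TangentSpace I x) : MDiffT (extendT v) x :=
  FiberBundle.mdifferentiableAt_extend I E v

/-- Koszul's expression as a bilinear form on the tangent space at `x`. -/
def koszulForm {Y : Π y : M, TangentSpace I y} {x : M} (hY : MDiffT Y x) :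
    TangentSpace I x →L[ℝ] TangentSpace I x →L[ℝ] ℝ :=
  TensorialAt.mkHom₂ (I := I) (F := E) (F' := E) (fun X Z ↦ koszul Y X Z x) x
    (fun _ hZ ↦ koszul_tensorial_X hY hZ) (fun _ hX ↦ koszul_tensorial_Z hY hX)

lemma koszulForm_apply {Y X Z : Π y : M, TangentSpace I y} {x : M} (hY : MDiffT Y x)
    (hX : MDiffT X x) (hZ : MDiffT Z x) : koszulForm hY (X x) (Z x) = koszul Y X Z x :=
  TensorialAt.mkHom₂_apply _ _ hX hZ

open Classical in
/-- The Levi-Civita derivative `v ↦ ∇_v Y` at `x`, determined by Koszul's formula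
`2⟨∇_v Y, w⟩ = koszul Y v w`, for a vector field `Y` that is differentiable at `x`. -/
def leviCivitaFun (Y : Π y : M, TangentSpace I y) (x : M) :
    TangentSpace I x →L[ℝ] TangentSpace I x :=
  if hY : MDiffT Y x then
    (1 / 2 : ℝ) • (((InnerProductSpace.toDual ℝ
      (TangentSpace I x)).symm.toContinuousLinearEquiv.toContinuousLinearMap).comp (koszulForm hY))
  else 0

lemma inner_leviCivitaFun {Y X Z : Π y : M, TangentSpace I y} {x : M} (hY : MDiffT Y x)
    (hX : MDiffT X x) (hZ : MDiffT Z x) :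
    inner ℝ (leviCivitaFun Y x (X x)) (Z x) = 1 / 2 * koszul Y X Z x := by
  rw [leviCivitaFun, dif_pos hY]
  simp [inner_smul_left, koszulForm_apply hY hX hZ]

lemma inner_leviCivitaFun' {Y : Π y : M, TangentSpace I y} {x : M} (hY : MDiffT Y x)
    (v w : TangentSpace I x) :
    inner ℝ (leviCivitaFun Y x v) w = 1 / 2 * koszul Y (extendT v) (extendT w) x := by
  simpa using inner_leviCivitaFun hY (mdiffT_extendT v) (mdiffT_extendT w)

variable (I M) in
/-- The Levi-Civita connection of a Riemannian manifold. -/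
def leviCivita : CovariantDerivative I E (fun x : M ↦ TangentSpace I x) where
  toFun := leviCivitaFun
  isCovariantDerivativeOnUniv :=
    { add := by
        intro Y Y' x hY hY' _
        ext v
        refine ext_inner_right ℝ fun w ↦ ?_
        rw [add_apply, inner_add_left, inner_leviCivitaFun' hY,
          inner_leviCivitaFun' hY', inner_leviCivitaFun' (mdifferentiableAt_add_section hY hY'),
          koszul_add hY hY' (mdiffT_extendT v) (mdiffT_extendT w)]
        ring
      leibniz := by
        intro Y f x hY hf _
        ext v
        refine ext_inner_right ℝ fun w ↦ ?_
        rw [inner_leviCivitaFun' (hf.smul_section hY),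
          koszul_smul hf hY (mdiffT_extendT v) (mdiffT_extendT w)]
        simp only [add_apply, smul_apply, inner_add_left,
          inner_smul_left, inner_leviCivitaFun' hY, ContinuousLinearMap.smulRight_apply,
          FiberBundle.extend_apply_self, RCLike.conj_to_real]
        ring }

/-- The Levi-Civita connection is torsion free. -/
lemma leviCivita_torsion : (leviCivita I M).torsion = 0 := by
  rw [CovariantDerivative.torsion_eq_zero_iff]
  intro X Y x hX hY
  refine ext_inner_right ℝ fun w ↦ ?_
  have h1 := inner_leviCivitaFun hY hX (mdiffT_extendT w)
  have h2 := inner_leviCivitaFun hX hY (mdiffT_extendT w)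
  have hw : extendT w x = w := FiberBundle.extend_apply_self _ _
  rw [hw] at h1 h2
  rw [inner_sub_left]
  refine (congrArg₂ (· - ·) h1 h2).trans ?_
  simp only [koszul]
  have e : (fun y ↦ inner ℝ (Y y) (X y)) = fun y ↦ inner ℝ (X y) (Y y) := by
    ext y; exact real_inner_comm _ _
  rw [e, VectorField.mlieBracket_swap_apply (V := Y) (W := X)]
  rw [hw]
  simp only [inner_neg_left]
  ring

/-- The Levi-Civita connection is compatible with the metric. -/
lemma leviCivita_metric {X Y Z : Π y : M, TangentSpace I y} {x : M}
    (hX : MDiffT X x) (hY : MDiffT Y x) (hZ : MDiffT Z x) :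
    mvfderiv I (fun y ↦ inner ℝ (Y y) (Z y)) x (X x) =
      inner ℝ (leviCivita I M Y x (X x)) (Z x) + inner ℝ (Y x) (leviCivita I M Z x (X x)) := by
  have h1 := inner_leviCivitaFun hY hX hZ
  have h2 := inner_leviCivitaFun hZ hX hY
  rw [real_inner_comm] at h2
  refine Eq.trans ?_ (congrArg₂ (· + ·) h1 h2).symm
  simp only [koszul]
  have e : (fun y ↦ inner ℝ (Z y) (Y y)) = fun y ↦ inner ℝ (Y y) (Z y) := by
    ext y; exact real_inner_comm _ _
  rw [e, VectorField.mlieBracket_swap_apply (V := Z) (W := Y)]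
  simp only [inner_neg_left]
  ring

end Riemannian

/-! ### Curvature, energies and stress-energy tensors -/

section Curvature

variable {E : Type*} [NormedAddCommGroup E] [NormedSpace ℝ E] [FiniteDimensional ℝ E]
  {H : Type*} [TopologicalSpace H] {I : ModelWithCorners ℝ E H}
  {M : Type*} [TopologicalSpace M] [ChartedSpace H M] [IsManifold I ∞ M]
  {F : Type*} [NormedAddCommGroup F] [NormedSpace ℝ F]
  {V : M → Type*} [TopologicalSpace (Bundle.TotalSpace F V)]
  [∀ x, TopologicalSpace (V x)] [∀ x, AddCommGroup (V x)] [∀ x, Module ℝ (V x)]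
  [∀ x, IsTopologicalAddGroup (V x)] [∀ x, ContinuousSMul ℝ (V x)]
  [FiberBundle F V]

/-- The curvature `R_{u,w} s = ∇_X ∇_Y σ - ∇_Y ∇_X σ - ∇_{[X,Y]} σ` at `x`, where `X`, `Y`, `σ` are
extensions of `u`, `w`, `s` that are smooth near `x`; for a smooth connection it does not depend on
the extensions. -/
def curvature (cov : CovariantDerivative I F V) (x : M) (u w : TangentSpace I x) (s : V x) : V x :=
  cov (fun y ↦ cov (FiberBundle.extend F s) y (extendT w y)) x u
  - cov (fun y ↦ cov (FiberBundle.extend F s) y (extendT u y)) x w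
  - cov (FiberBundle.extend F s) x (VectorField.mlieBracket I (extendT u) (extendT w) x)

variable [∀ x, FiniteDimensional ℝ (V x)] [Bundle.RiemannianBundle V]

/-- The inner product `⟨S, U⟩ = trace (Sᵀ ∘ U) = ∑ₐ ⟨S εₐ, U εₐ⟩` of endomorphisms of a fibre, where
`(εₐ)` is an orthonormal basis of the fibre. -/
def homInner {x : M} (S U : V x → V x) : ℝ :=
  ∑ a, inner ℝ (S (stdOrthonormalBasis ℝ (V x) a)) (U (stdOrthonormalBasis ℝ (V x) a))

variable [Bundle.RiemannianBundle (fun x : M ↦ TangentSpace I x)]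

variable (I) in
/-- An orthonormal basis of the tangent space at `x`. -/
abbrev onb (x : M) := stdOrthonormalBasis ℝ (TangentSpace I x)

/-- `‖R‖² = ∑_{i<j} ‖R_{e_i,e_j}‖²` at `x`. -/
def curvatureNormSq (cov : CovariantDerivative I F V) (x : M) : ℝ :=
  ∑ i, ∑ j ∈ Finset.Ioi i, homInner (curvature cov x (onb I x i) (onb I x j))
    (curvature cov x (onb I x i) (onb I x j))

/-- The inner product `⟨i_u R, i_w R⟩ = ∑ₖ ⟨R_{u,e_k}, R_{w,e_k}⟩` of the `1`-forms `i_u R`, `i_w R`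
at `x`. -/
def contractionInner (cov : CovariantDerivative I F V) (x : M) (u w : TangentSpace I x) : ℝ :=
  ∑ k, homInner (curvature cov x u (onb I x k)) (curvature cov x w (onb I x k))

/-- The stress-energy tensor of the exponential Yang-Mills functional. -/
def stressEnergy (cov : CovariantDerivative I F V) (x : M) (u w : TangentSpace I x) : ℝ :=
  Real.exp (curvatureNormSq cov x / 2) * (inner ℝ u w - contractionInner cov x u w)

/-- The stress-energy tensor of the normalized exponential Yang-Mills functional. -/
def normalizedStressEnergy (cov : CovariantDerivative I F V) (x : M)
    (u w : TangentSpace I x) : ℝ :=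
  (Real.exp (curvatureNormSq cov x / 2) - 1) * inner ℝ u w
    - Real.exp (curvatureNormSq cov x / 2) * contractionInner cov x u w

variable [IsContMDiffRiemannianBundle I ∞ E (fun x : M ↦ TangentSpace I x)]

/-- The covariant derivative `(∇_v S)(u, w)` at `x` of a `2`-tensor field `S`, for the Levi-Civita
connection. -/
def covDerivTensor (S : Π x : M, TangentSpace I x → TangentSpace I x → ℝ) (x : M)
    (v u w : TangentSpace I x) : ℝ :=
  mvfderiv I (fun y ↦ S y (extendT u y) (extendT w y)) x v
  - S x (leviCivita I M (extendT u) x v) w - S x u (leviCivita I M (extendT w) x v)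

/-- The divergence `(div S)(w) = ∑ᵢ (∇_{e_i} S)(e_i, w)` at `x`. -/
def divergence (S : Π x : M, TangentSpace I x → TangentSpace I x → ℝ) (x : M)
    (w : TangentSpace I x) : ℝ :=
  ∑ i, covDerivTensor S x (onb I x i) (onb I x i) w

/-- The tensor field `S` is differentiable and divergence free. -/
def IsDivergenceFree (S : Π x : M, TangentSpace I x → TangentSpace I x → ℝ) : Prop :=
  (∀ (x : M) (u w : TangentSpace I x),
    MDifferentiableAt I 𝓘(ℝ, ℝ) (fun y ↦ S y (extendT u y) (extendT w y)) x) ∧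
  ∀ (x : M) (w : TangentSpace I x), divergence S x w = 0

/-- The `e`-conservation law. -/
def EConservationLaw (cov : CovariantDerivative I F V) : Prop :=
  IsDivergenceFree (normalizedStressEnergy cov) ∧ IsDivergenceFree (stressEnergy cov)

end Curvature

section Energy

variable {n : ℕ} {M : Type*} [TopologicalSpace M] [ChartedSpace (Eu n) M] [IsManifold (𝓡 n) ∞ M]
  [Bundle.RiemannianBundle (fun x : M ↦ TangentSpace (𝓡 n) x)]

/-- The Gram matrix `g_ij = ⟨∂_i, ∂_j⟩` of the coordinate vector fields of the chart at `c`, at the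
point with coordinates `y`. -/
def gramMatrix (c : M) (y : Eu n) : Matrix (Fin n) (Fin n) ℝ := fun i j ↦
  inner ℝ (mfderiv (𝓡 n) (𝓡 n) (chartAt (Eu n) c).symm y (EuclideanSpace.single i (1 : ℝ)))
    (mfderiv (𝓡 n) (𝓡 n) (chartAt (Eu n) c).symm y (EuclideanSpace.single j (1 : ℝ)))

variable [MeasurableSpace M] [BorelSpace M]

/-- The measure `√(det g_ij) dy` in the chart at `c`, as a measure on `M` that is concentrated on
the domain of this chart. -/
def chartVolume (c : M) : Measure M :=
  ((volume.restrict (chartAt (Eu n) c).target).withDensity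
    (fun y ↦ ENNReal.ofReal (Real.sqrt (gramMatrix c y).det))).map (chartAt (Eu n) c).symm

variable (n M) in
/-- The Riemannian volume measure `dv`. The measures `√(det g_ij) dy` of two charts coincide on the
intersection of their domains; their supremum is the measure that restricts to each of them. -/
def riemannianVolume : Measure M := ⨆ c : M, chartVolume (n := n) c

variable {F : Type*} [NormedAddCommGroup F] [NormedSpace ℝ F]
  {V : M → Type*} [TopologicalSpace (Bundle.TotalSpace F V)]
  [∀ x, TopologicalSpace (V x)] [∀ x, AddCommGroup (V x)] [∀ x, Module ℝ (V x)]
  [∀ x, IsTopologicalAddGroup (V x)] [∀ x, ContinuousSMul ℝ (V x)]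
  [FiberBundle F V] [∀ x, FiniteDimensional ℝ (V x)] [Bundle.RiemannianBundle V]

/-- The exponential Yang-Mills energy on `K`: the integral of `exp (‖R‖² / 2)` over `K`. -/
def expEnergy (K : Set M) (cov : CovariantDerivative (𝓡 n) F V) : ℝ :=
  ∫ x in K, Real.exp (curvatureNormSq cov x / 2) ∂(riemannianVolume n M)

/-- The normalized exponential Yang-Mills energy on `K`. -/
def normalizedExpEnergy (K : Set M) (cov : CovariantDerivative (𝓡 n) F V) : ℝ :=
  ∫ x in K, (Real.exp (curvatureNormSq cov x / 2) - 1) ∂(riemannianVolume n M)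

/-- `∇` is a critical point of the functional `𝓔` with respect to the compactly supported variations
`∇ + t A` with `A ∈ 𝒜`. As the energy on `M` may be infinite, it is computed, as usual, on compact
sets `K` outside of which the connection is not varied. -/
def IsCriticalPoint (𝓔 : Set M → CovariantDerivative (𝓡 n) F V → ℝ)
    (𝒜 : Set (Π x : M, V x →L[ℝ] TangentSpace (𝓡 n) x →L[ℝ] V x))
    (cov : CovariantDerivative (𝓡 n) F V) : Prop :=
  ∀ A ∈ 𝒜, ∀ K : Set M, IsCompact K → (∀ x ∉ K, A x = 0) →
    HasDerivAt (fun t : ℝ ↦ 𝓔 K (cov.addOneForm (fun x ↦ t • A x))) 0 0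

variable (n F V) in
/-- The smooth `1`-forms on `M` with values in the endomorphisms of the vector bundle `V`, written
as `A x s v`, for `s` in the fibre and `v` a tangent vector. They are the differences of smooth
connections on `V`. -/
def endForms [VectorBundle ℝ F V] :
    Set (Π x : M, V x →L[ℝ] TangentSpace (𝓡 n) x →L[ℝ] V x) :=
  {A | ContMDiff (𝓡 n) ((𝓡 n).prod 𝓘(ℝ, F →L[ℝ] Eu n →L[ℝ] F)) ∞
    (fun x ↦ Bundle.TotalSpace.mk' (F →L[ℝ] Eu n →L[ℝ] F)
      (E := fun x : M ↦ V x →L[ℝ] TangentSpace (𝓡 n) x →L[ℝ] V x) x (A x))}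

end Energy

section AdForms

variable {n m d : ℕ} {M : Type*} [TopologicalSpace M] [ChartedSpace (Eu n) M]
  [IsManifold (𝓡 n) ∞ M]
  {G : Type*} [TopologicalSpace G] [ChartedSpace (Eu d) G] [Group G] [LieGroup (𝓡 d) ∞ G]
  {P : Type*} [TopologicalSpace P] [ChartedSpace (Eu m) P] [MulAction Gᵐᵒᵖ P]

/-- The smooth `1`-forms on `M` with values in `Ad(P)`, acting on `Ad(P)` through the bracket. -/
def PrincipalBundle.adForms (Q : PrincipalBundle n m d M G P) (κ : AdInvariantInner d G) :
    Set (Π x : M, Q.AdP κ x →L[ℝ] TangentSpace (𝓡 n) x →L[ℝ] Q.AdP κ x) :=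
  {A | ∃ a : Π x : M, TangentSpace (𝓡 n) x →L[ℝ] Q.AdP κ x,
    ContMDiff (𝓡 n) ((𝓡 n).prod 𝓘(ℝ, Eu n →L[ℝ] Eu d)) ∞
      (fun x ↦ Bundle.TotalSpace.mk' (Eu n →L[ℝ] Eu d)
        (E := fun x : M ↦ TangentSpace (𝓡 n) x →L[ℝ] Q.AdP κ x) x (a x)) ∧
    ∀ x s v, A x s v = Q.bracket κ (a x v) s}

end AdForms

end ExpYangMills

end

open ExpYangMills

/-! The conservation law is Noether's theorem for diffeomorphisms. Dragging a connection along a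
compactly supported vector field X, with g fixed, changes R by its Lie derivative; after integration
by parts, the vanishing of the first variation of the energy is the equation div S = 0 tested
against X.

No flows are needed, since only the infinitesimal variation enters and it can be written in one
chart. Let ∇ = d + Γ over the common domain of a chart and a trivialization, and let X = ψv with v
constant and ψ smooth with compact support there. The variation is L_XΓ = ψ ∂_vΓ + dψ ⊗ Γ(v)
(`lieVar`), extended by zero. It is i_X R plus the infinitesimal gauge transformation d_Γ(Γ(X)), and
its linearized curvature is L_X R (`linCurv_lieVar`).

Write f = exp(‖R‖²/2), C_ij = ⟨i_{b_i}R, i_{b_j}R⟩ and ρ for the volume density, with indices in a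
constant basis b and v = b_m. Since the fibre metric has constant coefficients in the
trivialization, which is where Ad-invariance enters, the first variation is ∫ f ⟨L_X R, R⟩ ρ
(`hasDerivAt_energy`). As ψ is arbitrary, integration by parts gives f ρ ⟨∂_m R, R⟩ = ∑ ∂_i(f ρ
g^{ia} C_ma) (`divergence_identity`). At the centre of the chart, with b orthonormal there, g = 1,
∂(g⁻¹) = -∂g and ∂ρ/ρ = ½ tr ∂g, and expanding the identity yields div S = 0
(`divergence_eq_zero_of_identity`, `divergence_algebra`). A constant subtracted from the energy
density does not affect this identity, and changing the constant in S adds a multiple of the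
parallel tensor g; so a critical point of either functional satisfies both laws.

Two things remain. The intrinsic objects have to be read in the chart: curvature
(`IsLocalRep.fibVec_curvature`), its norm (`IsConstMetric.curvatureNormSq_eq`), volume
(`setIntegral_riemannianVolume`) and the Levi-Civita derivative (`covDerivTensor_eq`). And L_XΓ has
to be admissible. In case (a) smoothness and compact support suffice. In case (b) Γ takes values in
the image of ad; this is a linear subspace, so L_XΓ takes values in it too, and a linear section of
ad lifts it to a form with values in Ad(P) (`IsInducedBy.exists_mem_adForms`). -/

noncomputable section

set_option linter.unusedSectionVars false

namespace ExpYangMills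

/-! ### Coordinate vector fields and derivatives in a chart -/

section Chart

variable {n : ℕ} {M : Type*} [TopologicalSpace M] [ChartedSpace (Eu n) M] [IsManifold (𝓡 n) ∞ M]
  {W : Type*} [NormedAddCommGroup W] [NormedSpace ℝ W]

/-- The coordinate vector field with constant components `u` in the chart at `c`. -/
def coordField (c : M) (u : Eu n) (y : M) : TangentSpace (𝓡 n) y :=
  (trivializationAt (Eu n) (TangentSpace (𝓡 n)) c).symmL ℝ y u

/-- The components of a tangent vector in the chart at `c`. -/
def coordVec (c : M) (y : M) : TangentSpace (𝓡 n) y →L[ℝ] Eu n :=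
  (trivializationAt (Eu n) (TangentSpace (𝓡 n)) c).continuousLinearMapAt ℝ y

lemma coordField_eq (c : M) (u : Eu n) {y : M} (hy : y ∈ (chartAt (Eu n) c).source) :
    coordField c u y = mfderiv (𝓡 n) (𝓡 n) (chartAt (Eu n) c).symm (chartAt (Eu n) c y) u := by
  unfold coordField
  rw [TangentBundle.symmL_trivializationAt hy]
  simp [mfderivWithin_univ, mfld_simps]
  rfl

lemma coordVec_eq (c : M) {y : M} (hy : y ∈ (chartAt (Eu n) c).source) :
    coordVec c y = mfderiv (𝓡 n) (𝓡 n) (chartAt (Eu n) c) y := by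
  unfold coordVec
  rw [TangentBundle.continuousLinearMapAt_trivializationAt hy]
  simp [mfld_simps]
  rfl

lemma coordVec_coordField (c : M) (u : Eu n) {y : M} (hy : y ∈ (chartAt (Eu n) c).source) :
    coordVec c y (coordField c u y) = u :=
  Bundle.Trivialization.continuousLinearMapAt_symmL _ (by simpa using hy) u

lemma coordField_coordVec (c : M) {y : M} (hy : y ∈ (chartAt (Eu n) c).source)
    (v : TangentSpace (𝓡 n) y) : coordField c (coordVec c y v) y = v :=
  Bundle.Trivialization.symmL_continuousLinearMapAt _ (by simpa using hy) v

lemma coordField_add (c : M) (u w : Eu n) (y : M) :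
    coordField c (u + w) y = coordField c u y + coordField c w y := map_add _ _ _

lemma coordField_smul (c : M) (r : ℝ) (u : Eu n) (y : M) :
    coordField c (r • u) y = r • coordField c u y := map_smul _ _ _

/-- A tangent space is the model space read through the preferred chart at its point, so that chart
has identity derivative at its own centre. -/
lemma coordVec_self (c : M) (v : TangentSpace (𝓡 n) c) : coordVec c c v = v := by
  unfold coordVec
  rw [TangentBundle.continuousLinearMapAt_trivializationAt (mem_chart_source _ c)]
  rw [mfderiv_extChartAt_self]
  rfl

/-- `FiberBundle.extend` keeps the components constant in the preferred trivialization at the base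
point. Hence the extensions in the definitions of curvature and divergence are coordinate fields
near that point. -/
lemma extendT_eq {c : M} (v : TangentSpace (𝓡 n) c) {y : M} (hy : y ∈ (chartAt (Eu n) c).source) :
    extendT v y = coordField c (coordVec c c v) y := by
  have hb : y ∈ (trivializationAt (Eu n) (TangentSpace (𝓡 n)) c).baseSet := by simpa using hy
  have hc : c ∈ (trivializationAt (Eu n) (TangentSpace (𝓡 n)) c).baseSet := by simp
  unfold coordField coordVec
  rw [Bundle.Trivialization.continuousLinearMapAt_apply_of_mem ℝ _ hc,
    Bundle.Trivialization.symmL_apply _ hb]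
  rfl

lemma mdifferentiableAt_chart (c : M) {y : M} (hy : y ∈ (chartAt (Eu n) c).source) :
    MDifferentiableAt (𝓡 n) (𝓡 n) (chartAt (Eu n) c) y :=
  mdifferentiableAt_atlas (chart_mem_atlas _ c) hy

lemma contMDiffAt_chart (c : M) {y : M} (hy : y ∈ (chartAt (Eu n) c).source) :
    ContMDiffAt (𝓡 n) (𝓡 n) ∞ (chartAt (Eu n) c) y :=
  (contMDiffOn_chart.contMDiffAt ((chartAt (Eu n) c).open_source.mem_nhds hy))

lemma contMDiffAt_chart_symm (c : M) {p : Eu n} (hp : p ∈ (chartAt (Eu n) c).target) :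
    ContMDiffAt (𝓡 n) (𝓡 n) ∞ (chartAt (Eu n) c).symm p :=
  (contMDiffOn_chart_symm.contMDiffAt ((chartAt (Eu n) c).open_target.mem_nhds hp))

lemma contMDiffAt_iff_chart (c : M) {y : M} (hy : y ∈ (chartAt (Eu n) c).source) {f : M → W} {k : ℕ∞} :
    ContMDiffAt (𝓡 n) 𝓘(ℝ, W) k f y ↔
      ContDiffAt ℝ k (f ∘ (chartAt (Eu n) c).symm) (chartAt (Eu n) c y) := by
  have hk : (k : WithTop ℕ∞) ≤ ∞ := by exact_mod_cast le_top
  rw [← contMDiffAt_iff_contDiffAt]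
  have ht := (chartAt (Eu n) c).map_source hy
  constructor
  · intro h
    refine ContMDiffAt.comp (I' := 𝓡 n) _ ?_ ((contMDiffAt_chart_symm c ht).of_le hk)
    rwa [(chartAt (Eu n) c).left_inv hy]
  · intro h
    refine (h.comp y ((contMDiffAt_chart c hy).of_le hk)).congr_of_eventuallyEq ?_
    filter_upwards [(chartAt (Eu n) c).open_source.mem_nhds hy] with z hz
    simp [(chartAt (Eu n) c).left_inv hz]

lemma mdifferentiableAt_iff_chart (c : M) {y : M} (hy : y ∈ (chartAt (Eu n) c).source) {f : M → W} :
    MDifferentiableAt (𝓡 n) 𝓘(ℝ, W) f y ↔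
      DifferentiableAt ℝ (f ∘ (chartAt (Eu n) c).symm) (chartAt (Eu n) c y) := by
  rw [← mdifferentiableAt_iff_differentiableAt]
  have ht := (chartAt (Eu n) c).map_source hy
  constructor
  · intro h
    refine MDifferentiableAt.comp (I' := 𝓡 n) _ ?_
      ((contMDiffAt_chart_symm c ht).mdifferentiableAt (by simp))
    rwa [(chartAt (Eu n) c).left_inv hy]
  · intro h
    refine (h.comp y ((contMDiffAt_chart c hy).mdifferentiableAt (by simp))).congr_of_eventuallyEq ?_
    filter_upwards [(chartAt (Eu n) c).open_source.mem_nhds hy] with z hz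
    simp [(chartAt (Eu n) c).left_inv hz]

lemma mvfderiv_eq_fderiv_chart (c : M) {y : M} (hy : y ∈ (chartAt (Eu n) c).source) {f : M → W}
    (hf : MDifferentiableAt (𝓡 n) 𝓘(ℝ, W) f y) (v : TangentSpace (𝓡 n) y) :
    mvfderiv (𝓡 n) f y v =
      fderiv ℝ (f ∘ (chartAt (Eu n) c).symm) (chartAt (Eu n) c y) (coordVec c y v) := by
  have ht := (chartAt (Eu n) c).map_source hy
  have hl := (chartAt (Eu n) c).left_inv hy
  conv_lhs => rw [← coordField_coordVec c hy v]
  rw [coordField_eq c _ hy, ← mfderiv_eq_fderiv]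
  have := mfderiv_comp_apply (I := 𝓡 n) (I' := 𝓡 n) (I'' := 𝓘(ℝ, W)) (chartAt (Eu n) c y)
    (g := f) (f := (chartAt (Eu n) c).symm) (by rwa [hl])
    ((contMDiffAt_chart_symm c ht).mdifferentiableAt (by simp)) (coordVec c y v)
  rw [hl] at this
  exact this.symm

lemma mvfderiv_coordField (c : M) {y : M} (hy : y ∈ (chartAt (Eu n) c).source) {f : M → W}
    (hf : MDifferentiableAt (𝓡 n) 𝓘(ℝ, W) f y) (u : Eu n) :
    mvfderiv (𝓡 n) f y (coordField c u y) =
      fderiv ℝ (f ∘ (chartAt (Eu n) c).symm) (chartAt (Eu n) c y) u := by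
  rw [mvfderiv_eq_fderiv_chart c hy hf, coordVec_coordField c u hy]

lemma mdiffT_iff (c : M) {y : M} (hy : y ∈ (chartAt (Eu n) c).source)
    {X : Π y : M, TangentSpace (𝓡 n) y} :
    MDiffT X y ↔ MDifferentiableAt (𝓡 n) 𝓘(ℝ, Eu n) (fun z ↦ coordVec c z (X z)) y := by
  have hb : y ∈ (trivializationAt (Eu n) (TangentSpace (𝓡 n)) c).baseSet := by simpa using hy
  rw [MDiffT, (trivializationAt (Eu n) (TangentSpace (𝓡 n)) c).mdifferentiableAt_section_iff _ X hb]
  refine Filter.EventuallyEq.mdifferentiableAt_iff ?_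
  filter_upwards [(trivializationAt (Eu n) (TangentSpace (𝓡 n)) c).open_baseSet.mem_nhds hb] with z hz
  simp only [coordVec]
  rw [Bundle.Trivialization.continuousLinearMapAt_apply,
    Bundle.Trivialization.coe_linearMapAt_of_mem _ hz]

lemma contMDiffAt_coordField (c : M) (u : Eu n) {y : M} (hy : y ∈ (chartAt (Eu n) c).source) :
    ContMDiffAt (𝓡 n) ((𝓡 n).prod 𝓘(ℝ, Eu n)) ∞
      (fun y ↦ Bundle.TotalSpace.mk' (Eu n) y (coordField c u y)) y := by
  have hb : y ∈ (trivializationAt (Eu n) (TangentSpace (𝓡 n)) c).baseSet := by simpa using hy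
  rw [(trivializationAt (Eu n) (TangentSpace (𝓡 n)) c).contMDiffAt_section_iff hb]
  refine (contMDiffAt_const (c := u)).congr_of_eventuallyEq ?_
  filter_upwards [(trivializationAt (Eu n) (TangentSpace (𝓡 n)) c).open_baseSet.mem_nhds hb] with z hz
  unfold coordField
  rw [Bundle.Trivialization.symmL_apply _ hz, Bundle.Trivialization.apply_mk_symm _ hz]

lemma mdiffT_coordField (c : M) (u : Eu n) {y : M} (hy : y ∈ (chartAt (Eu n) c).source) :
    MDiffT (coordField c u) y :=
  (contMDiffAt_coordField c u hy).mdifferentiableAt (by simp)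

/-- Coordinate fields are pullbacks of constant fields under the chart, and pullback commutes with
the Lie bracket. -/
lemma mlieBracket_coordField (c : M) (u w : Eu n) {y : M} (hy : y ∈ (chartAt (Eu n) c).source) :
    VectorField.mlieBracket (𝓡 n) (coordField c u) (coordField c w) y = 0 := by
  have key (u : Eu n) : coordField c u =ᶠ[𝓝 y]
      VectorField.mpullback (𝓡 n) (𝓡 n) (chartAt (Eu n) c) (fun _ ↦ u) := by
    filter_upwards [(chartAt (Eu n) c).open_source.mem_nhds hy] with z hz
    have h1 : coordVec c z = ((trivializationAt (Eu n) (TangentSpace (𝓡 n)) c).continuousLinearEquivAt ℝ z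
      (by simpa using hz) : TangentSpace (𝓡 n) z →L[ℝ] Eu n) := by
      refine ContinuousLinearMap.ext fun v ↦ ?_
      exact Bundle.Trivialization.continuousLinearMapAt_apply_of_mem ℝ _ (by simpa using hz) v
    have h2 := (coordVec_eq c hz).symm.trans h1
    -- A pullback applies the inverse of the derivative of the chart, and this derivative is the
    -- trivialization that `coordField` inverts.
    refine (?_ : _ = (mfderiv (𝓡 n) (𝓡 n) (chartAt (Eu n) c) z).inverse u)
    erw [h2, ContinuousLinearMap.inverse_equiv]
    exact Bundle.Trivialization.symmL_apply _ (by simpa using hz) u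
  rw [(key u).mlieBracket_vectorField_eq (key w)]
  have hs (u : Eu n) (p : Eu n): MDifferentiableAt (𝓡 n) ((𝓡 n).prod 𝓘(ℝ, Eu n))
      (fun y : Eu n ↦ Bundle.TotalSpace.mk' (Eu n) (E := fun y : Eu n ↦ TangentSpace (𝓡 n) y) y u) p := by
    have := (contMDiffAt_vectorSpace_iff_contDiffAt (𝕜 := ℝ) (n := 1) (E := Eu n)
      (V := fun _ ↦ u) (x := p)).2 contDiffAt_const
    exact this.mdifferentiableAt (by simp)
  have : IsManifold (𝓡 n) (minSmoothness ℝ 2) M := by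
    simp only [minSmoothness_of_isRCLikeNormedField]; infer_instance
  have hm : (minSmoothness ℝ 2) ≤ (∞ : WithTop ℕ∞) := by
    simp only [minSmoothness_of_isRCLikeNormedField]; exact WithTop.coe_le_coe.2 le_top
  rw [← VectorField.mpullback_mlieBracket (hs u _) (hs w _) (contMDiffAt_chart c hy) hm]
  have h0 (V W : Eu n → Eu n) (p : Eu n) (hV : fderiv ℝ V p = 0) (hW : fderiv ℝ W p = 0) :
      VectorField.lieBracket ℝ V W p = 0 := by
    simp [VectorField.lieBracket, hV, hW]
  have h1 (V W : Π x : Eu n, TangentSpace 𝓘(ℝ, Eu n) x) (p : Eu n)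
      (hV : fderiv ℝ (V : Eu n → Eu n) p = 0) (hW : fderiv ℝ (W : Eu n → Eu n) p = 0) :
      VectorField.mlieBracket 𝓘(ℝ, Eu n) V W p = 0 := by
    rw [← VectorField.mlieBracketWithin_univ, VectorField.mlieBracketWithin_eq_lieBracketWithin]
    exact (congrFun VectorField.lieBracketWithin_univ p).trans (h0 V W p hV hW)
  refine (congrArg _ (h1 (fun _ ↦ u) (fun _ ↦ w) _ (fderiv_const_apply u)
    (fderiv_const_apply w))).trans (map_zero _)

end Chart

/-! ### Trivializations and local connection forms -/

section LocalRep

variable {n : ℕ} {M : Type*} [TopologicalSpace M] [ChartedSpace (Eu n) M] [IsManifold (𝓡 n) ∞ M]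
  {F : Type*} [NormedAddCommGroup F] [NormedSpace ℝ F]
  {V : M → Type*} [TopologicalSpace (Bundle.TotalSpace F V)]
  [∀ x, TopologicalSpace (V x)] [∀ x, AddCommGroup (V x)] [∀ x, Module ℝ (V x)]
  [∀ x, IsTopologicalAddGroup (V x)] [∀ x, ContinuousSMul ℝ (V x)]
  [FiberBundle F V] [VectorBundle ℝ F V]

variable (n F) in
/-- The section `σ` is differentiable at `y`. -/
abbrev MDiffS (σ : Π x, V x) (y : M) : Prop :=
  MDifferentiableAt (𝓡 n) ((𝓡 n).prod 𝓘(ℝ, F)) (fun y ↦ Bundle.TotalSpace.mk' F y (σ y)) y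

variable (n F) in
/-- The section `σ` is smooth at `y`. -/
abbrev SmoothS (σ : Π x, V x) (y : M) : Prop :=
  ContMDiffAt (𝓡 n) ((𝓡 n).prod 𝓘(ℝ, F)) ∞ (fun y ↦ Bundle.TotalSpace.mk' F y (σ y)) y

/-- The components of a vector of `V` in the trivialization at `c`. -/
def fibVec (F : Type*) [NormedAddCommGroup F] [NormedSpace ℝ F]
    {V : M → Type*} [TopologicalSpace (Bundle.TotalSpace F V)]
    [∀ x, TopologicalSpace (V x)] [∀ x, AddCommGroup (V x)] [∀ x, Module ℝ (V x)]
    [FiberBundle F V] [VectorBundle ℝ F V] (c y : M) : V y →L[ℝ] F :=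
  (trivializationAt F V c).continuousLinearMapAt ℝ y

/-- The section of `V` with constant components `s` in the trivialization at `c`. -/
def fibSec (V : M → Type*) [TopologicalSpace (Bundle.TotalSpace F V)]
    [∀ x, TopologicalSpace (V x)] [∀ x, AddCommGroup (V x)] [∀ x, Module ℝ (V x)]
    [FiberBundle F V] [VectorBundle ℝ F V] (c : M) (s : F) (y : M) : V y :=
  (trivializationAt F V c).symmL ℝ y s

variable (n F V) in
/-- The common domain of the chart and of the trivialization at `c`. -/
def dom (c : M) : Set M := (chartAt (Eu n) c).source ∩ (trivializationAt F V c).baseSet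

variable (n F V) in
/-- The image of `dom` in the chart at `c`. -/
def cdom (c : M) : Set (Eu n) :=
  (chartAt (Eu n) c).target ∩ (chartAt (Eu n) c).symm ⁻¹' (trivializationAt F V c).baseSet

variable (n) in
/-- The components of a section in the trivialization and the chart at `c`. -/
def locSec (F : Type*) [NormedAddCommGroup F] [NormedSpace ℝ F]
    {V : M → Type*} [TopologicalSpace (Bundle.TotalSpace F V)]
    [∀ x, TopologicalSpace (V x)] [∀ x, AddCommGroup (V x)] [∀ x, Module ℝ (V x)]
    [FiberBundle F V] [VectorBundle ℝ F V] (c : M) (σ : Π x, V x) (p : Eu n) : F :=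
  fibVec F c ((chartAt (Eu n) c).symm p) (σ ((chartAt (Eu n) c).symm p))

lemma isOpen_dom (c : M) : IsOpen (dom n F V c) :=
  (chartAt (Eu n) c).open_source.inter (trivializationAt F V c).open_baseSet

lemma isOpen_cdom (c : M) : IsOpen (cdom n F V c) :=
  (chartAt (Eu n) c).isOpen_inter_preimage_symm (trivializationAt F V c).open_baseSet

lemma mem_dom_self (c : M) : c ∈ dom n F V c :=
  ⟨mem_chart_source _ c, FiberBundle.mem_baseSet_trivializationAt' c⟩

lemma chart_mem_cdom {c y : M} (hy : y ∈ dom n F V c) : chartAt (Eu n) c y ∈ cdom n F V c :=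
  ⟨(chartAt (Eu n) c).map_source hy.1, by
    rw [Set.mem_preimage, (chartAt (Eu n) c).left_inv hy.1]; exact hy.2⟩

lemma chart_symm_mem_dom {c : M} {p : Eu n} (hp : p ∈ cdom n F V c) :
    (chartAt (Eu n) c).symm p ∈ dom n F V c :=
  ⟨(chartAt (Eu n) c).map_target hp.1, hp.2⟩

lemma fibVec_fibSec {c y : M} (hy : y ∈ (trivializationAt F V c).baseSet) (s : F) :
    fibVec F c y (fibSec V c s y) = s :=
  Bundle.Trivialization.continuousLinearMapAt_symmL _ hy s

lemma fibSec_fibVec {c y : M} (hy : y ∈ (trivializationAt F V c).baseSet) (v : V y) :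
    fibSec V c (fibVec F c y v) y = v :=
  Bundle.Trivialization.symmL_continuousLinearMapAt _ hy v

lemma fibSec_add (c : M) (s t : F) (y : M) :
    fibSec V c (s + t) y = fibSec V c s y + fibSec V c t y := map_add _ _ _

lemma fibSec_smul (c : M) (r : ℝ) (s : F) (y : M) :
    fibSec V c (r • s) y = r • fibSec V c s y := map_smul _ _ _

section
variable [ContMDiffVectorBundle ∞ F V (𝓡 n)]

lemma mdiffS_iff {c y : M} (hy : y ∈ dom n F V c) {σ : Π x, V x} :
    MDiffS n F σ y ↔ DifferentiableAt ℝ (locSec n F c σ) (chartAt (Eu n) c y) := by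
  rw [MDiffS, (trivializationAt F V c).mdifferentiableAt_section_iff _ σ hy.2]
  refine Iff.trans ?_ (mdifferentiableAt_iff_chart c hy.1 (f := fun z ↦ fibVec F c z (σ z)))
  refine Filter.EventuallyEq.mdifferentiableAt_iff ?_
  filter_upwards [(trivializationAt F V c).open_baseSet.mem_nhds hy.2] with z hz
  exact (Bundle.Trivialization.continuousLinearMapAt_apply_of_mem ℝ _ hz _).symm

lemma contMDiffAt_sec_iff {c y : M} (hy : y ∈ dom n F V c) {σ : Π x, V x} :
    SmoothS n F σ y ↔ ContDiffAt ℝ ∞ (locSec n F c σ) (chartAt (Eu n) c y) := by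
  rw [SmoothS, (trivializationAt F V c).contMDiffAt_section_iff hy.2]
  refine Iff.trans ?_ (contMDiffAt_iff_chart c hy.1 (f := fun z ↦ fibVec F c z (σ z)) (k := ⊤))
  refine Filter.EventuallyEq.contMDiffAt_iff ?_
  filter_upwards [(trivializationAt F V c).open_baseSet.mem_nhds hy.2] with z hz
  exact (Bundle.Trivialization.continuousLinearMapAt_apply_of_mem ℝ _ hz _).symm

lemma locSec_fibSec (c : M) (s : F) {p : Eu n} (hp : p ∈ cdom n F V c) :
    locSec n F c (fibSec V c s) p = s := fibVec_fibSec hp.2 s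

lemma locSec_fibSec_eventuallyEq {c y : M} (s : F) (hy : y ∈ dom n F V c) :
    locSec n F c (fibSec V c s) =ᶠ[𝓝 (chartAt (Eu n) c y)] fun _ ↦ s := by
  filter_upwards [(isOpen_cdom c).mem_nhds (chart_mem_cdom hy)] with p hp
  exact locSec_fibSec c s hp

lemma smoothS_fibSec {c y : M} (s : F) (hy : y ∈ dom n F V c) : SmoothS n F (fibSec V c s) y := by
  rw [contMDiffAt_sec_iff hy]
  exact contDiffAt_const.congr_of_eventuallyEq (locSec_fibSec_eventuallyEq s hy)

lemma mdiffS_fibSec {c y : M} (s : F) (hy : y ∈ dom n F V c) : MDiffS n F (fibSec V c s) y :=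
  (smoothS_fibSec s hy).mdifferentiableAt (by simp)

end

/-- In the chart and the trivialization at `c`, the covariant derivative is `d + Γ`. -/
def IsLocalRep (cov : CovariantDerivative (𝓡 n) F V) (c : M)
    (Γ : Eu n → (Eu n →L[ℝ] F →L[ℝ] F)) : Prop :=
  ∀ (σ : Π x, V x) (y : M), y ∈ dom n F V c → MDiffS n F σ y → ∀ u : Eu n,
    fibVec F c y (cov σ y (coordField c u y)) =
      fderiv ℝ (locSec n F c σ) (chartAt (Eu n) c y) u +
        Γ (chartAt (Eu n) c y) u (fibVec F c y (σ y))

section Exists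

variable [ContMDiffVectorBundle ∞ F V (𝓡 n)] [FiniteDimensional ℝ F]

/-- The trivial connection of the trivialization at `c`. -/
def trivialCov (n : ℕ) {M : Type*} [TopologicalSpace M] [ChartedSpace (Eu n) M]
    (F : Type*) [NormedAddCommGroup F] [NormedSpace ℝ F]
    (V : M → Type*) [TopologicalSpace (Bundle.TotalSpace F V)]
    [∀ x, TopologicalSpace (V x)] [∀ x, AddCommGroup (V x)] [∀ x, Module ℝ (V x)]
    [FiberBundle F V] [VectorBundle ℝ F V] (c : M) (σ : Π x, V x) (y : M) :
    TangentSpace (𝓡 n) y →L[ℝ] V y :=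
  ((trivializationAt F V c).symmL ℝ y).comp (mvfderiv (𝓡 n) (fun z ↦ fibVec F c z (σ z)) y)

lemma mdiffS_iff' {c y : M} (hy : y ∈ dom n F V c) {σ : Π x, V x} :
    MDiffS n F σ y ↔ MDifferentiableAt (𝓡 n) 𝓘(ℝ, F) (fun z ↦ fibVec F c z (σ z)) y := by
  rw [mdiffS_iff hy]
  exact (mdifferentiableAt_iff_chart c hy.1 (f := fun z ↦ fibVec F c z (σ z))).symm

lemma isCovariantDerivativeOn_trivialCov (c : M) :
    IsCovariantDerivativeOn F (trivialCov n F V c) (dom n F V c) where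
  add {σ σ' y} hσ hσ' hy := by
    have := mvfderiv_fun_add ((mdiffS_iff' hy).1 hσ) ((mdiffS_iff' hy).1 hσ')
    simp only [trivialCov, Pi.add_apply, map_add, this, ContinuousLinearMap.comp_add]
  leibniz {σ g y} hσ hg hy := by
    have := mvfderiv_fun_smul hg ((mdiffS_iff' hy).1 hσ)
    have h2 : (trivializationAt F V c).symmL ℝ y (fibVec F c y (σ y)) = σ y := fibSec_fibVec hy.2 _
    ext v
    simp [trivialCov, this, h2]

/-- The components of a field of bilinear maps `V × TM → V` in the trivialization at `c`. -/
def bilinRep (D : Π y : M, V y →L[ℝ] TangentSpace (𝓡 n) y →L[ℝ] V y) (c y : M) :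
    Eu n →L[ℝ] F →L[ℝ] F :=
  LinearMap.toContinuousBilinearMap (LinearMap.mk₂ ℝ (fun (u : Eu n) (s : F) ↦
    fibVec F c y (D y (fibSec V c s y) (coordField c u y)))
    (fun u w s ↦ by rw [coordField_add, map_add, map_add])
    (fun r u s ↦ by rw [coordField_smul, map_smul, map_smul])
    (fun u s t ↦ by rw [fibSec_add, map_add, add_apply, map_add])
    (fun r u s ↦ by rw [fibSec_smul, map_smul, smul_apply, map_smul]))

lemma bilinRep_apply (D : Π y : M, V y →L[ℝ] TangentSpace (𝓡 n) y →L[ℝ] V y) (c y : M)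
    (u : Eu n) (s : F) :
    bilinRep D c y u s = fibVec F c y (D y (fibSec V c s y) (coordField c u y)) := rfl

/-- Two covariant derivatives differ by a tensor, so `Γ` is the difference from the trivial
connection of the trivialization. Smoothness of `Γ` needs a smooth connection and is proved
separately. -/
lemma exists_isLocalRep (cov : CovariantDerivative (𝓡 n) F V) (c : M) :
    ∃ Γ, IsLocalRep cov c Γ := by
  have h1 := cov.isCovariantDerivativeOn (s := dom n F V c)
  have h2 := isCovariantDerivativeOn_trivialCov (n := n) (F := F) (V := V) c
  have : ContMDiffVectorBundle 1 F V (𝓡 n) := ContMDiffVectorBundle.of_le (n := ∞) (by simp)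
  let D := h1.difference h2
  refine ⟨fun p ↦ bilinRep D c ((chartAt (Eu n) c).symm p), ?_⟩
  intro σ y hy hσ u
  have h3 : D y (σ y) = _ := h1.difference_apply h2 (x := y) hy hσ
  have h4 := congrArg (fun L : TangentSpace (𝓡 n) y →L[ℝ] V y ↦ fibVec F c y (L (coordField c u y))) h3
  simp only [sub_apply, map_sub] at h4
  have h5 : fibVec F c y (trivialCov n F V c σ y (coordField c u y)) =
      fderiv ℝ (locSec n F c σ) (chartAt (Eu n) c y) u := by
    refine (fibVec_fibSec hy.2 _).trans ?_
    exact mvfderiv_coordField c hy.1 ((mdiffS_iff' hy).1 hσ) u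
  rw [h5, eq_sub_iff_add_eq', eq_comm] at h4
  rw [h4]
  beta_reduce
  rw [(chartAt (Eu n) c).left_inv hy.1, bilinRep_apply, fibSec_fibVec hy.2]

end Exists

end LocalRep

/-! ### Smoothness of the local form, and curvature in coordinates -/

section Smooth

variable {n : ℕ} {M : Type*} [TopologicalSpace M] [ChartedSpace (Eu n) M] [IsManifold (𝓡 n) ∞ M]
  {F : Type*} [NormedAddCommGroup F] [NormedSpace ℝ F]
  {V : M → Type*} [TopologicalSpace (Bundle.TotalSpace F V)]
  [∀ x, TopologicalSpace (V x)] [∀ x, AddCommGroup (V x)] [∀ x, Module ℝ (V x)]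
  [∀ x, IsTopologicalAddGroup (V x)] [∀ x, ContinuousSMul ℝ (V x)]
  [FiberBundle F V] [VectorBundle ℝ F V] [ContMDiffVectorBundle ∞ F V (𝓡 n)]

/-- A constant section times a bump function: it makes local sections available to hypotheses about
global smooth sections. -/
lemma exists_smooth_section_eventuallyEq [T2Space M] {c y : M} (hy : y ∈ dom n F V c) (s : F) :
    ∃ σ : Π x, V x, (∀ z, SmoothS n F σ z) ∧ ∀ᶠ z in 𝓝 y, σ z = fibSec V c s z := by
  obtain ⟨χ, -, hχ⟩ := (SmoothBumpFunction.nhds_basis_tsupport (I := 𝓡 n) y).mem_iff.1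
    ((isOpen_dom c).mem_nhds hy)
  refine ⟨(χ : M → ℝ) • fibSec V c s, fun z ↦ ?_, ?_⟩
  · by_cases hz : z ∈ dom n F V c
    · exact χ.contMDiffAt.smul_section (smoothS_fibSec s hz)
    · have h0 : ∀ᶠ w in 𝓝 z, χ w = 0 := by
        filter_upwards [(isClosed_tsupport χ).isOpen_compl.mem_nhds fun h ↦ hz (hχ h)] with w hw
        exact image_eq_zero_of_notMem_tsupport hw
      refine (Bundle.contMDiff_zeroSection ℝ V z).congr_of_eventuallyEq ?_
      filter_upwards [h0] with w hw
      simp [hw, Bundle.zeroSection]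
  · filter_upwards [χ.eventuallyEq_one] with z hz
    simp [hz]

/-- On a section with constant components the derivative term vanishes, so `Γ u s` is the component
of `∇_u s`. Smoothness of `∇` is known on global sections only, hence the cut-off. -/
lemma contDiffOn_of_isLocalRep [FiniteDimensional ℝ F] [T2Space M]
    {cov : CovariantDerivative (𝓡 n) F V} [h : cov.ContMDiffCovariantDerivative ∞] {c : M}
    {Γ : Eu n → (Eu n →L[ℝ] F →L[ℝ] F)} (hΓ : IsLocalRep cov c Γ) :
    ContDiffOn ℝ ∞ Γ (cdom n F V c) := by
  rw [contDiffOn_clm_apply]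
  intro u
  rw [contDiffOn_clm_apply]
  intro s p hp
  refine ContDiffAt.contDiffWithinAt ?_
  have hy := chart_symm_mem_dom hp
  have hpp := (chartAt (Eu n) c).right_inv hp.1
  obtain ⟨σ, hσ, hσs⟩ := exists_smooth_section_eventuallyEq hy s
  set y := (chartAt (Eu n) c).symm p with hydef
  have h1 := (h.contMDiff.contMDiff (σ := σ) (by
    intro z _; exact (hσ z).contMDiffWithinAt)).contMDiffAt (x := y) Filter.univ_mem
  have h2 : SmoothS n F (fun z ↦ cov σ z (coordField c u z)) y :=
    ContMDiffAt.clm_bundle_apply h1 (contMDiffAt_coordField c u hy.1)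
  rw [contMDiffAt_sec_iff hy, hydef, hpp] at h2
  refine h2.congr_of_eventuallyEq ?_
  have hcont : Filter.Tendsto (chartAt (Eu n) c).symm (𝓝 p) (𝓝 y) :=
    ((chartAt (Eu n) c).continuousAt_symm hp.1).tendsto
  filter_upwards [hcont.eventually hσs.eventually_nhds, (isOpen_cdom c).mem_nhds hp] with q hq hqd
  have hz := chart_symm_mem_dom hqd
  -- `∇` only sees germs, so near `p` the cut-off section and the constant one have the same
  -- derivative.
  have e1 : cov σ ((chartAt (Eu n) c).symm q) = cov (fibSec V c s) ((chartAt (Eu n) c).symm q) :=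
    (cov.isCovariantDerivativeOn (s := Set.univ)).congr_of_eventuallyEq
      ((hσ _).mdifferentiableAt (by simp)) (mdiffS_fibSec s hz) Filter.univ_mem hq
  have e2 := hΓ (fibSec V c s) _ hz (mdiffS_fibSec s hz) u
  rw [(locSec_fibSec_eventuallyEq s hz).fderiv_eq] at e2
  simp only [fderiv_fun_const, Pi.zero_apply, zero_apply, zero_add, fibVec_fibSec hz.2,
    (chartAt (Eu n) c).right_inv hqd.1] at e2
  rw [← e2, ← e1]
  rfl

/-- `A` takes the fibre vector first and `A'` the tangent vector first. -/
lemma IsLocalRep.addOneForm {cov : CovariantDerivative (𝓡 n) F V} {c : M}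
    {Γ A' : Eu n → (Eu n →L[ℝ] F →L[ℝ] F)} (hΓ : IsLocalRep cov c Γ)
    {A : Π x : M, V x →L[ℝ] TangentSpace (𝓡 n) x →L[ℝ] V x}
    (hA : ∀ y ∈ dom n F V c, ∀ (u : Eu n) (v : V y), fibVec F c y (A y v (coordField c u y)) =
      A' (chartAt (Eu n) c y) u (fibVec F c y v)) :
    IsLocalRep (cov.addOneForm A) c (Γ + A') := by
  intro σ y hy hσ u
  simp only [CovariantDerivative.addOneForm, add_apply, map_add, hΓ σ y hy hσ u, hA y hy u (σ y),
    Pi.add_apply, add_assoc]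

/-- The curvature form `∂_u Γ_w - ∂_w Γ_u + [Γ_u, Γ_w]` of the connection `d + Γ`. -/
def curvForm (Γ : Eu n → (Eu n →L[ℝ] F →L[ℝ] F)) (p : Eu n) (u w : Eu n) : F →L[ℝ] F :=
  fderiv ℝ Γ p u w - fderiv ℝ Γ p w u + (Γ p u).comp (Γ p w) - (Γ p w).comp (Γ p u)

/-- `∇_X ∇_Y σ - ∇_Y ∇_X σ - ∇_{[X,Y]} σ` at `x`. -/
def curvatureFields (cov : CovariantDerivative (𝓡 n) F V) (σ : Π x, V x) (x : M)
    (X Y : Π y : M, TangentSpace (𝓡 n) y) : V x :=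
  cov (fun y ↦ cov σ y (Y y)) x (X x) - cov (fun y ↦ cov σ y (X y)) x (Y x)
    - cov σ x (VectorField.mlieBracket (𝓡 n) X Y x)

lemma curvatureFields_swap (cov : CovariantDerivative (𝓡 n) F V) (σ : Π x, V x) (x : M)
    (X Y : Π y : M, TangentSpace (𝓡 n) y) :
    curvatureFields cov σ x X Y = - curvatureFields cov σ x Y X := by
  unfold curvatureFields
  rw [VectorField.mlieBracket_swap_apply (V := X) (W := Y), map_neg]
  abel

/-- The terms with a derivative of `f` from the Leibniz rule cancel against that of `[fX, Y]`. The
hypothesis `hσ` is what the second application of the Leibniz rule needs. -/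
lemma curvatureFields_tensorial_left {cov : CovariantDerivative (𝓡 n) F V} {σ : Π x, V x} {x : M}
    (hσ : ∀ X : Π y : M, TangentSpace (𝓡 n) y, MDiffT X x → MDiffS n F (fun y ↦ cov σ y (X y)) x)
    {Y : Π y : M, TangentSpace (𝓡 n) y} (hY : MDiffT Y x) :
    TensorialAt (𝓡 n) (Eu n) (fun X ↦ curvatureFields cov σ x X Y) x where
  smul {f X} hf hX := by
    have h1 : (fun y ↦ cov σ y ((f • X) y)) = f • fun y ↦ cov σ y (X y) := by
      ext y; simp
    have h2 := cov.isCovariantDerivativeOnUniv.leibniz (hσ X hX) hf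
    simp only [curvatureFields]
    rw [h1, h2, VectorField.mlieBracket_smul_left hf hX]
    simp
    module
  add {X X'} hX hX' := by
    have h1 : (fun y ↦ cov σ y ((X + X') y)) =
      (fun y ↦ cov σ y (X y)) + fun y ↦ cov σ y (X' y) := by
      ext y; simp
    have h2 := cov.isCovariantDerivativeOnUniv.add (hσ X hX) (hσ X' hX')
    simp only [curvatureFields]
    rw [h1, h2, VectorField.mlieBracket_add_left hX hX']
    simp
    module

lemma curvatureFields_tensorial_right {cov : CovariantDerivative (𝓡 n) F V} {σ : Π x, V x} {x : M}
    (hσ : ∀ X : Π y : M, TangentSpace (𝓡 n) y, MDiffT X x → MDiffS n F (fun y ↦ cov σ y (X y)) x)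
    {X : Π y : M, TangentSpace (𝓡 n) y} (hX : MDiffT X x) :
    TensorialAt (𝓡 n) (Eu n) (fun Y ↦ curvatureFields cov σ x X Y) x where
  smul {f Y} hf hY := by
    rw [curvatureFields_swap, (curvatureFields_tensorial_left hσ hX).smul hf hY, ← smul_neg,
      ← curvatureFields_swap]
  add {Y Y'} hY hY' := by
    rw [curvatureFields_swap, (curvatureFields_tensorial_left hσ hX).add hY hY', neg_add,
      ← curvatureFields_swap, ← curvatureFields_swap]

variable {cov : CovariantDerivative (𝓡 n) F V} {c : M} {Γ : Eu n → (Eu n →L[ℝ] F →L[ℝ] F)}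

lemma IsLocalRep.locSec_cov_eventuallyEq (hΓ : IsLocalRep cov c Γ) {y : M} (hy : y ∈ dom n F V c)
    {σ : Π x, V x} (hσ : ∀ᶠ z in 𝓝 y, SmoothS n F σ z) (X : Π y : M, TangentSpace (𝓡 n) y) :
    locSec n F c (fun z ↦ cov σ z (X z)) =ᶠ[𝓝 (chartAt (Eu n) c y)] fun p ↦
      fderiv ℝ (locSec n F c σ) p (coordVec c ((chartAt (Eu n) c).symm p) (X ((chartAt (Eu n) c).symm p)))
        + Γ p (coordVec c ((chartAt (Eu n) c).symm p) (X ((chartAt (Eu n) c).symm p)))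
          (locSec n F c σ p) := by
  have hcont : Filter.Tendsto (chartAt (Eu n) c).symm (𝓝 (chartAt (Eu n) c y)) (𝓝 y) := by
    have := ((chartAt (Eu n) c).continuousAt_symm ((chartAt (Eu n) c).map_source hy.1)).tendsto
    rwa [(chartAt (Eu n) c).left_inv hy.1] at this
  filter_upwards [hcont.eventually hσ, (isOpen_cdom c).mem_nhds (chart_mem_cdom hy)] with p hp hpd
  have hz := chart_symm_mem_dom hpd
  have := hΓ σ _ hz (hp.mdifferentiableAt (by simp))
    (coordVec c ((chartAt (Eu n) c).symm p) (X ((chartAt (Eu n) c).symm p)))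
  rw [coordField_coordVec c hz.1, (chartAt (Eu n) c).right_inv hpd.1] at this
  exact this

lemma IsLocalRep.mdiffS_cov (hΓ : IsLocalRep cov c Γ) (hΓs : ContDiffOn ℝ ∞ Γ (cdom n F V c))
    {y : M} (hy : y ∈ dom n F V c)
    {σ : Π x, V x} (hσ : ∀ᶠ z in 𝓝 y, SmoothS n F σ z) {X : Π y : M, TangentSpace (𝓡 n) y}
    (hX : MDiffT X y) : MDiffS n F (fun z ↦ cov σ z (X z)) y := by
  rw [mdiffS_iff hy]
  rw [mdiffT_iff c hy.1, mdifferentiableAt_iff_chart c hy.1] at hX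
  have h1 := (contMDiffAt_sec_iff hy).1 hσ.self_of_nhds
  have h2 : DifferentiableAt ℝ (fderiv ℝ (locSec n F c σ)) (chartAt (Eu n) c y) :=
    (h1.fderiv_right (m := ∞) le_rfl).differentiableAt (by simp)
  have h3 : DifferentiableAt ℝ Γ (chartAt (Eu n) c y) :=
    (hΓs.contDiffAt ((isOpen_cdom c).mem_nhds (chart_mem_cdom hy))).differentiableAt (by simp)
  refine DifferentiableAt.congr_of_eventuallyEq ?_ (hΓ.locSec_cov_eventuallyEq hy hσ X)
  exact (h2.clm_apply hX).add ((h3.clm_apply hX).clm_apply (h1.differentiableAt (by simp)))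

set_option synthInstance.maxHeartbeats 200000 in
-- Apply `d + Γ` along `u` to `dσ(w) + Γ(w)σ`. Apart from the terms with `fderiv Γ` and `Γ u ∘ Γ w`,
-- the result is symmetric in `u`, `w`, so antisymmetrizing leaves the curvature form.
lemma IsLocalRep.fibVec_cov_cov (hΓ : IsLocalRep cov c Γ) (hΓs : ContDiffOn ℝ ∞ Γ (cdom n F V c))
    {y : M} (hy : y ∈ dom n F V c)
    {σ : Π x, V x} (hσ : ∀ᶠ z in 𝓝 y, SmoothS n F σ z) (u w : Eu n) :
    fibVec F c y (cov (fun z ↦ cov σ z (coordField c w z)) y (coordField c u y)) =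
      fderiv ℝ (fderiv ℝ (locSec n F c σ)) (chartAt (Eu n) c y) u w
      + fderiv ℝ Γ (chartAt (Eu n) c y) u w (fibVec F c y (σ y))
      + Γ (chartAt (Eu n) c y) w (fderiv ℝ (locSec n F c σ) (chartAt (Eu n) c y) u)
      + Γ (chartAt (Eu n) c y) u (fderiv ℝ (locSec n F c σ) (chartAt (Eu n) c y) w)
      + Γ (chartAt (Eu n) c y) u (Γ (chartAt (Eu n) c y) w (fibVec F c y (σ y))) := by
  set p := chartAt (Eu n) c y with hp
  have h1 := (contMDiffAt_sec_iff hy).1 hσ.self_of_nhds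
  have h2 : DifferentiableAt ℝ (fderiv ℝ (locSec n F c σ)) p :=
    (h1.fderiv_right (m := ∞) le_rfl).differentiableAt (by simp)
  have h3 : DifferentiableAt ℝ Γ p :=
    (hΓs.contDiffAt ((isOpen_cdom c).mem_nhds (chart_mem_cdom hy))).differentiableAt (by simp)
  have h4 : DifferentiableAt ℝ (locSec n F c σ) p := h1.differentiableAt (by simp)
  have hs : locSec n F c σ p = fibVec F c y (σ y) := by
    unfold locSec; rw [hp, (chartAt (Eu n) c).left_inv hy.1]
  have e1 : locSec n F c (fun z ↦ cov σ z (coordField c w z)) =ᶠ[𝓝 p]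
      fun q ↦ fderiv ℝ (locSec n F c σ) q w + Γ q w (locSec n F c σ q) := by
    filter_upwards [hΓ.locSec_cov_eventuallyEq hy hσ (coordField c w),
      (isOpen_cdom c).mem_nhds (chart_mem_cdom hy)] with q hq hqd
    rw [hq, coordVec_coordField c w (chart_symm_mem_dom hqd).1]
  have e2 : HasFDerivAt (fun q ↦ fderiv ℝ (locSec n F c σ) q w + Γ q w (locSec n F c σ q)) _ p :=
    (h2.hasFDerivAt.clm_apply (hasFDerivAt_const w p)).add
      ((h3.hasFDerivAt.clm_apply (hasFDerivAt_const w p)).clm_apply h4.hasFDerivAt)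
  rw [hΓ _ y hy (hΓ.mdiffS_cov hΓs hy hσ (mdiffT_coordField c w hy.1)) u, ← hp, e1.fderiv_eq,
    e2.fderiv, hΓ σ y hy (hσ.self_of_nhds.mdifferentiableAt (by simp)) w, ← hp, hs]
  simp only [add_apply, ContinuousLinearMap.comp_apply, ContinuousLinearMap.flip_apply, zero_apply,
    map_zero, map_add, zero_add, add_zero]
  abel

/-- The curvature at `y` is defined by extensions adapted to `y`, while `Γ` belongs to the chart at
`c`. Tensoriality in both vector slots bridges the two. -/
theorem IsLocalRep.fibVec_curvature [FiniteDimensional ℝ F] (hΓ : IsLocalRep cov c Γ)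
    (hΓs : ContDiffOn ℝ ∞ Γ (cdom n F V c)) {y : M} (hy : y ∈ dom n F V c)
    (v w : TangentSpace (𝓡 n) y) (s : V y) :
    fibVec F c y (curvature cov y v w s) =
      curvForm Γ (chartAt (Eu n) c y) (coordVec c y v) (coordVec c y w) (fibVec F c y s) := by
  set σ : Π x, V x := FiberBundle.extend F s with hσdef
  have hσ : ∀ᶠ z in 𝓝 y, SmoothS n F σ z := by
    obtain ⟨N, hN, h⟩ := FiberBundle.exists_contMDiffOn_extend (k := ∞) (𝓡 n) F s
    filter_upwards [eventually_mem_nhds_iff.2 hN] with z hz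
    exact h.contMDiffAt hz
  have hss : σ y = s := FiberBundle.extend_apply_self F s
  have hd : ∀ X : Π y : M, TangentSpace (𝓡 n) y, MDiffT X y → MDiffS n F (fun z ↦ cov σ z (X z)) y :=
    fun X hX ↦ hΓ.mdiffS_cov hΓs hy hσ hX
  have hv : extendT v y = v := FiberBundle.extend_apply_self _ v
  have hw : extendT w y = w := FiberBundle.extend_apply_self _ w
  have e0 : curvature cov y v w s = curvatureFields cov σ y (extendT v) (extendT w) := by
    unfold curvature curvatureFields
    rw [hv, hw]
  -- Only the vector fields are exchanged, for coordinate fields of `c`, whose bracket vanishes; the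
  -- section stays the extension at `y`, whose derivatives drop out below.
  have e1 : curvatureFields cov σ y (extendT v) (extendT w) =
      curvatureFields cov σ y (coordField c (coordVec c y v)) (coordField c (coordVec c y w)) := by
    refine TensorialAt.pointwise₂ (F := Eu n) (F' := Eu n) (I := 𝓡 n)
      (fun _ hY ↦ curvatureFields_tensorial_left hd hY)
      (fun X hX ↦ curvatureFields_tensorial_right hd hX)
      (FiberBundle.mdifferentiableAt_extend _ _ v) (mdiffT_coordField c _ hy.1)
      (FiberBundle.mdifferentiableAt_extend _ _ w) (mdiffT_coordField c _ hy.1) ?_ ?_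
    · rw [coordField_coordVec c hy.1]; exact hv
    · rw [coordField_coordVec c hy.1]; exact hw
  rw [e0, e1]
  unfold curvatureFields
  rw [mlieBracket_coordField c _ _ hy.1, map_zero, sub_zero, map_sub,
    hΓ.fibVec_cov_cov hΓs hy hσ, hΓ.fibVec_cov_cov hΓs hy hσ, hss]
  -- Symmetry of the second derivative of the section removes the remaining second order terms.
  have hsymm := ((contMDiffAt_sec_iff hy).1 hσ.self_of_nhds).isSymmSndFDerivAt
    (by simp only [minSmoothness_of_isRCLikeNormedField]; exact WithTop.coe_le_coe.2 le_top)
    (coordVec c y v) (coordVec c y w)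
  rw [hsymm]
  simp [curvForm]
  abel

end Smooth

/-! ### Traces in bases that are not orthonormal -/

section Trace

/-- The trace of a bilinear form in terms of a basis that need not be orthonormal. -/
lemma sum_orthonormalBasis_eq {ι κ W : Type*} [Fintype ι] [Fintype κ] [DecidableEq κ]
    [NormedAddCommGroup W] [InnerProductSpace ℝ W] (o : OrthonormalBasis ι ℝ W)
    (hcard : Fintype.card κ = Fintype.card ι) (b : κ → W) (h : Matrix κ κ ℝ)
    (hh : h * (Matrix.of fun i j ↦ inner ℝ (b i) (b j)) = 1) (B : W → W → ℝ)
    (hB : ∃ L : W →ₗ[ℝ] W →ₗ[ℝ] ℝ, ∀ v w, B v w = L v w) :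
    ∑ i, B (o i) (o i) = ∑ i, ∑ j, h i j * B (b i) (b j) := by
  classical
  obtain ⟨L, hL⟩ := hB
  let P : Matrix κ ι ℝ := Matrix.of fun a i ↦ inner ℝ (o i) (b a)
  have hb (a : κ) : b a = ∑ i, P a i • o i := (o.sum_repr' (b a)).symm
  have hG : (Matrix.of fun i j ↦ inner ℝ (b i) (b j)) = P * P.transpose := by
    ext i j
    simp only [Matrix.of_apply, Matrix.mul_apply, Matrix.transpose_apply, P]
    rw [← o.sum_inner_mul_inner (b i) (b j)]
    simp [real_inner_comm]
  rw [hG, ← Matrix.mul_assoc] at hh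
  -- `hh` now reads `(h P) Pᵀ = 1`. As `P` is square up to a bijection of its index types, a
  -- one-sided inverse is two-sided.
  have h1 : P.transpose * (h * P) = 1 := by
    have e : κ ≃ ι := Fintype.equivOfCardEq hcard
    exact (Matrix.mul_eq_one_comm_of_equiv e).1 hh
  have h2 (i j : ι) : ∑ a, ∑ c, h a c * (P a i * P c j) = if i = j then 1 else 0 := by
    have := congrFun (congrFun h1 i) j
    rw [Matrix.one_apply] at this
    rw [← this]
    simp only [Matrix.mul_apply, Matrix.transpose_apply, Finset.mul_sum]
    refine Finset.sum_congr rfl fun a _ ↦ Finset.sum_congr rfl fun c _ ↦ by ring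
  have h3 (a c : κ) : L (b a) (b c) = ∑ i, ∑ j, P a i * P c j * L (o i) (o j) := by
    rw [hb a, hb c]
    simp only [map_sum, LinearMap.sum_apply, map_smul, LinearMap.smul_apply, smul_eq_mul,
      Finset.mul_sum]
    rw [Finset.sum_comm]
    refine Finset.sum_congr rfl fun i _ ↦ Finset.sum_congr rfl fun j _ ↦ by ring
  calc ∑ i, B (o i) (o i) = ∑ i, ∑ j, (if i = j then 1 else 0) * L (o i) (o j) := by
        simp [hL]
    _ = ∑ i, ∑ j, ∑ a, ∑ c, h a c * (P a i * P c j) * L (o i) (o j) := by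
        simp only [← h2, Finset.sum_mul]
    _ = ∑ a, ∑ c, ∑ i, ∑ j, h a c * (P a i * P c j) * L (o i) (o j) := by
        rw [Finset.sum_congr rfl fun i _ ↦ Finset.sum_comm, Finset.sum_comm]
        refine Finset.sum_congr rfl fun a _ ↦ ?_
        rw [Finset.sum_congr rfl fun i _ ↦ Finset.sum_comm, Finset.sum_comm]
    _ = _ := by
        simp only [hL, h3, Finset.mul_sum]
        refine Finset.sum_congr rfl fun i _ ↦ Finset.sum_congr rfl fun j _ ↦
          Finset.sum_congr rfl fun k _ ↦ Finset.sum_congr rfl fun l _ ↦ by ring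

end Trace

section Contraction

variable {n : ℕ} {E : Type*} [NormedAddCommGroup E] [NormedSpace ℝ E]

/-- The contraction `∑ h^{jl} ⟨R_ij, R_kl⟩`. -/
def contr (H : E →L[ℝ] E →L[ℝ] ℝ) (h : Matrix (Fin n) (Fin n) ℝ) (R : Fin n → Fin n → E)
    (i k : Fin n) : ℝ := ∑ j, ∑ l, h j l * H (R i j) (R k l)

/-- The squared norm `½ ∑ h^{ik} h^{jl} ⟨R_ij, R_kl⟩`. -/
def normSq (H : E →L[ℝ] E →L[ℝ] ℝ) (h : Matrix (Fin n) (Fin n) ℝ) (R : Fin n → Fin n → E) : ℝ :=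
  (1 / 2) * ∑ i, ∑ k, h i k * contr H h R i k

end Contraction

/-! ### Fibre metrics with constant coefficients -/

section Local

variable {n : ℕ} {M : Type*} [TopologicalSpace M] [ChartedSpace (Eu n) M] [IsManifold (𝓡 n) ∞ M]
  [Bundle.RiemannianBundle (fun x : M ↦ TangentSpace (𝓡 n) x)]
  {F : Type*} [NormedAddCommGroup F] [NormedSpace ℝ F]
  {V : M → Type*} [TopologicalSpace (Bundle.TotalSpace F V)]
  [∀ x, TopologicalSpace (V x)] [∀ x, AddCommGroup (V x)] [∀ x, Module ℝ (V x)]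
  [∀ x, IsTopologicalAddGroup (V x)] [∀ x, ContinuousSMul ℝ (V x)]
  [FiberBundle F V] [VectorBundle ℝ F V]
  [∀ x, FiniteDimensional ℝ (V x)] [Bundle.RiemannianBundle V]

/-- The Gram matrix of the coordinate fields of a basis of `ℝⁿ`. -/
def gramB (c : M) (b : Fin n → Eu n) (p : Eu n) : Matrix (Fin n) (Fin n) ℝ :=
  Matrix.of fun i j ↦ inner ℝ (coordField c (b i) ((chartAt (Eu n) c).symm p))
    (coordField c (b j) ((chartAt (Eu n) c).symm p))

lemma gramB_posDef (c : M) (b : Module.Basis (Fin n) ℝ (Eu n)) {p : Eu n}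
    (hp : p ∈ (chartAt (Eu n) c).target) : (gramB c b p).PosDef := by
  have hy := (chartAt (Eu n) c).map_target hp
  have : LinearIndependent ℝ fun i ↦ coordField c (b i) ((chartAt (Eu n) c).symm p) := by
    refine LinearIndependent.of_comp
      (coordVec c ((chartAt (Eu n) c).symm p)).toLinearMap ?_
    convert b.linearIndependent using 1
    ext i : 1
    exact coordVec_coordField c (b i) hy
  exact Matrix.posDef_gram_of_linearIndependent this

variable (n V) in
/-- The fibre metric of `V` has constant coefficients `κ` in the trivialization at `c`. -/
def IsConstMetric (c : M) (κ : F →L[ℝ] F →L[ℝ] ℝ) : Prop :=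
  ∀ y ∈ dom n F V c, ∀ u v : V y, inner ℝ u v = κ (fibVec F c y u) (fibVec F c y v)

variable (F V) in
/-- The inner product of endomorphisms of the fibre, in the trivialization at `c`. -/
def endInner (c : M) (κ : F →L[ℝ] F →L[ℝ] ℝ) : (F →L[ℝ] F) →L[ℝ] (F →L[ℝ] F) →L[ℝ] ℝ :=
  ∑ a, κ.bilinearComp
    (ContinuousLinearMap.apply ℝ F (fibVec F c c (stdOrthonormalBasis ℝ (V c) a)))
    (ContinuousLinearMap.apply ℝ F (fibVec F c c (stdOrthonormalBasis ℝ (V c) a)))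

lemma endInner_apply (c : M) (κ : F →L[ℝ] F →L[ℝ] ℝ) (S U : F →L[ℝ] F) :
    endInner F V c κ S U = ∑ a, κ (S (fibVec F c c (stdOrthonormalBasis ℝ (V c) a)))
      (U (fibVec F c c (stdOrthonormalBasis ℝ (V c) a))) := by
  simp [endInner]

lemma finrank_fiber (c y : M) (hy : y ∈ dom n F V c) :
    Module.finrank ℝ (V y) = Module.finrank ℝ F :=
  LinearEquiv.finrank_eq
    ((trivializationAt F V c).continuousLinearEquivAt ℝ y hy.2).toLinearEquiv

/-- An orthonormal basis of the fibre at `c`, moved to `y` with constant components, stays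
orthonormal because the metric has constant coefficients. Hence one fixed form `endInner` serves the
whole domain. -/
lemma IsConstMetric.homInner_eq {c : M} {κ : F →L[ℝ] F →L[ℝ] ℝ} (hκ : IsConstMetric n V c κ)
    {y : M} (hy : y ∈ dom n F V c) {S U : V y → V y} {S' U' : F →L[ℝ] F}
    (hS : ∀ s, fibVec F c y (S s) = S' (fibVec F c y s))
    (hU : ∀ s, fibVec F c y (U s) = U' (fibVec F c y s)) :
    homInner S U = endInner F V c κ S' U' := by
  classical
  have hc := mem_dom_self (n := n) (F := F) (V := V) c
  let b : Fin (Module.finrank ℝ (V c)) → V y :=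
    fun a ↦ fibSec V c (fibVec F c c (stdOrthonormalBasis ℝ (V c) a)) y
  have hb (a) : fibVec F c y (b a) = fibVec F c c (stdOrthonormalBasis ℝ (V c) a) :=
    fibVec_fibSec hy.2 _
  -- The moved basis has Gram matrix `1`, so the trace formula is used with `h = 1`.
  have key := sum_orthonormalBasis_eq (stdOrthonormalBasis ℝ (V y))
    (κ := Fin (Module.finrank ℝ (V c))) (by simp [finrank_fiber c y hy, finrank_fiber c c hc])
    b 1 (by
      rw [one_mul]
      ext i j
      rw [Matrix.of_apply, hκ y hy, hb, hb, ← hκ c hc, OrthonormalBasis.inner_eq_ite,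
        Matrix.one_apply])
    (fun s t ↦ inner ℝ (S s) (U t))
    ⟨((κ.bilinearComp (S'.comp (fibVec F c y)) (U'.comp (fibVec F c y))).toLinearMap₁₂), fun s t ↦ by
      simp [hκ y hy, hS, hU]⟩
  rw [homInner, key, endInner_apply]
  simp [Matrix.one_apply, hκ y hy, hS, hU, hb]

end Local

/-! ### The norm of the curvature in coordinates -/

section

set_option synthInstance.maxHeartbeats 200000

section Bilin

variable {E : Type*} [NormedAddCommGroup E] [NormedSpace ℝ E] (H : E →L[ℝ] E →L[ℝ] ℝ)

lemma bilin_add_left (x x' y : E) : H (x + x') y = H x y + H x' y := by simp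

lemma bilin_add_right (x y y' : E) : H x (y + y') = H x y + H x y' := by simp

lemma bilin_smul_left (r : ℝ) (x y : E) : H (r • x) y = r * H x y := by simp

lemma bilin_smul_right (r : ℝ) (x y : E) : H x (r • y) = r * H x y := by simp

lemma bilin_neg_neg (x y : E) : H (-x) (-y) = H x y := by simp

lemma bilin_zero_left (y : E) : H 0 y = 0 := by simp

end Bilin

section LocalTensors

variable {n : ℕ} {F : Type*} [NormedAddCommGroup F] [NormedSpace ℝ F]

lemma curvForm_swap (Γ : Eu n → (Eu n →L[ℝ] F →L[ℝ] F)) (p u w : Eu n) :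
    curvForm Γ p u w = - curvForm Γ p w u := by
  simp only [curvForm]; abel

lemma curvForm_self (Γ : Eu n → (Eu n →L[ℝ] F →L[ℝ] F)) (p u : Eu n) :
    curvForm Γ p u u = 0 := by
  simp [curvForm]

lemma curvForm_add_right (Γ : Eu n → (Eu n →L[ℝ] F →L[ℝ] F)) (p u w w' : Eu n) :
    curvForm Γ p u (w + w') = curvForm Γ p u w + curvForm Γ p u w' := by
  simp only [curvForm, map_add, add_apply, ContinuousLinearMap.comp_add,
    ContinuousLinearMap.add_comp]
  abel

lemma curvForm_smul_right (Γ : Eu n → (Eu n →L[ℝ] F →L[ℝ] F)) (p u : Eu n) (r : ℝ) (w : Eu n) :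
    curvForm Γ p u (r • w) = r • curvForm Γ p u w := by
  simp only [curvForm, map_smul, smul_apply, ContinuousLinearMap.comp_smul,
    ContinuousLinearMap.smul_comp, smul_sub, smul_add]

lemma curvForm_add_left (Γ : Eu n → (Eu n →L[ℝ] F →L[ℝ] F)) (p u u' w : Eu n) :
    curvForm Γ p (u + u') w = curvForm Γ p u w + curvForm Γ p u' w := by
  rw [curvForm_swap, curvForm_add_right, neg_add, ← curvForm_swap, ← curvForm_swap]

lemma curvForm_smul_left (Γ : Eu n → (Eu n →L[ℝ] F →L[ℝ] F)) (p : Eu n) (r : ℝ) (u w : Eu n) :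
    curvForm Γ p (r • u) w = r • curvForm Γ p u w := by
  rw [curvForm_swap, curvForm_smul_right, ← smul_neg, ← curvForm_swap]

end LocalTensors

section Local

variable {n : ℕ} {M : Type*} [TopologicalSpace M] [ChartedSpace (Eu n) M] [IsManifold (𝓡 n) ∞ M]
  [Bundle.RiemannianBundle (fun x : M ↦ TangentSpace (𝓡 n) x)]
  {F : Type*} [NormedAddCommGroup F] [NormedSpace ℝ F] [FiniteDimensional ℝ F]
  {V : M → Type*} [TopologicalSpace (Bundle.TotalSpace F V)]
  [∀ x, TopologicalSpace (V x)] [∀ x, AddCommGroup (V x)] [∀ x, Module ℝ (V x)]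
  [∀ x, IsTopologicalAddGroup (V x)] [∀ x, ContinuousSMul ℝ (V x)]
  [FiberBundle F V] [VectorBundle ℝ F V] [ContMDiffVectorBundle ∞ F V (𝓡 n)]
  [∀ x, FiniteDimensional ℝ (V x)] [Bundle.RiemannianBundle V]
  {cov : CovariantDerivative (𝓡 n) F V} {c : M} {κ : F →L[ℝ] F →L[ℝ] ℝ}
  {Γ : Eu n → (Eu n →L[ℝ] F →L[ℝ] F)}

lemma gram_coordField_eq (c : M) (b : Fin n → Eu n) {y : M}
    (hy : y ∈ (chartAt (Eu n) c).source) :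
    gramB c b (chartAt (Eu n) c y) =
      Matrix.of fun i j ↦ inner ℝ (coordField c (b i) y) (coordField c (b j) y) := by
  unfold gramB
  rw [(chartAt (Eu n) c).left_inv hy]

lemma IsConstMetric.homInner_curvature (hκ : IsConstMetric n V c κ) (hΓ : IsLocalRep cov c Γ)
    (hΓs : ContDiffOn ℝ ∞ Γ (cdom n F V c)) {y : M} (hy : y ∈ dom n F V c)
    (u w u' w' : TangentSpace (𝓡 n) y) :
    homInner (curvature cov y u w) (curvature cov y u' w') =
      endInner F V c κ (curvForm Γ (chartAt (Eu n) c y) (coordVec c y u) (coordVec c y w))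
        (curvForm Γ (chartAt (Eu n) c y) (coordVec c y u') (coordVec c y w')) :=
  hκ.homInner_eq hy (hΓ.fibVec_curvature hΓs hy u w) (hΓ.fibVec_curvature hΓs hy u' w')

/-- The sum over `e_k` is the trace of a bilinear form in the second slots, taken in the coordinate
basis `b` at the cost of the inverse Gram matrix. -/
theorem IsConstMetric.contractionInner_eq (hκ : IsConstMetric n V c κ) (hΓ : IsLocalRep cov c Γ)
    (hΓs : ContDiffOn ℝ ∞ Γ (cdom n F V c)) {y : M} (hy : y ∈ dom n F V c)
    (b : Module.Basis (Fin n) ℝ (Eu n)) (u w : TangentSpace (𝓡 n) y) :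
    contractionInner cov y u w = ∑ j, ∑ l, (gramB c b (chartAt (Eu n) c y))⁻¹ j l *
      endInner F V c κ (curvForm Γ (chartAt (Eu n) c y) (coordVec c y u) (b j))
        (curvForm Γ (chartAt (Eu n) c y) (coordVec c y w) (b l)) := by
  unfold contractionInner
  refine (sum_orthonormalBasis_eq (onb (𝓡 n) y) (κ := Fin n) ?_
    (fun j ↦ coordField c (b j) y) (gramB c b (chartAt (Eu n) c y))⁻¹ ?_
    (fun v v' ↦ homInner (curvature cov y u v) (curvature cov y w v')) ?_).trans ?_
  · simp only [Fintype.card_fin]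
    exact (finrank_euclideanSpace_fin (𝕜 := ℝ) (n := n)).symm
  · rw [← gram_coordField_eq c b hy.1]
    exact Matrix.nonsing_inv_mul _
      (gramB_posDef c b ((chartAt (Eu n) c).map_source hy.1)).det_pos.ne'.isUnit
  · refine ⟨LinearMap.mk₂ ℝ (fun v v' ↦ homInner (curvature cov y u v) (curvature cov y w v'))
      ?_ ?_ ?_ ?_, fun v v' ↦ rfl⟩
    · intro v v' z
      simp only [hκ.homInner_curvature hΓ hΓs hy, map_add (coordVec c y), curvForm_add_right, bilin_add_left]
    · intro r v z
      have : coordVec c y (r • v) = r • coordVec c y v := map_smul (coordVec c y) r v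
      simp only [hκ.homInner_curvature hΓ hΓs hy]
      rw [this, curvForm_smul_right, bilin_smul_left, smul_eq_mul]
    · intro v v' z
      simp only [hκ.homInner_curvature hΓ hΓs hy, map_add (coordVec c y), curvForm_add_right, bilin_add_right]
    · intro r v z
      have : coordVec c y (r • z) = r • coordVec c y z := map_smul (coordVec c y) r z
      simp only [hκ.homInner_curvature hΓ hΓs hy]
      rw [this, curvForm_smul_right, bilin_smul_right, smul_eq_mul]
  · refine Finset.sum_congr rfl fun j _ ↦ Finset.sum_congr rfl fun l _ ↦ ?_
    rw [hκ.homInner_curvature hΓ hΓs hy, coordVec_coordField c _ hy.1,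
      coordVec_coordField c _ hy.1]

/-- Bilinearity, needed for a second trace over the first slots and for the divergence, is inherited
from the local curvature form. -/
lemma IsConstMetric.exists_linear_contractionInner (hκ : IsConstMetric n V c κ)
    (hΓ : IsLocalRep cov c Γ) (hΓs : ContDiffOn ℝ ∞ Γ (cdom n F V c)) {y : M}
    (hy : y ∈ dom n F V c) (b : Module.Basis (Fin n) ℝ (Eu n)) :
    ∃ L : TangentSpace (𝓡 n) y →ₗ[ℝ] TangentSpace (𝓡 n) y →ₗ[ℝ] ℝ,
      ∀ v w, contractionInner cov y v w = L v w := by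
  refine ⟨LinearMap.mk₂ ℝ (fun v v' ↦ contractionInner cov y v v')
    ?_ ?_ ?_ ?_, fun v v' ↦ rfl⟩
  · intro v v' z
    simp only [hκ.contractionInner_eq hΓ hΓs hy b, map_add (coordVec c y), curvForm_add_left, bilin_add_left,
      mul_add, Finset.sum_add_distrib]
  · intro r v z
    have : coordVec c y (r • v) = r • coordVec c y v := map_smul (coordVec c y) r v
    simp only [hκ.contractionInner_eq hΓ hΓs hy b]
    rw [this]
    simp only [curvForm_smul_left, bilin_smul_left, Finset.mul_sum, smul_eq_mul]
    exact Finset.sum_congr rfl fun _ _ ↦ Finset.sum_congr rfl fun _ _ ↦ mul_left_comm _ _ _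
  · intro v v' z
    simp only [hκ.contractionInner_eq hΓ hΓs hy b, map_add (coordVec c y), curvForm_add_left, bilin_add_right,
      mul_add, Finset.sum_add_distrib]
  · intro r v z
    have : coordVec c y (r • z) = r • coordVec c y z := map_smul (coordVec c y) r z
    simp only [hκ.contractionInner_eq hΓ hΓs hy b]
    rw [this]
    simp only [curvForm_smul_left, bilin_smul_right, Finset.mul_sum, smul_eq_mul]
    exact Finset.sum_congr rfl fun _ _ ↦ Finset.sum_congr rfl fun _ _ ↦ mul_left_comm _ _ _

lemma sum_Ioi_eq_half {k : ℕ} (f : Fin k → Fin k → ℝ) (hs : ∀ i j, f i j = f j i)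
    (h0 : ∀ i, f i i = 0) : ∑ i, ∑ j ∈ Finset.Ioi i, f i j = 1 / 2 * ∑ i, ∑ j, f i j := by
  have h1 (i : Fin k) : ∑ j, f i j =
      ∑ j ∈ Finset.Ioi i, f i j + ∑ j, if j < i then f i j else 0 := by
    rw [← Finset.sum_filter_add_sum_filter_not Finset.univ (fun j ↦ i < j), ← Finset.filter_lt_eq_Ioi,
      Finset.sum_filter (fun j ↦ ¬ i < j)]
    congr 1
    refine Finset.sum_congr rfl fun j _ ↦ ?_
    rcases lt_trichotomy i j with h | h | h
    · simp [h, h.le]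
    · simp [h, h0]
    · simp [h, h.le]
  have h2 : ∑ i, ∑ j, (if j < i then f i j else 0) = ∑ i, ∑ j ∈ Finset.Ioi i, f i j := by
    rw [Finset.sum_comm]
    refine Finset.sum_congr rfl fun i _ ↦ ?_
    rw [← Finset.filter_lt_eq_Ioi, Finset.sum_filter]
    exact Finset.sum_congr rfl fun j _ ↦ by rw [hs]
  rw [Finset.sum_congr rfl fun i _ ↦ h1 i, Finset.sum_add_distrib, h2]
  ring

/-- Antisymmetry of the curvature turns the sum over `i < j` into half a full sum, which is a trace
and hence independent of the basis. -/
lemma curvatureNormSq_eq_half (hκ : IsConstMetric n V c κ) (hΓ : IsLocalRep cov c Γ)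
    (hΓs : ContDiffOn ℝ ∞ Γ (cdom n F V c)) {y : M} (hy : y ∈ dom n F V c) :
    curvatureNormSq cov y =
      1 / 2 * ∑ i, contractionInner cov y (onb (𝓡 n) y i) (onb (𝓡 n) y i) := by
  unfold curvatureNormSq contractionInner
  refine sum_Ioi_eq_half (fun i j ↦ homInner (curvature cov y (onb (𝓡 n) y i) (onb (𝓡 n) y j))
    (curvature cov y (onb (𝓡 n) y i) (onb (𝓡 n) y j))) (fun i j ↦ ?_) (fun i ↦ ?_)
  · simp only [hκ.homInner_curvature hΓ hΓs hy]
    rw [curvForm_swap, bilin_neg_neg]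
  · simp only [hκ.homInner_curvature hΓ hΓs hy]
    rw [curvForm_self, bilin_zero_left]

/-- The trace formula once more, now over the first slots. -/
theorem IsConstMetric.curvatureNormSq_eq (hκ : IsConstMetric n V c κ) (hΓ : IsLocalRep cov c Γ)
    (hΓs : ContDiffOn ℝ ∞ Γ (cdom n F V c)) {y : M} (hy : y ∈ dom n F V c)
    (b : Module.Basis (Fin n) ℝ (Eu n)) :
    curvatureNormSq cov y = normSq (endInner F V c κ) (gramB c b (chartAt (Eu n) c y))⁻¹
      (fun i j ↦ curvForm Γ (chartAt (Eu n) c y) (b i) (b j)) := by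
  rw [curvatureNormSq_eq_half hκ hΓ hΓs hy, normSq]
  congr 1
  refine (sum_orthonormalBasis_eq (onb (𝓡 n) y) (κ := Fin n) ?_
    (fun j ↦ coordField c (b j) y) (gramB c b (chartAt (Eu n) c y))⁻¹ ?_
    (fun v v' ↦ contractionInner cov y v v') ?_).trans ?_
  · simp only [Fintype.card_fin]
    exact (finrank_euclideanSpace_fin (𝕜 := ℝ) (n := n)).symm
  · rw [← gram_coordField_eq c b hy.1]
    exact Matrix.nonsing_inv_mul _
      (gramB_posDef c b ((chartAt (Eu n) c).map_source hy.1)).det_pos.ne'.isUnit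
  · exact hκ.exists_linear_contractionInner hΓ hΓs hy b
  · refine Finset.sum_congr rfl fun j _ ↦ Finset.sum_congr rfl fun l _ ↦ ?_
    rw [hκ.contractionInner_eq hΓ hΓs hy b]
    rw [coordVec_coordField c _ hy.1, coordVec_coordField c _ hy.1]
    rfl

end Local

end

/-! ### Gram matrices and the Riemannian volume measure -/

section MatrixTransform

variable {n : ℕ}

/-- The coordinate basis of `ℝⁿ`. -/
abbrev stdB (n : ℕ) : Module.Basis (Fin n) ℝ (Eu n) := (EuclideanSpace.basisFun (Fin n) ℝ).toBasis

lemma bilin_transform (b : Module.Basis (Fin n) ℝ (Eu n)) (L : Eu n →ₗ[ℝ] Eu n)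
    (B : Eu n → Eu n → ℝ) (hadd : ∀ u v w, B (u + v) w = B u w + B v w)
    (hsmul : ∀ (r : ℝ) u w, B (r • u) w = r * B u w) (hsymm : ∀ u w, B u w = B w u) :
    (Matrix.of fun i j ↦ B (L (b i)) (L (b j))) =
      (LinearMap.toMatrix b b L).transpose * (Matrix.of fun i j ↦ B (b i) (b j)) *
        LinearMap.toMatrix b b L := by
  have hsum (f : Fin n → ℝ) (w : Eu n) : B (∑ a, f a • b a) w = ∑ a, f a * B (b a) w := by
    have h0 : B 0 w = 0 := by simpa using hsmul 0 0 w
    induction (Finset.univ : Finset (Fin n)) using Finset.induction_on with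
    | empty => simpa using h0
    | insert a s ha ih => rw [Finset.sum_insert ha, Finset.sum_insert ha, hadd, hsmul, ih]
  have hL (i : Fin n) : L (b i) = ∑ a, LinearMap.toMatrix b b L a i • b a := by
    simp [LinearMap.toMatrix_apply, b.sum_repr]
  ext i j
  rw [Matrix.of_apply, hL i, hL j, hsum, Matrix.mul_assoc, Matrix.mul_apply]
  refine Finset.sum_congr rfl fun a _ ↦ ?_
  rw [Matrix.transpose_apply, hsymm, hsum, Matrix.mul_apply]
  congr 1
  refine Finset.sum_congr rfl fun k _ ↦ ?_
  rw [Matrix.of_apply, hsymm, mul_comm]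

end MatrixTransform

section Volume

variable {n : ℕ} {M : Type*} [TopologicalSpace M] [ChartedSpace (Eu n) M] [IsManifold (𝓡 n) ∞ M]
  [Bundle.RiemannianBundle (fun x : M ↦ TangentSpace (𝓡 n) x)]

lemma gramMatrix_eq (c : M) {p : Eu n} (hp : p ∈ (chartAt (Eu n) c).target) :
    gramMatrix c p = gramB c (stdB n) p := by
  have hy := (chartAt (Eu n) c).map_target hp
  ext i j
  simp only [gramMatrix, gramB, Matrix.of_apply]
  have key (i : Fin n) : coordField c (stdB n i) ((chartAt (Eu n) c).symm p) =
      mfderiv (𝓡 n) (𝓡 n) (chartAt (Eu n) c).symm p (EuclideanSpace.single i (1 : ℝ)) := by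
    have h := coordField_eq c (stdB n i) hy
    rw [(chartAt (Eu n) c).right_inv hp] at h
    refine h.trans ?_
    congr 1
    simp [stdB]
    rfl
  rw [key, key]

lemma gramB_transform (c : M) (b : Module.Basis (Fin n) ℝ (Eu n)) (L : Eu n →ₗ[ℝ] Eu n) (p : Eu n) :
    gramB c (fun i ↦ L (b i)) p = (LinearMap.toMatrix b b L).transpose * gramB c b p *
      LinearMap.toMatrix b b L :=
  bilin_transform b L (fun u w ↦ inner ℝ (coordField c u ((chartAt (Eu n) c).symm p))
    (coordField c w ((chartAt (Eu n) c).symm p)))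
    (fun u v w ↦ by rw [coordField_add, inner_add_left])
    (fun r u w ↦ by rw [coordField_smul, real_inner_smul_left]) fun u w ↦ real_inner_comm _ _

/-- The components of `coordField c' u` in the chart at `c` are its derivatives of the chart map,
that is, the derivative of the transition map applied to `u`. -/
lemma coordField_change (c c' : M) (u : Eu n) {y : M} (hy : y ∈ (chartAt (Eu n) c).source)
    (hy' : y ∈ (chartAt (Eu n) c').source) :
    coordField c' u y = coordField c (fderiv ℝ (chartAt (Eu n) c ∘ (chartAt (Eu n) c').symm)
      (chartAt (Eu n) c' y) u) y := by
  have h1 := mvfderiv_coordField c' hy' (mdifferentiableAt_chart c hy) u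
  rw [← h1]
  have h2 : mvfderiv (𝓡 n) (chartAt (Eu n) c) y (coordField c' u y) =
      coordVec c y (coordField c' u y) := by
    rw [coordVec_eq c hy]; rfl
  rw [h2, coordField_coordVec c hy]

/-- The Gram matrix changes to `Lᵀ G L` with `L` the derivative of the transition map, so the
density picks up exactly the Jacobian factor of the change of variables. -/
lemma sqrt_det_gramMatrix_change (c c' : M) {p : Eu n} (hp : p ∈ (chartAt (Eu n) c').target)
    (hp' : (chartAt (Eu n) c').symm p ∈ (chartAt (Eu n) c).source) :
    Real.sqrt (gramMatrix c' p).det =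
      |(fderiv ℝ (chartAt (Eu n) c ∘ (chartAt (Eu n) c').symm) p).det| *
        Real.sqrt (gramMatrix c (chartAt (Eu n) c ((chartAt (Eu n) c').symm p))).det := by
  set y := (chartAt (Eu n) c').symm p with hydef
  set L := fderiv ℝ (chartAt (Eu n) c ∘ (chartAt (Eu n) c').symm) p
  have e1 : gramB c' (stdB n) p = gramB c (fun i ↦ L (stdB n i)) (chartAt (Eu n) c y) := by
    ext i j
    simp only [gramB, Matrix.of_apply]
    rw [(chartAt (Eu n) c).left_inv hp', ← hydef, coordField_change c c' _ hp'
      ((chartAt (Eu n) c').map_target hp), coordField_change c c' (stdB n j) hp'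
      ((chartAt (Eu n) c').map_target hp), hydef, (chartAt (Eu n) c').right_inv hp]
  rw [gramMatrix_eq c' hp, gramMatrix_eq c ((chartAt (Eu n) c).map_source hp'), e1]
  have e2 := gramB_transform c (stdB n) (L : Eu n →ₗ[ℝ] Eu n) (chartAt (Eu n) c y)
  have e3 : (gramB c (fun i ↦ L (stdB n i)) (chartAt (Eu n) c y)).det =
      L.det ^ 2 * (gramB c (stdB n) (chartAt (Eu n) c y)).det := by
    refine (congrArg Matrix.det e2).trans ?_
    rw [Matrix.det_mul, Matrix.det_mul, Matrix.det_transpose, LinearMap.det_toMatrix]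
    change L.det * _ * L.det = _
    ring
  rw [e3, Real.sqrt_mul (sq_nonneg _), Real.sqrt_sq_eq_abs]

section Smooth
variable [IsContMDiffRiemannianBundle (𝓡 n) ∞ (Eu n) (fun x : M ↦ TangentSpace (𝓡 n) x)]

lemma contDiffOn_inner_coordField (c : M) (u w : Eu n) :
    ContDiffOn ℝ ∞ (fun p ↦ (inner ℝ (coordField c u ((chartAt (Eu n) c).symm p))
      (coordField c w ((chartAt (Eu n) c).symm p)) : ℝ)) (chartAt (Eu n) c).target := by
  intro p hp
  have hy := (chartAt (Eu n) c).map_target hp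
  have h := ContMDiffAt.inner_bundle (contMDiffAt_coordField c u hy) (contMDiffAt_coordField c w hy)
  have h2 := (contMDiffAt_iff_chart c hy (k := ⊤)).1 h
  rw [(chartAt (Eu n) c).right_inv hp] at h2
  exact h2.contDiffWithinAt

lemma contDiffOn_gramB (c : M) (b : Fin n → Eu n) (i j : Fin n) :
    ContDiffOn ℝ ∞ (fun p ↦ gramB c b p i j) (chartAt (Eu n) c).target :=
  contDiffOn_inner_coordField c (b i) (b j)

lemma continuousOn_det_gramMatrix (c : M) :
    ContinuousOn (fun p ↦ (gramMatrix c p).det) (chartAt (Eu n) c).target := by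
  have h : ContinuousOn (fun p ↦ (gramB c (stdB n) p).det) (chartAt (Eu n) c).target := by
    simp only [Matrix.det_apply]
    refine continuousOn_finsetSum _ fun σ _ ↦ ContinuousOn.const_smul
      (continuousOn_finsetProd _ fun i _ ↦ (contDiffOn_gramB c _ _ _).continuousOn) _
  exact h.congr fun p hp ↦ by rw [gramMatrix_eq c hp]
end Smooth

variable [MeasurableSpace M] [BorelSpace M]

/-- The inverse chart is controlled only on its target. Almost everywhere measurability for the
restricted measure is enough for the push-forward to be meaningful. -/
lemma aemeasurable_chart_symm (c : M) (ρ : Eu n → ENNReal) :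
    AEMeasurable (chartAt (Eu n) c).symm
      ((volume.restrict (chartAt (Eu n) c).target).withDensity ρ) :=
  ((chartAt (Eu n) c).continuousOn_symm.aemeasurable
    (chartAt (Eu n) c).open_target.measurableSet).mono_ac (withDensity_absolutelyContinuous _ _)

lemma chartVolume_apply (c : M) {s : Set M} (hs : MeasurableSet s) :
    chartVolume (n := n) c s =
      ∫⁻ p in (chartAt (Eu n) c).symm ⁻¹' s ∩ (chartAt (Eu n) c).target,
        ENNReal.ofReal (Real.sqrt (gramMatrix c p).det) := by
  rw [chartVolume, Measure.map_apply_of_aemeasurable (aemeasurable_chart_symm c _) hs,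
    withDensity_apply', Measure.restrict_restrict' (chartAt (Eu n) c).open_target.measurableSet]

lemma measurableSet_chart_preimage (c : M) {s : Set M} (hs : MeasurableSet s) :
    MeasurableSet ((chartAt (Eu n) c).symm ⁻¹' s ∩ (chartAt (Eu n) c).target) := by
  have h := (chartAt (Eu n) c).continuousOn_symm.domRestrict.measurable hs
  have := (MeasurableEmbedding.subtype_coe
    (chartAt (Eu n) c).open_target.measurableSet).measurableSet_image.2 h
  convert this using 1
  ext p
  simp [and_comm]

/-- Change of variables along the transition map `T`: the Jacobian is absorbed by
`sqrt_det_gramMatrix_change`. -/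
lemma chartVolume_eq_of_subset (c c' : M) {s : Set M} (hs : MeasurableSet s)
    (hc : s ⊆ (chartAt (Eu n) c).source) (hc' : s ⊆ (chartAt (Eu n) c').source) :
    chartVolume (n := n) c' s = chartVolume (n := n) c s := by
  rw [chartVolume_apply c hs, chartVolume_apply c' hs]
  set S' := (chartAt (Eu n) c').symm ⁻¹' s ∩ (chartAt (Eu n) c').target
  set T := chartAt (Eu n) c ∘ (chartAt (Eu n) c').symm with hT
  have himg : (chartAt (Eu n) c).symm ⁻¹' s ∩ (chartAt (Eu n) c).target = T '' S' := by
    ext p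
    constructor
    · rintro ⟨h1, h2⟩
      refine ⟨chartAt (Eu n) c' ((chartAt (Eu n) c).symm p), ⟨?_, ?_⟩, ?_⟩
      · rw [Set.mem_preimage, (chartAt (Eu n) c').left_inv (hc' h1)]; exact h1
      · exact (chartAt (Eu n) c').map_source (hc' h1)
      · rw [hT, Function.comp_apply, (chartAt (Eu n) c').left_inv (hc' h1),
          (chartAt (Eu n) c).right_inv h2]
    · rintro ⟨q, ⟨h1, h2⟩, rfl⟩
      refine ⟨?_, (chartAt (Eu n) c).map_source (hc h1)⟩
      rw [Set.mem_preimage, hT, Function.comp_apply, (chartAt (Eu n) c).left_inv (hc h1)]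
      exact h1
  have hdiff (p : Eu n) (hp : p ∈ S') : DifferentiableAt ℝ T p := by
    have hy := (chartAt (Eu n) c').map_target hp.2
    have h := (mdifferentiableAt_iff_chart c' hy).1 (mdifferentiableAt_chart c (hc hp.1))
    rwa [(chartAt (Eu n) c').right_inv hp.2] at h
  have hinj : Set.InjOn T S' := by
    intro p hp q hq hpq
    have h1 := (chartAt (Eu n) c).injOn (hc hp.1) (hc hq.1) hpq
    exact (chartAt (Eu n) c').symm.injOn hp.2 hq.2 h1
  rw [himg, lintegral_image_eq_lintegral_abs_det_fderiv_mul volume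
    (measurableSet_chart_preimage c' hs) (fun p hp ↦ (hdiff p hp).hasFDerivAt.hasFDerivWithinAt)
    hinj]
  refine setLIntegral_congr_fun (measurableSet_chart_preimage c' hs) fun p hp ↦ ?_
  beta_reduce
  rw [sqrt_det_gramMatrix_change c c' hp.2 (hc hp.1), ENNReal.ofReal_mul (abs_nonneg _)]
  rfl

lemma chartVolume_compl_source (c : M) :
    chartVolume (n := n) c (chartAt (Eu n) c).sourceᶜ = 0 := by
  rw [chartVolume_apply c (chartAt (Eu n) c).open_source.measurableSet.compl]
  have : (chartAt (Eu n) c).symm ⁻¹' (chartAt (Eu n) c).sourceᶜ ∩ (chartAt (Eu n) c).target = ∅ := by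
    ext p
    simp only [Set.mem_inter_iff, Set.mem_preimage, Set.mem_compl_iff, Set.mem_empty_iff_false,
      iff_false, not_and]
    exact fun h1 h2 ↦ h1 ((chartAt (Eu n) c).map_target h2)
  rw [this]
  simp

lemma chartVolume_restrict_source (c : M) :
    (chartVolume (n := n) c).restrict (chartAt (Eu n) c).source = chartVolume (n := n) c :=
  Measure.restrict_eq_self_of_ae_mem (chartVolume_compl_source c)

/-- The measure of `c'` lives on the domain of `c'`, so after restriction only the overlap counts,
and there the two chart measures agree. -/
lemma chartVolume_restrict_le (c c' : M) :
    (chartVolume (n := n) c').restrict (chartAt (Eu n) c).source ≤ chartVolume (n := n) c := by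
  refine Measure.le_iff.2 fun s hs ↦ ?_
  have ho := (chartAt (Eu n) c).open_source.measurableSet
  have ho' := (chartAt (Eu n) c').open_source.measurableSet
  rw [Measure.restrict_apply hs, ← chartVolume_restrict_source c', Measure.restrict_apply (hs.inter ho),
    chartVolume_eq_of_subset c c' ((hs.inter ho).inter ho') (fun x hx ↦ hx.1.2) (fun x hx ↦ hx.2)]
  exact measure_mono fun x hx ↦ hx.1.1

/-- On the domain of a chart, the Riemannian volume measure is that of the chart. -/
theorem riemannianVolume_restrict (c : M) :
    (riemannianVolume n M).restrict (chartAt (Eu n) c).source = chartVolume (n := n) c := by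
  have ho := (chartAt (Eu n) c).open_source.measurableSet
  refine le_antisymm ?_ ?_
  -- Each chart measure splits into a part inside the domain, bounded by the measure of `c`, and a
  -- part outside. The bound passes to the supremum, and restriction to the domain kills the second
  -- summand.
  · have h1 : riemannianVolume n M ≤ chartVolume (n := n) c +
        (riemannianVolume n M).restrict (chartAt (Eu n) c).sourceᶜ := by
      refine iSup_le fun c' ↦ ?_
      rw [← Measure.restrict_add_restrict_compl (μ := chartVolume (n := n) c') ho]
      exact add_le_add (chartVolume_restrict_le c c')
        (Measure.restrict_mono le_rfl (le_iSup (chartVolume (n := n)) c'))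
    refine (Measure.restrict_mono le_rfl h1).trans ?_
    rw [Measure.restrict_add, chartVolume_restrict_source, Measure.restrict_restrict ho]
    simp
  · conv_lhs => rw [← chartVolume_restrict_source c]
    exact Measure.restrict_mono le_rfl (le_iSup (chartVolume (n := n)) c)

/-- The integral over a compact set in the domain of a chart. -/
theorem setIntegral_riemannianVolume
    [IsContMDiffRiemannianBundle (𝓡 n) ∞ (Eu n) (fun x : M ↦ TangentSpace (𝓡 n) x)] [T2Space M]
    (c : M) {K : Set (Eu n)} (hK : IsCompact K)
    (hKs : K ⊆ (chartAt (Eu n) c).target) {f : M → ℝ}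
    (hf : ContinuousOn (fun p ↦ f ((chartAt (Eu n) c).symm p)) K) :
    ∫ x in (chartAt (Eu n) c).symm '' K, f x ∂(riemannianVolume n M) =
      ∫ p in K, f ((chartAt (Eu n) c).symm p) * Real.sqrt (gramMatrix c p).det := by
  set φ := chartAt (Eu n) c
  have hKc : IsCompact (φ.symm '' K) := hK.image_of_continuousOn (φ.continuousOn_symm.mono hKs)
  have hKm := hKc.measurableSet
  have hsub : φ.symm '' K ⊆ φ.source := by
    rintro _ ⟨p, hp, rfl⟩; exact φ.map_target (hKs hp)
  have hpre : φ.symm ⁻¹' (φ.symm '' K) ∩ φ.target = K := by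
    ext p
    constructor
    · rintro ⟨⟨q, hq, hqp⟩, hp⟩
      rwa [← φ.symm.injOn (hKs hq) hp hqp]
    · exact fun hp ↦ ⟨⟨p, hp, rfl⟩, hKs hp⟩
  have hfc : ContinuousOn f (φ.symm '' K) := by
    have : ContinuousOn ((fun p ↦ f (φ.symm p)) ∘ φ) (φ.symm '' K) := by
      refine hf.comp (φ.continuousOn.mono hsub) ?_
      rintro _ ⟨p, hp, rfl⟩
      rwa [φ.right_inv (hKs hp)]
    exact this.congr fun x hx ↦ by simp [φ.left_inv (hsub hx)]
  -- The compact set lies in one chart domain, where the volume is the push-forward of the weighted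
  -- Lebesgue measure.
  rw [← Measure.restrict_restrict_of_subset hsub, riemannianVolume_restrict c,
    ← integral_indicator hKm, chartVolume, integral_map (aemeasurable_chart_symm c _)
      ((aestronglyMeasurable_indicator_iff hKm).2 (hfc.aestronglyMeasurable hKm))]
  have hρ : ContinuousOn (fun p ↦ Real.sqrt (gramMatrix c p).det) φ.target :=
    (continuousOn_det_gramMatrix c).sqrt
  rw [integral_withDensity_eq_integral_toReal_smul₀
    ((hρ.aemeasurable φ.open_target.measurableSet).ennreal_ofReal) (by simp)]
  rw [setIntegral_congr_fun (g := K.indicator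
    fun p ↦ f (φ.symm p) * Real.sqrt (gramMatrix c p).det) φ.open_target.measurableSet,
    setIntegral_indicator hK.measurableSet, Set.inter_eq_right.2 hKs]
  intro p hp
  by_cases hpK : p ∈ K
  · have h1 := Set.indicator_of_mem (Set.mem_image_of_mem φ.symm hpK) f
    simp only [Set.indicator_of_mem hpK]
    erw [h1]
    rw [ENNReal.toReal_ofReal (Real.sqrt_nonneg _), smul_eq_mul, mul_comm]
  · have : φ.symm p ∉ φ.symm '' K := fun h ↦ hpK (hpre ▸ ⟨h, hp⟩)
    have h1 := Set.indicator_of_notMem this f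
    simp only [Set.indicator_of_notMem hpK]
    erw [h1, smul_zero]

end Volume

/-! ### Curvature forms with values in an algebra, later `F →L[ℝ] F`, and their Lie derivatives -/

section AlgebraCurvature

variable {n : ℕ} {E : Type*} [NormedRing E] [NormedAlgebra ℝ E]

/-- The curvature of the connection form `Γ` with values in an algebra. -/
def curvA (Γ : Eu n → (Eu n →L[ℝ] E)) (p u w : Eu n) : E :=
  fderiv ℝ Γ p u w - fderiv ℝ Γ p w u + Γ p u * Γ p w - Γ p w * Γ p u

/-- The linearization of the curvature at `Γ`. -/
def linCurv (Γ A : Eu n → (Eu n →L[ℝ] E)) (p u w : Eu n) : E :=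
  fderiv ℝ A p u w - fderiv ℝ A p w u + (A p u * Γ p w + Γ p u * A p w)
    - (A p w * Γ p u + Γ p w * A p u)

/-- The quadratic part of the curvature. -/
def quadCurv (A : Eu n → (Eu n →L[ℝ] E)) (p u w : Eu n) : E :=
  A p u * A p w - A p w * A p u

/-- The Lie derivative of the form `Γ` along the vector field `ψ v`. -/
def lieVar (Γ : Eu n → (Eu n →L[ℝ] E)) (v : Eu n) (ψ : Eu n → ℝ) (p : Eu n) : Eu n →L[ℝ] E :=
  ψ p • fderiv ℝ Γ p v + (fderiv ℝ ψ p).smulRight (Γ p v)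

/-- Curvature is a quadratic polynomial in the connection form, so the expansion in `t` has no
remainder. -/
lemma curvA_add_smul {Γ A : Eu n → (Eu n →L[ℝ] E)} {p : Eu n} (hΓ : DifferentiableAt ℝ Γ p)
    (hA : DifferentiableAt ℝ A p) (t : ℝ) (u w : Eu n) :
    curvA (Γ + t • A) p u w =
      curvA Γ p u w + t • linCurv Γ A p u w + t ^ 2 • quadCurv A p u w := by
  have h : fderiv ℝ (Γ + t • A) p = fderiv ℝ Γ p + t • fderiv ℝ A p := by
    rw [fderiv_add hΓ (hA.const_smul t), fderiv_const_smul hA]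
  simp only [curvA, linCurv, quadCurv, h, add_apply, smul_apply, Pi.add_apply, Pi.smul_apply,
    mul_add, add_mul, smul_mul_assoc, mul_smul_comm, smul_add, smul_sub, smul_smul, pow_two]
  abel

lemma lieVar_apply (Γ : Eu n → (Eu n →L[ℝ] E)) (v : Eu n) (ψ : Eu n → ℝ) (p w : Eu n) :
    lieVar Γ v ψ p w = ψ p • fderiv ℝ Γ p v w + fderiv ℝ ψ p w • Γ p v := by
  simp [lieVar]

lemma contDiffAt_lieVar {Γ : Eu n → (Eu n →L[ℝ] E)} {p : Eu n} (hΓ : ContDiffAt ℝ ∞ Γ p)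
    (v : Eu n) {ψ : Eu n → ℝ} (hψ : ContDiff ℝ ∞ ψ) : ContDiffAt ℝ ∞ (lieVar Γ v ψ) p := by
  have h1 : ContDiffAt ℝ ∞ (fun p ↦ fderiv ℝ Γ p v) p :=
    (hΓ.fderiv_right (m := ∞) le_rfl).clm_apply contDiffAt_const
  exact (hψ.contDiffAt.smul h1).add
    ((hψ.contDiffAt.fderiv_right (m := ∞) le_rfl).smulRight (hΓ.clm_apply contDiffAt_const))

lemma lieVar_eq_zero_of_notMem {Γ : Eu n → (Eu n →L[ℝ] E)} (v : Eu n) {ψ : Eu n → ℝ} {p : Eu n}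
    (hp : p ∉ tsupport ψ) : lieVar Γ v ψ p = 0 := by
  have h2 : fderiv ℝ ψ p = 0 := image_eq_zero_of_notMem_tsupport
    fun h ↦ hp (tsupport_fderiv_subset ℝ h)
  ext w
  simp [lieVar_apply, image_eq_zero_of_notMem_tsupport hp, h2]

lemma fderiv_fderiv_apply {W W' : Type*} [NormedAddCommGroup W] [NormedSpace ℝ W]
    [NormedAddCommGroup W'] [NormedSpace ℝ W'] {f : Eu n → (W' →L[ℝ] W)} {p : Eu n}
    (hf : DifferentiableAt ℝ f p) (u : Eu n) (w : W') :
    fderiv ℝ (fun p ↦ f p w) p u = fderiv ℝ f p u w := by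
  rw [fderiv_clm_apply hf (differentiableAt_const w)]
  simp

lemma contDiffAt_curvA {Γ : Eu n → (Eu n →L[ℝ] E)} {p : Eu n} (hΓ : ContDiffAt ℝ ∞ Γ p)
    (u w : Eu n) : ContDiffAt ℝ ∞ (fun p ↦ curvA Γ p u w) p := by
  have h1 (u w : Eu n) : ContDiffAt ℝ ∞ (fun p ↦ fderiv ℝ Γ p u w) p :=
    ((hΓ.fderiv_right (m := ∞) le_rfl).clm_apply contDiffAt_const).clm_apply contDiffAt_const
  have h2 (u : Eu n) : ContDiffAt ℝ ∞ (fun p ↦ Γ p u) p := hΓ.clm_apply contDiffAt_const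
  exact (((h1 u w).sub (h1 w u)).add ((h2 u).mul (h2 w))).sub ((h2 w).mul (h2 u))

lemma fderiv_curvA {Γ : Eu n → (Eu n →L[ℝ] E)} {p : Eu n} (hΓ : ContDiffAt ℝ ∞ Γ p)
    (u w v : Eu n) : fderiv ℝ (fun p ↦ curvA Γ p u w) p v =
      fderiv ℝ (fderiv ℝ Γ) p v u w - fderiv ℝ (fderiv ℝ Γ) p v w u
      + (Γ p u * fderiv ℝ Γ p v w + fderiv ℝ Γ p v u * Γ p w)
      - (Γ p w * fderiv ℝ Γ p v u + fderiv ℝ Γ p v w * Γ p u) := by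
  have hd := hΓ.differentiableAt (by simp)
  have hdd : DifferentiableAt ℝ (fderiv ℝ Γ) p :=
    (hΓ.fderiv_right (m := ∞) le_rfl).differentiableAt (by simp)
  have h1 (u w : Eu n) : HasFDerivAt (fun p ↦ fderiv ℝ Γ p u w)
      (fderiv ℝ (fun p ↦ fderiv ℝ Γ p u w) p) p :=
    ((hdd.clm_apply (differentiableAt_const u)).clm_apply (differentiableAt_const w)).hasFDerivAt
  have e1 (u w : Eu n) : fderiv ℝ (fun p ↦ fderiv ℝ Γ p u w) p v = fderiv ℝ (fderiv ℝ Γ) p v u w := by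
    rw [fderiv_fderiv_apply (f := fun p ↦ fderiv ℝ Γ p u)
      (hdd.clm_apply (differentiableAt_const u)), fderiv_fderiv_apply hdd]
  have h2 (u : Eu n) : HasFDerivAt (fun p ↦ Γ p u) (fderiv ℝ (fun p ↦ Γ p u) p) p :=
    (hd.clm_apply (differentiableAt_const u)).hasFDerivAt
  have e2 (u : Eu n) : fderiv ℝ (fun p ↦ Γ p u) p v = fderiv ℝ Γ p v u := fderiv_fderiv_apply hd v u
  have h := (((h1 u w).sub (h1 w u)).add ((h2 u).mul' (h2 w))).sub ((h2 w).mul' (h2 u))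
  have h3 := congrArg (fun L : Eu n →L[ℝ] E ↦ L v) h.fderiv
  refine h3.trans ?_
  simp [e1, e2]

/-- The Lie derivative of the connection form along `ψ v` changes the curvature by its Lie
derivative. -/
theorem linCurv_lieVar {Γ : Eu n → (Eu n →L[ℝ] E)} {p : Eu n} (hΓ : ContDiffAt ℝ ∞ Γ p)
    {ψ : Eu n → ℝ} (hψ : ContDiff ℝ ∞ ψ) (v u w : Eu n) :
    linCurv Γ (lieVar Γ v ψ) p u w = ψ p • fderiv ℝ (fun p ↦ curvA Γ p u w) p v
      + fderiv ℝ ψ p u • curvA Γ p v w + fderiv ℝ ψ p w • curvA Γ p u v := by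
  have hd := hΓ.differentiableAt (by simp)
  have hdd : DifferentiableAt ℝ (fderiv ℝ Γ) p :=
    (hΓ.fderiv_right (m := ∞) le_rfl).differentiableAt (by simp)
  have hψd := (hψ.contDiffAt (x := p)).differentiableAt (by simp)
  have hψdd : DifferentiableAt ℝ (fderiv ℝ ψ) p :=
    (hψ.contDiffAt.fderiv_right (m := ∞) le_rfl).differentiableAt (by simp)
  have hA := (contDiffAt_lieVar hΓ v hψ).differentiableAt (by simp)
  have e (u w : Eu n) : fderiv ℝ (lieVar Γ v ψ) p u w =
      ψ p • fderiv ℝ (fderiv ℝ Γ) p u v w + fderiv ℝ ψ p u • fderiv ℝ Γ p v w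
      + (fderiv ℝ ψ p w • fderiv ℝ Γ p u v + fderiv ℝ (fderiv ℝ ψ) p u w • Γ p v) := by
    rw [← fderiv_fderiv_apply hA]
    simp only [lieVar_apply]
    have h1 : DifferentiableAt ℝ (fun p ↦ fderiv ℝ Γ p v) p :=
      hdd.clm_apply (differentiableAt_const v)
    have h2 := (hψd.hasFDerivAt.smul (h1.clm_apply (differentiableAt_const w)).hasFDerivAt).add
      ((hψdd.clm_apply (differentiableAt_const w)).hasFDerivAt.smul
        (hd.clm_apply (differentiableAt_const v)).hasFDerivAt)
    refine (congrArg (fun L : Eu n →L[ℝ] E ↦ L u) h2.fderiv).trans ?_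
    simp [fderiv_fderiv_apply hd, fderiv_fderiv_apply h1, fderiv_fderiv_apply hdd,
      fderiv_fderiv_apply hψdd]
  -- Symmetry of second derivatives is the commutation of the Lie derivative with `d`: the Hessian
  -- terms of `ψ` cancel and those of `Γ` combine into the derivative of the curvature along `v`.
  have s1 : ∀ a b, fderiv ℝ (fderiv ℝ Γ) p a b = fderiv ℝ (fderiv ℝ Γ) p b a :=
    fun a b ↦ (hΓ.isSymmSndFDerivAt (by simp only [minSmoothness_of_isRCLikeNormedField]; exact WithTop.coe_le_coe.2 le_top)) a b
  have s2 : ∀ a b, fderiv ℝ (fderiv ℝ ψ) p a b = fderiv ℝ (fderiv ℝ ψ) p b a :=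
    fun a b ↦ (hψ.contDiffAt.isSymmSndFDerivAt (by simp only [minSmoothness_of_isRCLikeNormedField]; exact WithTop.coe_le_coe.2 le_top)) a b
  rw [fderiv_curvA hΓ]
  simp only [linCurv, e, lieVar_apply, curvA]
  rw [s1 u v, s1 w v, s2 w u]
  simp only [smul_add, smul_sub, add_mul, mul_add, smul_mul_assoc, mul_smul_comm]
  abel

end AlgebraCurvature

/-! ### Differentiation under the integral sign -/

section ParametricIntegral

variable {X : Type*} [TopologicalSpace X] [MeasurableSpace X] [OpensMeasurableSpace X] [T2Space X]

/-- Differentiation under the integral sign over a compact set. -/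
lemma hasDerivAt_setIntegral_of_continuousOn {μ : Measure X} [IsFiniteMeasureOnCompacts μ]
    {K : Set X} (hK : IsCompact K) {g g' : ℝ → X → ℝ}
    (hg : ∀ t, ContinuousOn (g t) K)
    (hg' : ContinuousOn (fun x : ℝ × X ↦ g' x.1 x.2) (Set.univ ×ˢ K))
    (hd : ∀ t, ∀ x ∈ K, HasDerivAt (fun t ↦ g t x) (g' t x) t) :
    HasDerivAt (fun t ↦ ∫ x in K, g t x ∂μ) (∫ x in K, g' 0 x ∂μ) 0 := by
  have hm := hK.measurableSet
  -- By compactness of `[-1, 1] × K` one constant dominates all derivatives near `t = 0`.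
  obtain ⟨C, hC⟩ := ((isCompact_Icc (a := (-1 : ℝ)) (b := 1)).prod hK).exists_bound_of_continuousOn
    (hg'.mono (Set.prod_mono (Set.subset_univ _) le_rfl))
  have hg0 : ContinuousOn (g' 0) K :=
    hg'.comp (f := fun x ↦ ((0 : ℝ), x)) (by fun_prop) fun x hx ↦ ⟨trivial, hx⟩
  refine (hasDerivAt_integral_of_dominated_loc_of_deriv_le (s := Set.Icc (-1) 1)
    (bound := fun _ ↦ C) (Icc_mem_nhds (by norm_num) (by norm_num))
    (.of_forall fun t ↦ (hg t).aestronglyMeasurable_of_isCompact hK hm)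
    ((hg 0).integrableOn_compact hK) (hg0.aestronglyMeasurable_of_isCompact hK hm) ?_ ?_ ?_).2
  · exact (ae_restrict_mem hm).mono fun x hx t ht ↦ hC (t, x) ⟨ht, hx⟩
  · exact integrableOn_const (hK.measure_lt_top.ne)
  · exact (ae_restrict_mem hm).mono fun x hx t _ ↦ hd t x hx

end ParametricIntegral

/-! ### Quadratic expressions in the curvature -/

section Quadratic

variable {n : ℕ} {E : Type*} [NormedAddCommGroup E] [NormedSpace ℝ E]

/-- The inner product `½ ∑ h^{ik} h^{jl} ⟨R_ij, S_kl⟩`. -/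
def normSqB (H : E →L[ℝ] E →L[ℝ] ℝ) (h : Matrix (Fin n) (Fin n) ℝ) (R S : Fin n → Fin n → E) : ℝ :=
  (1 / 2) * ∑ i, ∑ k, h i k * ∑ j, ∑ l, h j l * H (R i j) (S k l)

variable {H : E →L[ℝ] E →L[ℝ] ℝ} {h : Matrix (Fin n) (Fin n) ℝ}

lemma normSqB_comm (hH : ∀ x y, H x y = H y x) (hh : ∀ i j, h i j = h j i)
    (R S : Fin n → Fin n → E) : normSqB H h R S = normSqB H h S R := by
  unfold normSqB
  congr 1
  rw [Finset.sum_comm]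
  refine Finset.sum_congr rfl fun i _ ↦ Finset.sum_congr rfl fun k _ ↦ ?_
  rw [hh, Finset.sum_comm]
  congr 1
  refine Finset.sum_congr rfl fun j _ ↦ Finset.sum_congr rfl fun l _ ↦ ?_
  rw [hh, hH]

lemma contr_comm (hH : ∀ x y, H x y = H y x) (hh : ∀ i j, h i j = h j i)
    (R : Fin n → Fin n → E) (i k : Fin n) : contr H h R i k = contr H h R k i := by
  unfold contr
  rw [Finset.sum_comm]
  refine Finset.sum_congr rfl fun j _ ↦ Finset.sum_congr rfl fun l _ ↦ ?_
  rw [hh, hH]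

lemma hasDerivAt_normSq {R : ℝ → Fin n → Fin n → E} {R' : Fin n → Fin n → E} {t : ℝ}
    (hR : ∀ i j, HasDerivAt (fun t ↦ R t i j) (R' i j) t) :
    HasDerivAt (fun t ↦ normSq H h (R t)) (normSqB H h R' (R t) + normSqB H h (R t) R') t := by
  have h1 (i j k l : Fin n) : HasDerivAt (fun t ↦ H (R t i j) (R t k l))
      (H (R' i j) (R t k l) + H (R t i j) (R' k l)) t :=
    (H.hasFDerivAt.comp_hasDerivAt t (hR i j)).clm_apply (hR k l)
  have h2 := (HasDerivAt.fun_sum (u := Finset.univ) fun i _ ↦ HasDerivAt.fun_sum (u := Finset.univ) fun k _ ↦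
    (HasDerivAt.fun_sum (u := Finset.univ) fun j _ ↦ HasDerivAt.fun_sum (u := Finset.univ) fun l _ ↦
      (h1 i j k l).const_mul (h j l)).const_mul (h i k)).const_mul (1 / 2 : ℝ)
  refine h2.congr_deriv ?_
  simp only [normSqB, mul_add, Finset.sum_add_distrib]

lemma normSqB_add_left (R R' S : Fin n → Fin n → E) :
    normSqB H h (fun i j ↦ R i j + R' i j) S = normSqB H h R S + normSqB H h R' S := by
  simp only [normSqB, bilin_add_left, mul_add, Finset.sum_add_distrib]

lemma normSqB_smul_left (r : ℝ) (R S : Fin n → Fin n → E) :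
    normSqB H h (fun i j ↦ r • R i j) S = r * normSqB H h R S := by
  simp only [normSqB, bilin_smul_left, Finset.mul_sum]
  refine Finset.sum_congr rfl fun _ _ ↦ Finset.sum_congr rfl fun _ _ ↦ Finset.sum_congr rfl
    fun _ _ ↦ Finset.sum_congr rfl fun _ _ ↦ by ring

/-- With `x = dψ` this is one of the two terms of `L_X R` that differentiate `ψ`; it pairs with `R`
to half of `dψ` contracted with the raised tensor `C_m`. The other half is `normSqB_left_col`. -/
lemma normSqB_left_row (x : Fin n → ℝ) (R : Fin n → Fin n → E) (m : Fin n) :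
    normSqB H h (fun i j ↦ x i • R m j) R = 1 / 2 * ∑ i, x i * ∑ k, h i k * contr H h R m k := by
  simp only [normSqB, contr, bilin_smul_left, Finset.mul_sum]
  refine Finset.sum_congr rfl fun _ _ ↦ Finset.sum_congr rfl fun _ _ ↦ Finset.sum_congr rfl
    fun _ _ ↦ Finset.sum_congr rfl fun _ _ ↦ by ring

lemma normSqB_swap (R S : Fin n → Fin n → E) :
    normSqB H h (fun i j ↦ R j i) (fun i j ↦ S j i) = normSqB H h R S := by
  simp only [normSqB, Finset.mul_sum]
  calc _ = ∑ i, ∑ j, ∑ k, ∑ l, 1 / 2 * (h i k * (h j l * H (R j i) (S l k))) :=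
        Finset.sum_congr rfl fun i _ ↦ Finset.sum_comm
    _ = ∑ j, ∑ i, ∑ k, ∑ l, 1 / 2 * (h i k * (h j l * H (R j i) (S l k))) := Finset.sum_comm
    _ = ∑ j, ∑ i, ∑ l, ∑ k, 1 / 2 * (h i k * (h j l * H (R j i) (S l k))) :=
        Finset.sum_congr rfl fun i _ ↦ Finset.sum_congr rfl fun j _ ↦ Finset.sum_comm
    _ = ∑ j, ∑ l, ∑ i, ∑ k, 1 / 2 * (h i k * (h j l * H (R j i) (S l k))) :=
        Finset.sum_congr rfl fun i _ ↦ Finset.sum_comm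
    _ = _ := Finset.sum_congr rfl fun _ _ ↦ Finset.sum_congr rfl fun _ _ ↦ Finset.sum_congr rfl
      fun _ _ ↦ Finset.sum_congr rfl fun _ _ ↦ by ring

/-- Exchanging both pairs of indices and using the antisymmetry of `R` reduces this to
`normSqB_left_row`. -/
lemma normSqB_left_col (x : Fin n → ℝ) {R : Fin n → Fin n → E} (hR : ∀ i j, R i j = - R j i)
    (m : Fin n) :
    normSqB H h (fun i j ↦ x j • R i m) R = 1 / 2 * ∑ i, x i * ∑ k, h i k * contr H h R m k := by
  rw [← normSqB_left_row, ← normSqB_swap]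
  simp only [normSqB]
  congr 1
  refine Finset.sum_congr rfl fun i _ ↦ Finset.sum_congr rfl fun k _ ↦ ?_
  congr 1
  refine Finset.sum_congr rfl fun j _ ↦ Finset.sum_congr rfl fun l _ ↦ ?_
  rw [hR j m, hR l k, smul_neg, bilin_neg_neg]

section Regularity

variable {X : Type*} [TopologicalSpace X] {s : Set X} {h : X → Matrix (Fin n) (Fin n) ℝ}
  {R S : X → Fin n → Fin n → E}

lemma continuousOn_normSqB (hh : ∀ i j, ContinuousOn (fun x ↦ h x i j) s)
    (hR : ∀ i j, ContinuousOn (fun x ↦ R x i j) s) (hS : ∀ i j, ContinuousOn (fun x ↦ S x i j) s) :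
    ContinuousOn (fun x ↦ normSqB H (h x) (R x) (S x)) s := by
  unfold normSqB
  refine continuousOn_const.mul (continuousOn_finsetSum _ fun i _ ↦ continuousOn_finsetSum _ fun k _ ↦
    (hh i k).mul (continuousOn_finsetSum _ fun j _ ↦ continuousOn_finsetSum _ fun l _ ↦
    (hh j l).mul ?_))
  exact (H.continuous.comp_continuousOn (hR i j)).clm_apply (hS k l)

end Regularity

section RegularityDiff

variable {p : Eu n} {h : Eu n → Matrix (Fin n) (Fin n) ℝ}
  {R : Eu n → Fin n → Fin n → E}

lemma contDiffAt_contr (hh : ∀ i j, ContDiffAt ℝ ∞ (fun x ↦ h x i j) p)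
    (hR : ∀ i j, ContDiffAt ℝ ∞ (fun x ↦ R x i j) p) (i k : Fin n) :
    ContDiffAt ℝ ∞ (fun x ↦ contr H (h x) (R x) i k) p := by
  unfold contr
  refine ContDiffAt.sum fun j _ ↦ ContDiffAt.sum fun l _ ↦ (hh j l).mul ?_
  exact (H.contDiff.contDiffAt.comp p (hR i j)).clm_apply (hR k l)

lemma contDiffAt_normSq (hh : ∀ i j, ContDiffAt ℝ ∞ (fun x ↦ h x i j) p)
    (hR : ∀ i j, ContDiffAt ℝ ∞ (fun x ↦ R x i j) p) :
    ContDiffAt ℝ ∞ (fun x ↦ normSq H (h x) (R x)) p := by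
  unfold normSq
  exact contDiffAt_const.mul (ContDiffAt.sum fun i _ ↦ ContDiffAt.sum fun k _ ↦
    (hh i k).mul (contDiffAt_contr hh hR i k))

end RegularityDiff

end Quadratic

/-! ### The first variation of the local energy -/

section FirstVariation

variable {n : ℕ} {E : Type*} [NormedRing E] [NormedAlgebra ℝ E]

/-- The components of the curvature. -/
def curvMat (Γ : Eu n → (Eu n →L[ℝ] E)) (b : Fin n → Eu n) (p : Eu n) (i j : Fin n) : E :=
  curvA Γ p (b i) (b j)

lemma curvMat_swap (Γ : Eu n → (Eu n →L[ℝ] E)) (b : Fin n → Eu n) (p : Eu n) (i j : Fin n) :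
    curvMat Γ b p i j = - curvMat Γ b p j i := by
  simp only [curvMat, curvA]; abel

variable {H : E →L[ℝ] E →L[ℝ] ℝ} {h : Eu n → Matrix (Fin n) (Fin n) ℝ} {ρ : Eu n → ℝ}
  {Γ A : Eu n → (Eu n →L[ℝ] E)}

lemma continuousOn_comp_snd {X Z : Type*} [TopologicalSpace X] [TopologicalSpace Z] {K : Set X}
    {f : X → Z} (hf : ContinuousOn f K) :
    ContinuousOn (fun x : ℝ × X ↦ f x.2) (Set.univ ×ˢ K) :=
  hf.comp continuousOn_snd fun _ hx ↦ hx.2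

/-- The first variation of the exponential Yang-Mills energy on a compact set. -/
lemma hasDerivAt_energy (c₀ : ℝ) (b : Fin n → Eu n) {K : Set (Eu n)} (hK : IsCompact K)
    (hΓ : ∀ p ∈ K, ContDiffAt ℝ ∞ Γ p) (hA : ∀ p ∈ K, ContDiffAt ℝ ∞ A p)
    (hh : ∀ i j, ContinuousOn (fun p ↦ h p i j) K) (hρ : ContinuousOn ρ K)
    (hH : ∀ x y, H x y = H y x) (hs : ∀ p i j, h p i j = h p j i) :
    HasDerivAt (fun t : ℝ ↦ ∫ p in K,
        (Real.exp (normSq H (h p) (curvMat (Γ + t • A) b p) / 2) - c₀) * ρ p)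
      (∫ p in K, Real.exp (normSq H (h p) (curvMat Γ b p) / 2) *
        normSqB H (h p) (fun i j ↦ linCurv Γ A p (b i) (b j)) (curvMat Γ b p) * ρ p) 0 := by
  let R : Eu n → Fin n → Fin n → E := curvMat Γ b
  let L : Eu n → Fin n → Fin n → E := fun p i j ↦ linCurv Γ A p (b i) (b j)
  let S : Eu n → Fin n → Fin n → E := fun p i j ↦ quadCurv A p (b i) (b j)
  -- On `K` this polynomial in `t` is the curvature of `Γ + t • A`. It makes the joint continuity in
  -- `(t, p)` explicit, and `T'` is its derivative in `t`.
  let T : ℝ → Eu n → Fin n → Fin n → E := fun t p i j ↦ R p i j + t • L p i j + t ^ 2 • S p i j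
  let T' : ℝ → Eu n → Fin n → Fin n → E := fun t p i j ↦ L p i j + (2 * t) • S p i j
  have hcA (B : Eu n → (Eu n →L[ℝ] E)) (hB : ∀ p ∈ K, ContDiffAt ℝ ∞ B p) (u : Eu n) :
      ContinuousOn (fun p ↦ B p u) K :=
    fun p hp ↦ ((hB p hp).clm_apply contDiffAt_const).continuousAt.continuousWithinAt
  have hcD (B : Eu n → (Eu n →L[ℝ] E)) (hB : ∀ p ∈ K, ContDiffAt ℝ ∞ B p) (u w : Eu n) :
      ContinuousOn (fun p ↦ fderiv ℝ B p u w) K :=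
    fun p hp ↦ ((((hB p hp).fderiv_right (m := ∞) le_rfl).clm_apply contDiffAt_const).clm_apply
      contDiffAt_const).continuousAt.continuousWithinAt
  have hR : ∀ i j, ContinuousOn (fun p ↦ R p i j) K := fun i j p hp ↦
    (contDiffAt_curvA (hΓ p hp) _ _).continuousAt.continuousWithinAt
  have hL : ∀ i j, ContinuousOn (fun p ↦ L p i j) K := fun i j ↦
    (((hcD A hA _ _).sub (hcD A hA _ _)).add (((hcA A hA _).mul (hcA Γ hΓ _)).add
      ((hcA Γ hΓ _).mul (hcA A hA _)))).sub (((hcA A hA _).mul (hcA Γ hΓ _)).add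
      ((hcA Γ hΓ _).mul (hcA A hA _)))
  have hS : ∀ i j, ContinuousOn (fun p ↦ S p i j) K := fun i j ↦
    ((hcA A hA _).mul (hcA A hA _)).sub ((hcA A hA _).mul (hcA A hA _))
  have hT : ∀ i j, ContinuousOn (fun x : ℝ × Eu n ↦ T x.1 x.2 i j) (Set.univ ×ˢ K) := fun i j ↦
    ((continuousOn_comp_snd (hR i j)).add (continuousOn_fst.smul (continuousOn_comp_snd (hL i j)))).add
      ((continuousOn_fst.pow 2).smul (continuousOn_comp_snd (hS i j)))
  have hT' : ∀ i j, ContinuousOn (fun x : ℝ × Eu n ↦ T' x.1 x.2 i j) (Set.univ ×ˢ K) := fun i j ↦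
    (continuousOn_comp_snd (hL i j)).add ((continuousOn_const.mul continuousOn_fst).smul (continuousOn_comp_snd (hS i j)))
  have hh' : ∀ i j, ContinuousOn (fun x : ℝ × Eu n ↦ h x.2 i j) (Set.univ ×ˢ K) :=
    fun i j ↦ continuousOn_comp_snd (hh i j)
  have hq := continuousOn_normSqB (H := H) hh' hT hT
  have hexp : ContinuousOn (fun x : ℝ × Eu n ↦ Real.exp (normSq H (h x.2) (T x.1 x.2) / 2))
      (Set.univ ×ˢ K) := (hq.div_const 2).rexp
  have key := hasDerivAt_setIntegral_of_continuousOn (μ := volume) hK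
    (g := fun t p ↦ (Real.exp (normSq H (h p) (T t p) / 2) - c₀) * ρ p)
    (g' := fun t p ↦ (Real.exp (normSq H (h p) (T t p) / 2) *
      ((normSqB H (h p) (T' t p) (T t p) + normSqB H (h p) (T t p) (T' t p)) / 2)) * ρ p)
    ?_ ?_ ?_
  · have e1 : (fun t : ℝ ↦ ∫ p in K,
        (Real.exp (normSq H (h p) (curvMat (Γ + t • A) b p) / 2) - c₀) * ρ p) =
        fun t ↦ ∫ p in K, (Real.exp (normSq H (h p) (T t p) / 2) - c₀) * ρ p := by
      ext t
      refine setIntegral_congr_fun hK.measurableSet fun p hp ↦ ?_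
      have : curvMat (Γ + t • A) b p = T t p := by
        ext i j
        exact curvA_add_smul ((hΓ p hp).differentiableAt (by simp))
          ((hA p hp).differentiableAt (by simp)) t _ _
      beta_reduce
      rw [this]
    rw [e1]
    refine key.congr_deriv (setIntegral_congr_fun hK.measurableSet fun p hp ↦ ?_)
    have h0 : T 0 p = curvMat Γ b p := by ext i j; simp [T, R]
    have h0' : T' 0 p = L p := by ext i j; simp [T']
    -- By symmetry both terms of the derivative of the norm are equal, which cancels the factor
    -- `1/2` in the exponent.
    rw [h0, h0', normSqB_comm hH (hs p) (curvMat Γ b p)]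
    ring
  · intro t
    have := hexp.comp (f := fun p ↦ (t, p)) (s := K) (by fun_prop) fun x hx ↦ ⟨trivial, hx⟩
    exact (this.sub continuousOn_const).mul hρ
  · exact (hexp.mul (((continuousOn_normSqB hh' hT' hT).add
      (continuousOn_normSqB hh' hT hT')).div_const 2)).mul (continuousOn_comp_snd hρ)
  · intro t p hp
    have hTd : ∀ i j, HasDerivAt (fun t ↦ T t p i j) (T' t p i j) t := fun i j ↦ by
      have h1 := (((hasDerivAt_id t).smul_const (L p i j)).const_add (R p i j)).add
        (((hasDerivAt_id t).pow 2).smul_const (S p i j))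
      refine h1.congr_deriv ?_
      simp [T']
    exact (((hasDerivAt_normSq hTd).div_const 2).exp.sub_const c₀).mul_const (ρ p)

end FirstVariation

/-! ### Integration by parts and the local form of criticality -/

section EulerLagrange

variable {n : ℕ}

lemma continuous_of_continuousOn_of_tsupport {X : Type*} [TopologicalSpace X] {f : X → ℝ}
    {U K : Set X} (hU : IsOpen U) (hK : IsClosed K) (hKU : K ⊆ U) (hf : ContinuousOn f U)
    (h0 : ∀ x ∉ K, f x = 0) : Continuous f := by
  rw [continuous_iff_continuousAt]
  intro x
  by_cases hx : x ∈ K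
  · exact hf.continuousAt (hU.mem_nhds (hKU hx))
  · refine (continuousAt_const (y := (0 : ℝ))).congr ?_
    filter_upwards [hK.isOpen_compl.mem_nhds hx] with y hy
    exact (h0 y hy).symm

/-- `Y` is smooth on `U` only. All products contain `ψ` or its derivative and extend by zero to
continuous functions with compact support, so the boundaryless formula applies. -/
lemma integral_fderiv_mul_eq_neg {U : Set (Eu n)} (hU : IsOpen U) {ψ Y : Eu n → ℝ}
    (hψ : ContDiff ℝ ∞ ψ) (hc : HasCompactSupport ψ) (hψU : tsupport ψ ⊆ U)
    (hY : ContDiffOn ℝ ∞ Y U) (v : Eu n) :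
    Integrable (fun p ↦ fderiv ℝ ψ p v * Y p) ∧ Integrable (fun p ↦ ψ p * fderiv ℝ Y p v) ∧
      ∫ p, fderiv ℝ ψ p v * Y p = - ∫ p, ψ p * fderiv ℝ Y p v := by
  have hψ0 (p) (hp : p ∉ tsupport ψ) : ψ p = 0 := image_eq_zero_of_notMem_tsupport hp
  have hψ0' (p) (hp : p ∉ tsupport ψ) : fderiv ℝ ψ p = 0 :=
    image_eq_zero_of_notMem_tsupport fun h ↦ hp (tsupport_fderiv_subset ℝ h)
  have hψ' : Continuous fun p ↦ fderiv ℝ ψ p v :=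
    (hψ.continuous_fderiv (by simp)).clm_apply continuous_const
  have hY' : ContinuousOn (fun p ↦ fderiv ℝ Y p v) U :=
    (hY.continuousOn_fderiv_of_isOpen hU (by simp)).clm_apply continuousOn_const
  have hint {f : Eu n → ℝ} (hf : ContinuousOn f U) (h0 : ∀ x ∉ tsupport ψ, f x = 0) :
      Integrable f :=
    (continuous_of_continuousOn_of_tsupport hU (isClosed_tsupport ψ) hψU hf h0).integrable_of_hasCompactSupport
      (HasCompactSupport.intro hc h0)
  have i1 : Integrable (fun p ↦ fderiv ℝ ψ p v * Y p) :=
    hint (hψ'.continuousOn.mul hY.continuousOn) fun p hp ↦ by simp [hψ0' p hp]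
  have i2 : Integrable (fun p ↦ ψ p * fderiv ℝ Y p v) :=
    hint (hψ.continuous.continuousOn.mul hY') fun p hp ↦ by simp [hψ0 p hp]
  have i3 : Integrable (fun p ↦ ψ p * Y p) :=
    hint (hψ.continuous.continuousOn.mul hY.continuousOn) fun p hp ↦ by simp [hψ0 p hp]
  refine ⟨i1, i2, ?_⟩
  rw [integral_mul_fderiv_eq_neg_fderiv_mul_of_integrable i1 i2 i3
    (fun x _ ↦ hψ.differentiable (by simp) x)
    (fun x hx ↦ (hY.contDiffAt (hU.mem_nhds (hψU hx))).differentiableAt (by simp)), neg_neg]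

/-- The fundamental lemma of the calculus of variations for first order expressions. -/
lemma eq_sum_fderiv_of_integral_eq_zero {U : Set (Eu n)} (hU : IsOpen U) {Z : Eu n → ℝ}
    {Y : Fin n → Eu n → ℝ} (hZ : ContinuousOn Z U) (hY : ∀ i, ContDiffOn ℝ ∞ (Y i) U)
    (b : Fin n → Eu n)
    (hint : ∀ ψ : Eu n → ℝ, ContDiff ℝ ∞ ψ → HasCompactSupport ψ → tsupport ψ ⊆ U →
      ∫ p in tsupport ψ, (ψ p * Z p + ∑ i, fderiv ℝ ψ p (b i) * Y i p) = 0) :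
    ∀ p ∈ U, Z p = ∑ i, fderiv ℝ (Y i) p (b i) := by
  have hY' : ContinuousOn (fun p ↦ ∑ i, fderiv ℝ (Y i) p (b i)) U :=
    continuousOn_finsetSum _ fun i _ ↦
      ((hY i).continuousOn_fderiv_of_isOpen hU (by simp)).clm_apply continuousOn_const
  have key : ∀ᵐ p, p ∈ U → Z p - ∑ i, fderiv ℝ (Y i) p (b i) = 0 := by
    refine hU.ae_eq_zero_of_integral_contDiff_smul_eq_zero
      ((hZ.sub hY').locallyIntegrableOn hU.measurableSet) fun ψ hψ hc hψU ↦ ?_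
    have h := hint ψ hψ hc hψU
    have hψ0 (p) (hp : p ∉ tsupport ψ) : ψ p = 0 := image_eq_zero_of_notMem_tsupport hp
    have hψ0' (p) (hp : p ∉ tsupport ψ) : fderiv ℝ ψ p = 0 :=
      image_eq_zero_of_notMem_tsupport fun h ↦ hp (tsupport_fderiv_subset ℝ h)
    rw [setIntegral_eq_integral_of_forall_compl_eq_zero fun p hp ↦ by
      simp [hψ0 p hp, hψ0' p hp]] at h
    have h1 (i : Fin n) := integral_fderiv_mul_eq_neg hU hψ hc hψU (hY i) (b i)
    have iZ : Integrable (fun p ↦ ψ p * Z p) :=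
      (continuous_of_continuousOn_of_tsupport hU (isClosed_tsupport ψ) hψU
        (hψ.continuous.continuousOn.mul hZ)
        fun p hp ↦ by simp [hψ0 p hp]).integrable_of_hasCompactSupport
        (HasCompactSupport.intro hc fun p hp ↦ by simp [hψ0 p hp])
    rw [integral_add iZ (integrable_finsetSum _ fun i _ ↦ (h1 i).1),
      integral_finsetSum _ fun i _ ↦ (h1 i).1] at h
    simp only [smul_eq_mul, mul_sub, Finset.mul_sum]
    rw [integral_sub iZ (integrable_finsetSum _ fun i _ ↦ (h1 i).2.1),
      integral_finsetSum _ fun i _ ↦ (h1 i).2.1, ← h, Finset.sum_congr rfl fun i _ ↦ (h1 i).2.2,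
      Finset.sum_neg_distrib, sub_eq_add_neg]
  -- The fundamental lemma gives equality almost everywhere; continuity on the open set `U` makes it
  -- pointwise.
  have h2 := Measure.eqOn_open_of_ae_eq (μ := volume) (f := Z)
    (g := fun p ↦ ∑ i, fderiv ℝ (Y i) p (b i))
    ((ae_restrict_iff' hU.measurableSet).2 (key.mono fun p hp hpU ↦ sub_eq_zero.1 (hp hpU)))
    hU hZ hY'
  exact h2

variable {E : Type*} [NormedRing E] [NormedAlgebra ℝ E]
  {H : E →L[ℝ] E →L[ℝ] ℝ} {h : Eu n → Matrix (Fin n) (Fin n) ℝ} {ρ : Eu n → ℝ}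
  {Γ : Eu n → (Eu n →L[ℝ] E)}

/-- The consequence of the invariance under diffeomorphisms, for a connection form that is critical
under variations by Lie derivatives. -/
theorem divergence_identity {U : Set (Eu n)} (hU : IsOpen U) (hΓ : ContDiffOn ℝ ∞ Γ U)
    (hh : ∀ i j, ContDiffOn ℝ ∞ (fun p ↦ h p i j) U) (hρ : ContDiffOn ℝ ∞ ρ U)
    (hH : ∀ x y, H x y = H y x) (hs : ∀ p i j, h p i j = h p j i) (c₀ : ℝ)
    (b : Fin n → Eu n) (m : Fin n)
    (hcrit : ∀ ψ : Eu n → ℝ, ContDiff ℝ ∞ ψ → HasCompactSupport ψ → tsupport ψ ⊆ U →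
      HasDerivAt (fun t : ℝ ↦ ∫ p in tsupport ψ, (Real.exp (normSq H (h p)
        (curvMat (Γ + t • lieVar Γ (b m) ψ) b p) / 2) - c₀) * ρ p) 0 0) :
    ∀ p ∈ U, Real.exp (normSq H (h p) (curvMat Γ b p) / 2) * ρ p *
        normSqB H (h p) (fun i j ↦ fderiv ℝ (fun p ↦ curvMat Γ b p i j) p (b m)) (curvMat Γ b p) =
      ∑ i, fderiv ℝ (fun p ↦ Real.exp (normSq H (h p) (curvMat Γ b p) / 2) * ρ p *
        ∑ a, h p i a * contr H (h p) (curvMat Γ b p) m a) p (b i) := by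
  have hΓ' (p) (hp : p ∈ U) : ContDiffAt ℝ ∞ Γ p := hΓ.contDiffAt (hU.mem_nhds hp)
  have hh' (p) (hp : p ∈ U) (i j) : ContDiffAt ℝ ∞ (fun p ↦ h p i j) p :=
    (hh i j).contDiffAt (hU.mem_nhds hp)
  have hR (p) (hp : p ∈ U) (i j) : ContDiffAt ℝ ∞ (fun p ↦ curvMat Γ b p i j) p :=
    contDiffAt_curvA (hΓ' p hp) _ _
  have hf : ContDiffOn ℝ ∞ (fun p ↦ Real.exp (normSq H (h p) (curvMat Γ b p) / 2) * ρ p) U :=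
    fun p hp ↦ ((((contDiffAt_normSq (hh' p hp) (hR p hp)).div_const 2).exp).mul
      (hρ.contDiffAt (hU.mem_nhds hp))).contDiffWithinAt
  refine eq_sum_fderiv_of_integral_eq_zero hU ?_ (fun i ↦ ?_) b fun ψ hψ hc hψU ↦ ?_
  · refine hf.continuousOn.mul (continuousOn_normSqB (fun i j ↦ (hh i j).continuousOn)
      (fun i j p hp ↦ ?_) fun i j p hp ↦ (hR p hp i j).continuousAt.continuousWithinAt)
    exact (((hR p hp i j).fderiv_right (m := ∞) le_rfl).clm_apply
      contDiffAt_const).continuousAt.continuousWithinAt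
  · exact fun p hp ↦ (hf p hp).mul (ContDiffAt.sum fun a _ ↦ (hh' p hp i a).mul
      (contDiffAt_contr (hh' p hp) (hR p hp) m a)).contDiffWithinAt
  · have h1 := hasDerivAt_energy (H := H) (h := h) (ρ := ρ) c₀ b hc (fun p hp ↦ hΓ' p (hψU hp))
      (fun p hp ↦ contDiffAt_lieVar (hΓ' p (hψU hp)) (b m) hψ)
      (fun i j ↦ (hh i j).continuousOn.mono hψU) (hρ.continuousOn.mono hψU) hH hs
    -- The same derivative is the first variation integral and is zero by criticality; it remains to
    -- match the integrands.
    have h2 := h1.unique (hcrit ψ hψ hc hψU)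
    rw [← h2]
    refine setIntegral_congr_fun hc.isCompact.measurableSet fun p hp ↦ ?_
    -- This is `L_X R` in components for `X = ψ b_m`: one term along `b_m` and two terms with `dψ`,
    -- whose halves add up below.
    have e : (fun i j ↦ linCurv Γ (lieVar Γ (b m) ψ) p (b i) (b j)) = fun i j ↦
        (ψ p • fderiv ℝ (fun p ↦ curvMat Γ b p i j) p (b m)
          + fderiv ℝ ψ p (b i) • curvMat Γ b p m j) + fderiv ℝ ψ p (b j) • curvMat Γ b p i m := by
      ext i j
      exact linCurv_lieVar (hΓ' p (hψU hp)) hψ _ _ _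
    beta_reduce
    rw [e, normSqB_add_left, normSqB_add_left, normSqB_smul_left,
      normSqB_left_row (fun i ↦ fderiv ℝ ψ p (b i)),
      normSqB_left_col (fun i ↦ fderiv ℝ ψ p (b i)) (curvMat_swap Γ b p)]
    have e2 : ∑ i, fderiv ℝ ψ p (b i) * (Real.exp (normSq H (h p) (curvMat Γ b p) / 2) * ρ p *
        ∑ a, h p i a * contr H (h p) (curvMat Γ b p) m a) =
        Real.exp (normSq H (h p) (curvMat Γ b p) / 2) * ρ p *
          ∑ i, fderiv ℝ ψ p (b i) * ∑ a, h p i a * contr H (h p) (curvMat Γ b p) m a := by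
      rw [Finset.mul_sum]
      exact Finset.sum_congr rfl fun i _ ↦ by ring
    rw [e2]
    ring

end EulerLagrange

/-! ### Derivatives of determinant, inverse and norm along curves -/

section MatrixCurves

variable {n : ℕ}

/-- Jacobi's formula at the identity from the Leibniz expansion: a nontrivial permutation moves at
least two indices, so after differentiating one factor another off-diagonal factor still vanishes.
-/
lemma hasDerivAt_det_of_eq_one {G : ℝ → Matrix (Fin n) (Fin n) ℝ} {G' : Fin n → Fin n → ℝ} {t : ℝ}
    (hG : ∀ i j, HasDerivAt (fun t ↦ G t i j) (G' i j) t) (h1 : G t = 1) :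
    HasDerivAt (fun t ↦ (G t).det) (∑ i, G' i i) t := by
  simp only [Matrix.det_apply']
  have h := HasDerivAt.fun_sum (u := Finset.univ) fun σ : Equiv.Perm (Fin n) ↦ fun _ ↦
    (HasDerivAt.fun_finsetProd (u := Finset.univ) fun i _ ↦ hG (σ i) i).const_mul
      (((Equiv.Perm.sign σ : ℤˣ) : ℤ) : ℝ)
  refine h.congr_deriv ?_
  rw [Finset.sum_eq_single_of_mem (1 : Equiv.Perm (Fin n)) (Finset.mem_univ _)]
  · simp only [Equiv.Perm.sign_one, Units.val_one, Int.cast_one, one_mul, Equiv.Perm.one_apply,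
      smul_eq_mul]
    refine Finset.sum_congr rfl fun i _ ↦ ?_
    rw [Finset.prod_eq_one fun j _ ↦ by rw [h1, Matrix.one_apply_eq], one_mul]
  · intro σ _ hσ
    rw [Finset.sum_eq_zero, mul_zero]
    intro i _
    -- If `σ` fixed every index except `i`, injectivity would force it to fix `i` as well.
    have : ∃ j ∈ Finset.univ.erase i, σ j ≠ j := by
      by_contra! hc
      refine hσ (Equiv.ext fun k ↦ ?_)
      have hk : ∀ k, k ≠ i → σ k = k := fun k hk ↦ hc k (by simp [hk])
      by_cases h : k = i
      · subst h
        by_contra hne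
        exact hne (σ.injective (hk (σ k) hne))
      · exact hk k h
    obtain ⟨j, hj, hne⟩ := this
    rw [Finset.prod_eq_zero hj (by rw [h1, Matrix.one_apply_ne hne]), zero_smul]

/-- Differentiate `h G = 1` at a point where both factors are the identity. -/
lemma hasDerivAt_inv_of_eq_one {G h : ℝ → Matrix (Fin n) (Fin n) ℝ} {G' h' : Fin n → Fin n → ℝ}
    {t : ℝ} (hG : ∀ i j, HasDerivAt (fun t ↦ G t i j) (G' i j) t)
    (hh : ∀ i j, HasDerivAt (fun t ↦ h t i j) (h' i j) t) (hG1 : G t = 1)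
    (hinv : ∀ᶠ s in 𝓝 t, h s * G s = 1) (i j : Fin n) : h' i j = - G' i j := by
  have hh1 : h t = 1 := by simpa [hG1] using hinv.self_of_nhds
  have h1 := HasDerivAt.fun_sum (u := Finset.univ) fun a _ ↦ (hh i a).mul (hG a j)
  have h2 : HasDerivAt (fun _ : ℝ ↦ (1 : Matrix (Fin n) (Fin n) ℝ) i j) 0 t := hasDerivAt_const _ _
  have h3 := h2.congr_of_eventuallyEq (f₁ := fun s ↦ ∑ a, h s i a * G s a j) (by
    filter_upwards [hinv] with s hs
    rw [← hs, Matrix.mul_apply])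
  have h4 := h1.unique h3
  simp only [hG1, hh1, Finset.sum_add_distrib, Matrix.one_apply, mul_ite, mul_one, mul_zero, ite_mul,
    one_mul, zero_mul, Finset.sum_ite_eq, Finset.sum_ite_eq', Finset.mem_univ, if_true] at h4
  linarith

variable {E : Type*} [NormedAddCommGroup E] [NormedSpace ℝ E] {H : E →L[ℝ] E →L[ℝ] ℝ}

/-- Unlike in the first variation, the inverse metric moves too. Its two occurrences contribute
equally, which cancels the factor `1/2` of `normSq`. -/
lemma hasDerivAt_normSq_curve {h : ℝ → Matrix (Fin n) (Fin n) ℝ} {h' : Fin n → Fin n → ℝ}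
    {R : ℝ → Fin n → Fin n → E} {R' : Fin n → Fin n → E} {t : ℝ}
    (hh : ∀ i j, HasDerivAt (fun t ↦ h t i j) (h' i j) t)
    (hR : ∀ i j, HasDerivAt (fun t ↦ R t i j) (R' i j) t) (hRs : ∀ i j, R t i j = - R t j i) :
    HasDerivAt (fun t ↦ normSq H (h t) (R t))
      (∑ i, ∑ k, h' i k * contr H (h t) (R t) i k
        + (normSqB H (h t) R' (R t) + normSqB H (h t) (R t) R')) t := by
  have h1 (i j k l : Fin n) : HasDerivAt (fun t ↦ H (R t i j) (R t k l))
      (H (R' i j) (R t k l) + H (R t i j) (R' k l)) t :=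
    (H.hasFDerivAt.comp_hasDerivAt t (hR i j)).clm_apply (hR k l)
  have h2 := (HasDerivAt.fun_sum (u := Finset.univ) fun i _ ↦ HasDerivAt.fun_sum (u := Finset.univ) fun k _ ↦
    (hh i k).mul (HasDerivAt.fun_sum (u := Finset.univ) fun j _ ↦
      HasDerivAt.fun_sum (u := Finset.univ) fun l _ ↦ (hh j l).mul (h1 i j k l))).const_mul
      (1 / 2 : ℝ)
  refine h2.congr_deriv ?_
  -- Antisymmetry of `R t` in both factors exchanges the roles of the two index pairs, turning the
  -- second occurrence of `h'` into the first.
  have e1 : ∑ i, ∑ k, h t i k * ∑ j, ∑ l, h' j l * H (R t i j) (R t k l) =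
      ∑ i, ∑ k, h' i k * contr H (h t) (R t) i k := by
    simp only [contr, Finset.mul_sum]
    calc _ = ∑ i, ∑ j, ∑ k, ∑ l, h t i k * (h' j l * H (R t i j) (R t k l)) :=
          Finset.sum_congr rfl fun i _ ↦ Finset.sum_comm
      _ = ∑ j, ∑ i, ∑ k, ∑ l, h t i k * (h' j l * H (R t i j) (R t k l)) := Finset.sum_comm
      _ = ∑ j, ∑ i, ∑ l, ∑ k, h t i k * (h' j l * H (R t i j) (R t k l)) :=
          Finset.sum_congr rfl fun i _ ↦ Finset.sum_congr rfl fun j _ ↦ Finset.sum_comm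
      _ = ∑ j, ∑ l, ∑ i, ∑ k, h t i k * (h' j l * H (R t i j) (R t k l)) :=
          Finset.sum_congr rfl fun i _ ↦ Finset.sum_comm
      _ = _ := Finset.sum_congr rfl fun j _ ↦ Finset.sum_congr rfl fun l _ ↦ Finset.sum_congr rfl
        fun i _ ↦ Finset.sum_congr rfl fun k _ ↦ by
          rw [hRs i j, hRs k l, bilin_neg_neg]; ring
  have e2 : (fun i k ↦ h' i k * ∑ j, ∑ l, h t j l * H (R t i j) (R t k l)) =
      fun i k ↦ h' i k * contr H (h t) (R t) i k := rfl
  simp only [Pi.mul_apply, normSqB, mul_add, Finset.sum_add_distrib, e1]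
  simp only [contr]
  ring

end MatrixCurves

/-! ### From the local identity to the divergence -/

section PointwiseIdentity

variable {n : ℕ}

/-- The divergence of the stress-energy tensor at the centre of coordinates with `g_ij = δ_ij`. -/
lemma divergence_algebra (m : Fin n) (f c₀ D : ℝ) (df : Fin n → ℝ) (C : Fin n → Fin n → ℝ)
    (dC dG : Fin n → Fin n → Fin n → ℝ) (hC : ∀ i k, C i k = C k i)
    (hdC : ∀ l i k, dC l i k = dC l k i)
    (hdG : ∀ l i k, dG l i k = dG l k i)
    (h1 : df m = f * (D - 1 / 2 * ∑ i, ∑ k, dG m i k * C i k))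
    (h2 : f * D = ∑ i, ((df i + f * (1 / 2 * ∑ a, dG i a a)) * C m i
      + f * ∑ a, (- dG i i a * C m a) + f * dC i m i)) :
    ∑ i, ((df i * (1 : Matrix (Fin n) (Fin n) ℝ) i m + (f - c₀) * dG i i m
        - (df i * C i m + f * dC i i m))
      - ∑ l, 1 / 2 * (dG i i l + dG i i l - dG l i i) *
          ((f - c₀) * (1 : Matrix (Fin n) (Fin n) ℝ) l m - f * C l m)
      - ∑ l, 1 / 2 * (dG i m l + dG m i l - dG l i m) *
          ((f - c₀) * (1 : Matrix (Fin n) (Fin n) ℝ) i l - f * C i l)) = 0 := by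
  -- Two Christoffel terms of the second slot cancel, since their difference is antisymmetric in the
  -- indices contracted with the symmetric `C`.
  have s67 : ∑ i, ∑ l, dG l i m * C i l = ∑ i, ∑ l, dG i m l * C i l := by
    rw [Finset.sum_comm]
    refine Finset.sum_congr rfl fun i _ ↦ Finset.sum_congr rfl fun l _ ↦ ?_
    rw [hdG, hC]
  -- This trace of the derivative of the metric matches the derivative of the volume density in
  -- `h2`.
  have s4 : ∑ i, ∑ l, dG l i i * C l m = ∑ i, (∑ a, dG i a a) * C m i := by
    rw [Finset.sum_comm]
    refine Finset.sum_congr rfl fun i _ ↦ ?_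
    rw [Finset.sum_mul]
    refine Finset.sum_congr rfl fun l _ ↦ ?_
    rw [hC]
  -- The multiples of `f - c₀` in `t1` and `t2` add up to `dG i i m`, which cancels the derivative
  -- of the metric. This is the parallelism of `g`, and it is why `c₀` drops out.
  have t1 (i : Fin n) : ∑ l, 1 / 2 * (dG i i l + dG i i l - dG l i i) *
      ((f - c₀) * (1 : Matrix (Fin n) (Fin n) ℝ) l m - f * C l m) =
      (f - c₀) * (dG i i m - 1 / 2 * dG m i i) - f * ∑ l, dG i i l * C l m
        + 1 / 2 * f * ∑ l, dG l i i * C l m := by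
    have : ∀ l, 1 / 2 * (dG i i l + dG i i l - dG l i i) *
      ((f - c₀) * (1 : Matrix (Fin n) (Fin n) ℝ) l m - f * C l m) =
      (if l = m then (f - c₀) * (dG i i l - 1 / 2 * dG l i i) else 0) - f * (dG i i l * C l m)
        + 1 / 2 * f * (dG l i i * C l m) := by
      intro l; rw [Matrix.one_apply]; split_ifs <;> ring
    rw [Finset.sum_congr rfl fun l _ ↦ this l, Finset.sum_add_distrib, Finset.sum_sub_distrib,
      ← Finset.mul_sum, ← Finset.mul_sum]
    simp
  have t2 (i : Fin n) : ∑ l, 1 / 2 * (dG i m l + dG m i l - dG l i m) *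
          ((f - c₀) * (1 : Matrix (Fin n) (Fin n) ℝ) i l - f * C i l) =
      (f - c₀) * (1 / 2 * dG m i i) - 1 / 2 * f * ∑ l, dG i m l * C i l
        - 1 / 2 * f * ∑ l, dG m i l * C i l + 1 / 2 * f * ∑ l, dG l i m * C i l := by
    have : ∀ l, 1 / 2 * (dG i m l + dG m i l - dG l i m) *
          ((f - c₀) * (1 : Matrix (Fin n) (Fin n) ℝ) i l - f * C i l) =
      (if i = l then (f - c₀) * (1 / 2 * dG m i i) else 0) - 1 / 2 * f * (dG i m l * C i l)
        - 1 / 2 * f * (dG m i l * C i l) + 1 / 2 * f * (dG l i m * C i l) := by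
      intro l; rw [Matrix.one_apply]
      split_ifs with h
      · subst h; rw [hdG i m i]; ring
      · ring
    rw [Finset.sum_congr rfl fun l _ ↦ this l, Finset.sum_add_distrib, Finset.sum_sub_distrib,
      Finset.sum_sub_distrib, ← Finset.mul_sum, ← Finset.mul_sum, ← Finset.mul_sum]
    simp
  have t3 : ∑ i, df i * (1 : Matrix (Fin n) (Fin n) ℝ) i m = df m := by simp [Matrix.one_apply]
  simp only [t1, t2]
  simp only [Finset.sum_add_distrib, Finset.sum_sub_distrib, ← Finset.mul_sum, s67, t3,
    mul_sub]
  have h2' : f * D = ∑ i, df i * C i m + 1 / 2 * f * ∑ i, (∑ a, dG i a a) * C m i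
      - f * ∑ i, ∑ l, dG i i l * C l m + f * ∑ i, dC i i m := by
    rw [h2]
    simp only [Finset.mul_sum, ← Finset.sum_add_distrib, ← Finset.sum_sub_distrib]
    refine Finset.sum_congr rfl fun i _ ↦ ?_
    rw [hC i m, hdC i m i]
    have : ∑ l, f * (- dG i i l * C m l) = - ∑ l, f * (dG i i l * C l m) := by
      rw [← Finset.sum_neg_distrib]
      refine Finset.sum_congr rfl fun l _ ↦ ?_
      rw [hC m l]; ring
    rw [this]
    simp only [← Finset.mul_sum]
    ring
  rw [s4]
  linarith

variable {E : Type*} [NormedRing E] [NormedAlgebra ℝ E]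
  {H : E →L[ℝ] E →L[ℝ] ℝ} {G h : Eu n → Matrix (Fin n) (Fin n) ℝ} {ρ : Eu n → ℝ}
  {Γ : Eu n → (Eu n →L[ℝ] E)}

lemma hasDerivAt_line {W : Type*} [NormedAddCommGroup W] [NormedSpace ℝ W] {F : Eu n → W}
    {p₀ : Eu n} (hF : ContDiffAt ℝ ∞ F p₀) (v : Eu n) :
    HasDerivAt (fun t : ℝ ↦ F (p₀ + t • v)) (fderiv ℝ F p₀ v) 0 :=
  (hF.differentiableAt (by simp)).hasFDerivAt.hasLineDerivAt v

/-- Carry out the derivatives in `hid` at a point with `G = 1`; no vanishing of the first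
derivatives of the metric is assumed. The constant `a` compares the density of the standard
coordinates with that of the basis used for `G`. -/
theorem divergence_eq_zero_of_identity {p₀ : Eu n} (b : Fin n → Eu n) (m : Fin n) (c₀ a : ℝ)
    (ha : a ≠ 0) (hG : ∀ i j, ContDiffAt ℝ ∞ (fun p ↦ G p i j) p₀) (hG0 : G p₀ = 1)
    (hGs : ∀ p i j, G p i j = G p j i)
    (hh : ∀ i j, ContDiffAt ℝ ∞ (fun p ↦ h p i j) p₀) (hhs : ∀ p i j, h p i j = h p j i)
    (hinv : ∀ᶠ p in 𝓝 p₀, h p * G p = 1)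
    (hρ : ∀ᶠ p in 𝓝 p₀, ρ p = a * Real.sqrt (G p).det) (hΓ : ContDiffAt ℝ ∞ Γ p₀)
    (hH : ∀ x y, H x y = H y x)
    (hid : Real.exp (normSq H (h p₀) (curvMat Γ b p₀) / 2) * ρ p₀ *
        normSqB H (h p₀) (fun i j ↦ fderiv ℝ (fun p ↦ curvMat Γ b p i j) p₀ (b m)) (curvMat Γ b p₀) =
      ∑ i, fderiv ℝ (fun p ↦ Real.exp (normSq H (h p) (curvMat Γ b p) / 2) * ρ p *
        ∑ a, h p i a * contr H (h p) (curvMat Γ b p) m a) p₀ (b i))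
    {T : Eu n → Fin n → Fin n → ℝ}
    (hT : ∀ p i k, T p i k = (Real.exp (normSq H (h p) (curvMat Γ b p) / 2) - c₀) * G p i k -
      Real.exp (normSq H (h p) (curvMat Γ b p) / 2) * contr H (h p) (curvMat Γ b p) i k) :
    ∑ i, (fderiv ℝ (fun p ↦ T p i m) p₀ (b i)
      - ∑ l, 1 / 2 * (fderiv ℝ (fun p ↦ G p i l) p₀ (b i) + fderiv ℝ (fun p ↦ G p i l) p₀ (b i)
        - fderiv ℝ (fun p ↦ G p i i) p₀ (b l)) * T p₀ l m
      - ∑ l, 1 / 2 * (fderiv ℝ (fun p ↦ G p m l) p₀ (b i) + fderiv ℝ (fun p ↦ G p i l) p₀ (b m)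
        - fderiv ℝ (fun p ↦ G p i m) p₀ (b l)) * T p₀ i l) = 0 := by
  have hh0 : h p₀ = 1 := by simpa [hG0] using hinv.self_of_nhds
  have hR : ∀ i j, ContDiffAt ℝ ∞ (fun p ↦ curvMat Γ b p i j) p₀ :=
    fun i j ↦ contDiffAt_curvA hΓ _ _
  have ev {q : Eu n → Prop} (hq : ∀ᶠ p in 𝓝 p₀, q p) (l : Fin n) :
      ∀ᶠ t : ℝ in 𝓝 0, q (p₀ + t • b l) := by
    have hc : Filter.Tendsto (fun t : ℝ ↦ p₀ + t • b l) (𝓝 0) (𝓝 p₀) := by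
      have : Continuous fun t : ℝ ↦ p₀ + t • b l := by fun_prop
      simpa using this.tendsto 0
    exact hc.eventually hq
  set q : Eu n → ℝ := fun p ↦ normSq H (h p) (curvMat Γ b p) with hq
  set C : Eu n → Fin n → Fin n → ℝ := fun p ↦ contr H (h p) (curvMat Γ b p) with hCdef
  set f : Eu n → ℝ := fun p ↦ Real.exp (q p / 2) with hf
  have hqs : ContDiffAt ℝ ∞ q p₀ := contDiffAt_normSq hh hR
  have hCs : ∀ i k, ContDiffAt ℝ ∞ (fun p ↦ C p i k) p₀ := contDiffAt_contr hh hR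
  have hfs : ContDiffAt ℝ ∞ f p₀ := (hqs.div_const 2).exp
  have hdh (l i j : Fin n) : fderiv ℝ (fun p ↦ h p i j) p₀ (b l) =
      - fderiv ℝ (fun p ↦ G p i j) p₀ (b l) :=
    hasDerivAt_inv_of_eq_one (G := fun t ↦ G (p₀ + t • b l)) (h := fun t ↦ h (p₀ + t • b l))
      (fun i j ↦ hasDerivAt_line (hG i j) (b l)) (fun i j ↦ hasDerivAt_line (hh i j) (b l)) (by simp [hG0]) (ev hinv l) i j
  -- The chain rule for the exponential density: the curvature is differentiated in both arguments,
  -- and the inverse metric contributes with the sign of `hdh`.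
  have hdf (l : Fin n) : fderiv ℝ f p₀ (b l) = f p₀ * (normSqB H (h p₀)
      (fun i j ↦ fderiv ℝ (fun p ↦ curvMat Γ b p i j) p₀ (b l)) (curvMat Γ b p₀)
      - 1 / 2 * ∑ i, ∑ k, fderiv ℝ (fun p ↦ G p i k) p₀ (b l) * C p₀ i k) := by
    have h1 := hasDerivAt_normSq_curve (H := H) (h := fun t ↦ h (p₀ + t • b l))
      (R := fun t ↦ curvMat Γ b (p₀ + t • b l)) (fun i j ↦ hasDerivAt_line (hh i j) (b l))
      (fun i j ↦ hasDerivAt_line (hR i j) (b l)) (curvMat_swap Γ b _)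
    have h2 := (hasDerivAt_line hfs (b l)).unique (h1.div_const 2).exp
    rw [h2]
    simp only [zero_smul, add_zero, hdh, neg_mul, Finset.sum_neg_distrib]
    rw [normSqB_comm hH (hhs p₀) (curvMat Γ b p₀)]
    simp only [hf, hq, hCdef]
    ring
  have hρ0 : ρ p₀ = a := by rw [hρ.self_of_nhds, hG0]; simp
  have hdρ (l : Fin n) : HasDerivAt (fun t : ℝ ↦ ρ (p₀ + t • b l))
      (a * (1 / 2 * ∑ i, fderiv ℝ (fun p ↦ G p i i) p₀ (b l))) 0 := by
    have h1 := hasDerivAt_det_of_eq_one (G := fun t ↦ G (p₀ + t • b l))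
      (fun i j ↦ hasDerivAt_line (hG i j) (b l)) (by simp [hG0])
    have h2 := (h1.sqrt (by simp [hG0])).const_mul a
    refine (h2.congr_of_eventuallyEq (ev hρ l)).congr_deriv ?_
    simp only [zero_smul, add_zero, hG0, Matrix.det_one, Real.sqrt_one]
    ring
  -- Product rule for the right side of `hid`; the density and the inverse metric supply the terms
  -- that become Christoffel symbols.
  have hY (i : Fin n) : fderiv ℝ (fun p ↦ f p * ρ p * ∑ a, h p i a * C p m a) p₀ (b i) =
      a * ((fderiv ℝ f p₀ (b i) + f p₀ * (1 / 2 * ∑ j, fderiv ℝ (fun p ↦ G p j j) p₀ (b i))) * C p₀ m i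
      + f p₀ * ∑ j, (- fderiv ℝ (fun p ↦ G p i j) p₀ (b i) * C p₀ m j)
      + f p₀ * fderiv ℝ (fun p ↦ C p m i) p₀ (b i)) := by
    have hρs : ContDiffAt ℝ ∞ ρ p₀ := by
      refine ContDiffAt.congr_of_eventuallyEq ?_ hρ
      refine contDiffAt_const.mul (ContDiffAt.sqrt ?_ (by simp [hG0]))
      simp only [Matrix.det_apply]
      exact ContDiffAt.sum fun σ _ ↦ (contDiffAt_prod fun i _ ↦ hG _ _).const_smul _
    have hs : ContDiffAt ℝ ∞ (fun p ↦ f p * ρ p * ∑ a, h p i a * C p m a) p₀ :=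
      (hfs.mul hρs).mul (ContDiffAt.sum fun a _ ↦ (hh i a).mul (hCs m a))
    have h1 := ((hasDerivAt_line hfs (b i)).mul (hdρ i)).mul (HasDerivAt.fun_sum (u := Finset.univ) fun a _ ↦
      (hasDerivAt_line (hh i a) (b i)).mul (hasDerivAt_line (hCs m a) (b i)))
    rw [(hasDerivAt_line hs (b i)).unique h1]
    simp only [zero_smul, add_zero, Pi.mul_apply, hρ0, hh0, hdh, Finset.sum_add_distrib, Matrix.one_apply, ite_mul, one_mul,
      zero_mul, Finset.sum_ite_eq, Finset.mem_univ, if_true]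
    ring
  have hdT (i : Fin n) : fderiv ℝ (fun p ↦ T p i m) p₀ (b i) =
      fderiv ℝ f p₀ (b i) * (1 : Matrix (Fin n) (Fin n) ℝ) i m
        + (f p₀ - c₀) * fderiv ℝ (fun p ↦ G p i m) p₀ (b i)
        - (fderiv ℝ f p₀ (b i) * C p₀ i m + f p₀ * fderiv ℝ (fun p ↦ C p i m) p₀ (b i)) := by
    have hs : ContDiffAt ℝ ∞ (fun p ↦ T p i m) p₀ := by
      simp only [hT]
      exact ((hfs.sub contDiffAt_const).mul (hG i m)).sub (hfs.mul (hCs i m))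
    have h1 := (((hasDerivAt_line hfs (b i)).sub_const c₀).mul (hasDerivAt_line (hG i m) (b i))).sub
      ((hasDerivAt_line hfs (b i)).mul (hasDerivAt_line (hCs i m) (b i)))
    have h2 := (hasDerivAt_line hs (b i)).unique (h1.congr_of_eventuallyEq (.of_forall fun t ↦ hT _ _ _))
    rw [h2]
    simp [hG0]
  have hT0 (i k : Fin n) : T p₀ i k = (f p₀ - c₀) * (1 : Matrix (Fin n) (Fin n) ℝ) i k - f p₀ * C p₀ i k := by
    rw [hT, hG0]
  have hCsymm (p : Eu n) (i k : Fin n) : C p i k = C p k i := contr_comm hH (hhs p) _ i k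
  simp only [hdT, hT0]
  refine divergence_algebra m (f p₀) c₀ (normSqB H (h p₀)
      (fun i j ↦ fderiv ℝ (fun p ↦ curvMat Γ b p i j) p₀ (b m)) (curvMat Γ b p₀))
    (fun i ↦ fderiv ℝ f p₀ (b i)) (C p₀) (fun l i k ↦ fderiv ℝ (fun p ↦ C p i k) p₀ (b l))
    (fun l i k ↦ fderiv ℝ (fun p ↦ G p i k) p₀ (b l)) (hCsymm p₀) (fun l i k ↦ ?_)
    (fun l i k ↦ ?_) (hdf m) ?_
  · simp only [fun p ↦ hCsymm p i k]
  · simp only [fun p ↦ hGs p i k]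
  · change f p₀ * ρ p₀ * _ = ∑ i, fderiv ℝ (fun p ↦ f p * ρ p * ∑ a, h p i a * C p m a) p₀ (b i)
      at hid
    simp only [hY, hρ0, ← Finset.mul_sum] at hid
    -- At `p₀` the density equals `a`, so `a` is a common factor of both sides.
    refine mul_left_cancel₀ ha ?_
    rw [← hid]
    ring

end PointwiseIdentity

/-! ### Levi-Civita derivative and divergence in coordinates -/

section Divergence

variable {n : ℕ} {M : Type*} [TopologicalSpace M] [ChartedSpace (Eu n) M] [IsManifold (𝓡 n) ∞ M]
  [Bundle.RiemannianBundle (fun x : M ↦ TangentSpace (𝓡 n) x)]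

/-- The components of a `2`-tensor field in the chart at `c`. -/
def tensorRep (c : M) (S : Π x : M, TangentSpace (𝓡 n) x → TangentSpace (𝓡 n) x → ℝ) (u w p : Eu n) :
    ℝ :=
  S ((chartAt (Eu n) c).symm p) (coordField c u ((chartAt (Eu n) c).symm p))
    (coordField c w ((chartAt (Eu n) c).symm p))

/-- The components of the metric in the chart at `c`. -/
def metricRep (c : M) (u w p : Eu n) : ℝ :=
  tensorRep c (fun _ u w ↦ (inner ℝ u w : ℝ)) u w p

lemma metricRep_comm (c : M) (u w p : Eu n) : metricRep c u w p = metricRep c w u p :=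
  real_inner_comm _ _

lemma metricRep_add_left (c : M) (u u' w p : Eu n) :
    metricRep c (u + u') w p = metricRep c u w p + metricRep c u' w p := by
  simp only [metricRep, tensorRep]
  rw [coordField_add, inner_add_left]

lemma metricRep_smul_left (c : M) (r : ℝ) (u w p : Eu n) :
    metricRep c (r • u) w p = r * metricRep c u w p := by
  simp only [metricRep, tensorRep]
  rw [coordField_smul, real_inner_smul_left]

lemma extendT_eventuallyEq {c : M} (u : TangentSpace (𝓡 n) c) :
    ∀ᶠ y in 𝓝 c, extendT u y = coordField c (coordVec c c u) y := by
  filter_upwards [(chartAt (Eu n) c).open_source.mem_nhds (mem_chart_source _ c)] with y hy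
  exact extendT_eq u hy

lemma tensorRep_eventuallyEq {c : M} (S : Π x : M, TangentSpace (𝓡 n) x → TangentSpace (𝓡 n) x → ℝ)
    (u w : TangentSpace (𝓡 n) c) :
    (fun y ↦ S y (extendT u y) (extendT w y)) ∘ (chartAt (Eu n) c).symm
      =ᶠ[𝓝 (chartAt (Eu n) c c)] tensorRep c S (coordVec c c u) (coordVec c c w) := by
  filter_upwards [(chartAt (Eu n) c).open_target.mem_nhds
    ((chartAt (Eu n) c).map_source (mem_chart_source _ c))] with p hp
  have hy := (chartAt (Eu n) c).map_target hp
  simp only [Function.comp_apply, tensorRep]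
  rw [extendT_eq u hy, extendT_eq w hy]

lemma mdifferentiableAt_tensor {c : M}
    {S : Π x : M, TangentSpace (𝓡 n) x → TangentSpace (𝓡 n) x → ℝ} (u w : TangentSpace (𝓡 n) c)
    (hS : DifferentiableAt ℝ (tensorRep c S (coordVec c c u) (coordVec c c w)) (chartAt (Eu n) c c)) :
    MDifferentiableAt (𝓡 n) 𝓘(ℝ, ℝ) (fun y ↦ S y (extendT u y) (extendT w y)) c := by
  rw [mdifferentiableAt_iff_chart c (mem_chart_source _ c)]
  exact hS.congr_of_eventuallyEq (tensorRep_eventuallyEq S u w)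

lemma mvfderiv_tensor {c : M}
    {S : Π x : M, TangentSpace (𝓡 n) x → TangentSpace (𝓡 n) x → ℝ} (u w v : TangentSpace (𝓡 n) c)
    (hS : DifferentiableAt ℝ (tensorRep c S (coordVec c c u) (coordVec c c w)) (chartAt (Eu n) c c)) :
    mvfderiv (𝓡 n) (fun y ↦ S y (extendT u y) (extendT w y)) c v =
      fderiv ℝ (tensorRep c S (coordVec c c u) (coordVec c c w)) (chartAt (Eu n) c c)
        (coordVec c c v) := by
  rw [mvfderiv_eq_fderiv_chart c (mem_chart_source _ c) (mdifferentiableAt_tensor u w hS),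
    (tensorRep_eventuallyEq S u w).fderiv_eq]

variable [IsContMDiffRiemannianBundle (𝓡 n) ∞ (Eu n) (fun x : M ↦ TangentSpace (𝓡 n) x)]

lemma differentiableAt_metricRep (c : M) (u w : Eu n) :
    DifferentiableAt ℝ (metricRep c u w) (chartAt (Eu n) c c) :=
  ((contDiffOn_inner_coordField c u w).contDiffAt ((chartAt (Eu n) c).open_target.mem_nhds
    ((chartAt (Eu n) c).map_source (mem_chart_source _ c)))).differentiableAt (by simp)

/-- The Christoffel symbols at the centre of the chart. -/
def christoffel (c : M) (v u z : Eu n) : ℝ :=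
  1 / 2 * (fderiv ℝ (metricRep c u z) (chartAt (Eu n) c c) v
    + fderiv ℝ (metricRep c v z) (chartAt (Eu n) c c) u
    - fderiv ℝ (metricRep c v u) (chartAt (Eu n) c c) z)

lemma mlieBracket_extendT {c : M} (u w : TangentSpace (𝓡 n) c) :
    VectorField.mlieBracket (𝓡 n) (extendT u) (extendT w) c = 0 := by
  rw [Filter.EventuallyEq.mlieBracket_vectorField_eq (extendT_eventuallyEq u)
    (extendT_eventuallyEq w)]
  exact mlieBracket_coordField c _ _ (mem_chart_source _ c)

/-- The extensions are coordinate fields near `c`, so the brackets in Koszul's formula vanish and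
the classical expression for the Christoffel symbols with lowered index remains. -/
lemma inner_leviCivita_extendT {c : M} (u v z : TangentSpace (𝓡 n) c) :
    inner ℝ (leviCivita (𝓡 n) M (extendT u) c v) z =
      christoffel c (coordVec c c v) (coordVec c c u) (coordVec c c z) := by
  have h := inner_leviCivitaFun' (mdiffT_extendT u) v z
  refine h.trans ?_
  have h1 (u w v : TangentSpace (𝓡 n) c) := mvfderiv_tensor
    (S := fun _ u w ↦ (inner ℝ u w : ℝ)) u w v (differentiableAt_metricRep c _ _)
  have e (v : TangentSpace (𝓡 n) c) : extendT v c = v := FiberBundle.extend_apply_self _ _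
  simp only [koszul, mlieBracket_extendT, inner_zero_left, add_zero, sub_zero]
  rw [e v, e u, e z, h1, h1, h1]
  rfl

lemma christoffel_add (c : M) (v u u' z : Eu n) :
    christoffel c v (u + u') z = christoffel c v u z + christoffel c v u' z := by
  have e1 : metricRep c (u + u') z = metricRep c u z + metricRep c u' z :=
    funext fun p ↦ metricRep_add_left c u u' z p
  have e2 : metricRep c v (u + u') = metricRep c v u + metricRep c v u' :=
    funext fun p ↦ by
      simp only [Pi.add_apply, metricRep_comm c v, metricRep_add_left]
  simp only [christoffel]
  rw [e1, e2, fderiv_add (differentiableAt_metricRep c _ _) (differentiableAt_metricRep c _ _),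
    fderiv_add (differentiableAt_metricRep c _ _) (differentiableAt_metricRep c _ _)]
  simp only [add_apply, map_add]
  ring

lemma christoffel_smul (c : M) (v : Eu n) (r : ℝ) (u z : Eu n) :
    christoffel c v (r • u) z = r * christoffel c v u z := by
  have e1 : metricRep c (r • u) z = r • metricRep c u z :=
    funext fun p ↦ metricRep_smul_left c r u z p
  have e2 : metricRep c v (r • u) = r • metricRep c v u :=
    funext fun p ↦ by
      simp only [Pi.smul_apply, metricRep_comm c v, metricRep_smul_left, smul_eq_mul]
  simp only [christoffel]
  rw [e1, e2, fderiv_const_smul (differentiableAt_metricRep c _ _),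
    fderiv_const_smul (differentiableAt_metricRep c _ _)]
  simp only [smul_apply, map_smul, smul_eq_mul]
  ring

variable {c : M} {S : Π x : M, TangentSpace (𝓡 n) x → TangentSpace (𝓡 n) x → ℝ}

/-- Expanding the Levi-Civita derivative in an orthonormal basis at `c` lets the lowered Christoffel
symbols serve as its components. No inverse metric is needed. -/
lemma covDerivTensor_eq
    (hS : ∀ u w, DifferentiableAt ℝ (tensorRep c S u w) (chartAt (Eu n) c c))
    {L : TangentSpace (𝓡 n) c →ₗ[ℝ] TangentSpace (𝓡 n) c →ₗ[ℝ] ℝ} (hL : ∀ u w, S c u w = L u w)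
    (v u w : TangentSpace (𝓡 n) c) :
    covDerivTensor S c v u w =
      fderiv ℝ (tensorRep c S (coordVec c c u) (coordVec c c w)) (chartAt (Eu n) c c) (coordVec c c v)
      - ∑ l, christoffel c (coordVec c c v) (coordVec c c u) (coordVec c c (onb (𝓡 n) c l)) *
          S c (onb (𝓡 n) c l) w
      - ∑ l, christoffel c (coordVec c c v) (coordVec c c w) (coordVec c c (onb (𝓡 n) c l)) *
          S c u (onb (𝓡 n) c l) := by
  have h (u : TangentSpace (𝓡 n) c) : leviCivita (𝓡 n) M (extendT u) c v =
      ∑ l, christoffel c (coordVec c c v) (coordVec c c u) (coordVec c c (onb (𝓡 n) c l)) •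
        onb (𝓡 n) c l := by
    rw [← (onb (𝓡 n) c).sum_repr' (leviCivita (𝓡 n) M (extendT u) c v)]
    refine Finset.sum_congr rfl fun l _ ↦ ?_
    rw [real_inner_comm, inner_leviCivita_extendT]
  rw [covDerivTensor, mvfderiv_tensor u w v (hS _ _)]
  congr 1
  · congr 1
    rw [hL, h]
    simp only [map_sum, map_smul, LinearMap.sum_apply, LinearMap.smul_apply, smul_eq_mul, hL]
  · rw [hL, h]
    simp only [map_sum, map_smul, smul_eq_mul, hL]

/-- Linearity is required on a neighbourhood and not only at `c`, because the components are
differentiated. -/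
lemma tensorRep_linear (hlin : ∀ᶠ y in 𝓝 c,
      ∃ L : TangentSpace (𝓡 n) y →ₗ[ℝ] TangentSpace (𝓡 n) y →ₗ[ℝ] ℝ, ∀ u w, S y u w = L u w) :
    ∀ᶠ p in 𝓝 (chartAt (Eu n) c c), (∀ u w w', tensorRep c S u (w + w') p =
      tensorRep c S u w p + tensorRep c S u w' p) ∧
      ∀ u (r : ℝ) w, tensorRep c S u (r • w) p = r * tensorRep c S u w p := by
  have hcont : Filter.Tendsto (chartAt (Eu n) c).symm (𝓝 (chartAt (Eu n) c c)) (𝓝 c) := by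
    have := ((chartAt (Eu n) c).continuousAt_symm
      ((chartAt (Eu n) c).map_source (mem_chart_source _ c))).tendsto
    rwa [(chartAt (Eu n) c).left_inv (mem_chart_source _ c)] at this
  filter_upwards [hcont.eventually hlin] with p hp
  obtain ⟨L, hL⟩ := hp
  refine ⟨fun u w w' ↦ ?_, fun u r w ↦ ?_⟩
  · simp only [tensorRep, hL]
    rw [coordField_add, map_add]
  · simp only [tensorRep, hL]
    rw [coordField_smul, map_smul, smul_eq_mul]

/-- It suffices to compute the divergence on an orthonormal basis. -/
lemma divergence_eq_zero_of_onb
    (hS : ∀ u w, DifferentiableAt ℝ (tensorRep c S u w) (chartAt (Eu n) c c))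
    (hlin : ∀ᶠ y in 𝓝 c,
      ∃ L : TangentSpace (𝓡 n) y →ₗ[ℝ] TangentSpace (𝓡 n) y →ₗ[ℝ] ℝ, ∀ u w, S y u w = L u w)
    (h : ∀ m, divergence S c (onb (𝓡 n) c m) = 0) (w : TangentSpace (𝓡 n) c) :
    divergence S c w = 0 := by
  obtain ⟨L, hL⟩ := hlin.self_of_nhds
  have hrep := tensorRep_linear hlin
  have hadd (v u w w' : TangentSpace (𝓡 n) c) : covDerivTensor S c v u (w + w') =
      covDerivTensor S c v u w + covDerivTensor S c v u w' := by
    have e : tensorRep c S (coordVec c c u) (coordVec c c w + coordVec c c w')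
        =ᶠ[𝓝 (chartAt (Eu n) c c)] tensorRep c S (coordVec c c u) (coordVec c c w) +
          tensorRep c S (coordVec c c u) (coordVec c c w') := by
      filter_upwards [hrep] with p hp using hp.1 _ _ _
    rw [covDerivTensor_eq hS hL, covDerivTensor_eq hS hL, covDerivTensor_eq hS hL,
      map_add (coordVec c c), e.fderiv_eq, fderiv_add (hS _ _) (hS _ _)]
    simp only [add_apply, christoffel_add, hL, map_add, mul_add, add_mul, Finset.sum_add_distrib]
    ring
  have hsmul (v u : TangentSpace (𝓡 n) c) (r : ℝ) (w : TangentSpace (𝓡 n) c) :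
      covDerivTensor S c v u (r • w) = r * covDerivTensor S c v u w := by
    have e : tensorRep c S (coordVec c c u) (r • coordVec c c w)
        =ᶠ[𝓝 (chartAt (Eu n) c c)] r • tensorRep c S (coordVec c c u) (coordVec c c w) := by
      filter_upwards [hrep] with p hp using hp.2 _ _ _
    have hv : coordVec c c (r • w) = r • coordVec c c w := map_smul (coordVec c c) r w
    rw [covDerivTensor_eq hS hL, covDerivTensor_eq hS hL, hv, e.fderiv_eq,
      fderiv_const_smul (hS _ _)]
    simp only [smul_apply, christoffel_smul, hL, map_smul, smul_eq_mul, mul_sub, Finset.mul_sum]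
    congr 1
    · congr 1
      exact Finset.sum_congr rfl fun _ _ ↦ by ring
    · exact Finset.sum_congr rfl fun _ _ ↦ by ring
  let D : TangentSpace (𝓡 n) c →ₗ[ℝ] ℝ :=
    { toFun := divergence S c
      map_add' := fun w w' ↦ by simp only [divergence, hadd, Finset.sum_add_distrib]
      map_smul' := fun r w ↦ by
        simp only [divergence, hsmul, Finset.mul_sum, RingHom.id_apply, smul_eq_mul] }
  -- A linear form vanishes if it vanishes on the orthonormal basis. This permits taking the free
  -- index from the same frame as the summation index.
  have h0 : D = 0 := (onb (𝓡 n) c).toBasis.ext fun m ↦ by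
    rw [OrthonormalBasis.coe_toBasis]
    exact h m
  exact LinearMap.congr_fun h0 w

end Divergence

/-! ### Smoothness of the inverse metric -/

section MatrixSmooth

lemma contDiffAt_bilin {W E : Type*} [NormedAddCommGroup W] [NormedSpace ℝ W]
    [NormedAddCommGroup E] [NormedSpace ℝ E] (H : E →L[ℝ] E →L[ℝ] ℝ) {f g : W → E} {p : W}
    (hf : ContDiffAt ℝ ∞ f p) (hg : ContDiffAt ℝ ∞ g p) :
    ContDiffAt ℝ ∞ (fun p ↦ H (f p) (g p)) p :=
  (H.contDiff.contDiffAt.comp p hf).clm_apply hg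

variable {n : ℕ} {G : Eu n → Matrix (Fin n) (Fin n) ℝ} {p : Eu n}

lemma contDiffAt_det (hG : ∀ i j, ContDiffAt ℝ ∞ (fun p ↦ G p i j) p) :
    ContDiffAt ℝ ∞ (fun p ↦ (G p).det) p := by
  simp only [Matrix.det_apply]
  exact ContDiffAt.sum fun σ _ ↦ (contDiffAt_prod fun i _ ↦ hG _ _).const_smul _

/-- Cramer's rule: the entries are determinants of smooth matrices divided by the determinant. -/
lemma contDiffAt_inv_apply (hG : ∀ i j, ContDiffAt ℝ ∞ (fun p ↦ G p i j) p) (h0 : (G p).det ≠ 0)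
    (i j : Fin n) : ContDiffAt ℝ ∞ (fun p ↦ (G p)⁻¹ i j) p := by
  simp only [Matrix.inv_def, Ring.inverse_eq_inv', Matrix.smul_apply, Matrix.adjugate_apply,
    smul_eq_mul]
  refine ((contDiffAt_det hG).inv h0).mul (contDiffAt_det fun k l ↦ ?_)
  by_cases hk : k = j
  · subst hk
    simp only [Matrix.updateRow_self]
    exact contDiffAt_const
  · simp only [Matrix.updateRow_ne hk]
    exact hG k l

end MatrixSmooth

/-! ### The stress-energy tensor in coordinates -/

section Stress

variable {n : ℕ} {M : Type*} [TopologicalSpace M] [ChartedSpace (Eu n) M] [IsManifold (𝓡 n) ∞ M]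
  [Bundle.RiemannianBundle (fun x : M ↦ TangentSpace (𝓡 n) x)]
  {F : Type*} [NormedAddCommGroup F] [NormedSpace ℝ F]
  {V : M → Type*} [TopologicalSpace (Bundle.TotalSpace F V)]
  [∀ x, TopologicalSpace (V x)] [∀ x, AddCommGroup (V x)] [∀ x, Module ℝ (V x)]
  [∀ x, IsTopologicalAddGroup (V x)] [∀ x, ContinuousSMul ℝ (V x)]
  [FiberBundle F V] [VectorBundle ℝ F V]
  [∀ x, FiniteDimensional ℝ (V x)] [Bundle.RiemannianBundle V]

/-- The tensor `(exp (‖R‖² / 2) - c₀) g - exp (‖R‖² / 2) ⟨i R, i R⟩`. -/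
def stressTensor (c₀ : ℝ) (cov : CovariantDerivative (𝓡 n) F V) (x : M)
    (u w : TangentSpace (𝓡 n) x) : ℝ :=
  (Real.exp (curvatureNormSq cov x / 2) - c₀) * inner ℝ u w
    - Real.exp (curvatureNormSq cov x / 2) * contractionInner cov x u w

/-- One family covers both tensors: `c₀ = 0` here, `c₀ = 1` in the normalized case. -/
lemma stressEnergy_eq (cov : CovariantDerivative (𝓡 n) F V) :
    stressEnergy cov = stressTensor 0 cov := by
  ext x u w
  simp only [stressEnergy, stressTensor]
  ring

lemma normalizedStressEnergy_eq (cov : CovariantDerivative (𝓡 n) F V) :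
    normalizedStressEnergy cov = stressTensor 1 cov := rfl

variable (n) in
/-- The identification of the index set of an orthonormal basis of the tangent space. -/
def onbIndex (c : M) : Fin (Module.finrank ℝ (TangentSpace (𝓡 n) c)) ≃ Fin n :=
  finCongr (finrank_euclideanSpace_fin (𝕜 := ℝ) (n := n))

/-- The chosen orthonormal basis of the tangent space at `c`, as a basis of `ℝⁿ`. -/
def frame (c : M) : Module.Basis (Fin n) ℝ (Eu n) :=
  ((onb (𝓡 n) c).toBasis.map (LinearEquiv.ofBijective (coordVec c c).toLinearMap
    ⟨fun u v h ↦ (coordVec_self c u).symm.trans (h.trans (coordVec_self c v)), fun v ↦ ⟨v, coordVec_self c v⟩⟩)).reindex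
    (onbIndex n c)

lemma frame_apply (c : M) (i : Fin (Module.finrank ℝ (TangentSpace (𝓡 n) c))) :
    frame c (onbIndex n c i) = coordVec c c (onb (𝓡 n) c i) := by
  simp [frame]
  rfl

/-- A constant linear change of coordinates makes the metric the identity at the centre. Normal
coordinates are not used, so first derivatives of the metric remain. -/
lemma gramB_frame (c : M) : gramB c (frame c) (chartAt (Eu n) c c) = 1 := by
  rw [gram_coordField_eq c _ (mem_chart_source _ c)]
  ext i j
  obtain ⟨i, rfl⟩ := (onbIndex n c).surjective i
  obtain ⟨j, rfl⟩ := (onbIndex n c).surjective j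
  rw [Matrix.of_apply, frame_apply, frame_apply, coordField_coordVec c (mem_chart_source _ c),
    coordField_coordVec c (mem_chart_source _ c), OrthonormalBasis.inner_eq_ite, Matrix.one_apply]
  simp

/-- The volume density refers to the standard basis and the computation to `b`. Both bases have
constant coefficients, so the densities differ by the constant `|det L|`. -/
lemma exists_sqrt_det_gramMatrix_eq (c : M) (b : Module.Basis (Fin n) ℝ (Eu n)) :
    ∃ a : ℝ, a ≠ 0 ∧ ∀ p ∈ (chartAt (Eu n) c).target,
      Real.sqrt (gramMatrix c p).det = a * Real.sqrt (gramB c b p).det := by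
  let L : Eu n ≃ₗ[ℝ] Eu n := b.equiv (stdB n) (Equiv.refl _)
  refine ⟨|LinearMap.det (L : Eu n →ₗ[ℝ] Eu n)|, abs_ne_zero.2 L.isUnit_det'.ne_zero, fun p hp ↦ ?_⟩
  have e : (fun i ↦ (L : Eu n →ₗ[ℝ] Eu n) (b i)) = stdB n := by
    ext i : 1
    exact b.equiv_apply i (stdB n) (Equiv.refl _)
  have h := gramB_transform c b (L : Eu n →ₗ[ℝ] Eu n) p
  rw [e] at h
  rw [gramMatrix_eq c hp, h, Matrix.det_mul, Matrix.det_mul, Matrix.det_transpose,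
    LinearMap.det_toMatrix, mul_right_comm, Real.sqrt_mul (mul_self_nonneg _),
    Real.sqrt_mul_self_eq_abs]

lemma endInner_comm {c : M} {κ : F →L[ℝ] F →L[ℝ] ℝ} (hκ : ∀ s t, κ s t = κ t s)
    (S U : F →L[ℝ] F) : endInner F V c κ S U = endInner F V c κ U S := by
  rw [endInner_apply, endInner_apply]
  exact Finset.sum_congr rfl fun a _ ↦ hκ _ _

variable [FiniteDimensional ℝ F] [ContMDiffVectorBundle ∞ F V (𝓡 n)]
  {cov : CovariantDerivative (𝓡 n) F V} {c : M} {κ : F →L[ℝ] F →L[ℝ] ℝ}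
  {Γ : Eu n → (Eu n →L[ℝ] F →L[ℝ] F)}

lemma IsConstMetric.exp_curvatureNormSq (hκ : IsConstMetric n V c κ) (hΓ : IsLocalRep cov c Γ)
    (hΓs : ContDiffOn ℝ ∞ Γ (cdom n F V c)) (b : Module.Basis (Fin n) ℝ (Eu n)) {p : Eu n}
    (hp : p ∈ cdom n F V c) :
    curvatureNormSq cov ((chartAt (Eu n) c).symm p) =
      normSq (endInner F V c κ) (gramB c b p)⁻¹ (curvMat Γ b p) := by
  rw [hκ.curvatureNormSq_eq hΓ hΓs (chart_symm_mem_dom hp) b, (chartAt (Eu n) c).right_inv hp.1]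
  rfl

lemma IsConstMetric.tensorRep_stressTensor (hκ : IsConstMetric n V c κ) (hΓ : IsLocalRep cov c Γ)
    (hΓs : ContDiffOn ℝ ∞ Γ (cdom n F V c)) (b : Module.Basis (Fin n) ℝ (Eu n)) (c₀ : ℝ) {p : Eu n}
    (hp : p ∈ cdom n F V c) (u w : Eu n) :
    tensorRep c (stressTensor c₀ cov) u w p =
      (Real.exp (normSq (endInner F V c κ) (gramB c b p)⁻¹ (curvMat Γ b p) / 2) - c₀)
        * metricRep c u w p
      - Real.exp (normSq (endInner F V c κ) (gramB c b p)⁻¹ (curvMat Γ b p) / 2) *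
        ∑ j, ∑ l, (gramB c b p)⁻¹ j l *
          endInner F V c κ (curvA Γ p u (b j)) (curvA Γ p w (b l)) := by
  have hy := chart_symm_mem_dom hp
  rw [tensorRep, stressTensor, hκ.exp_curvatureNormSq hΓ hΓs b hp,
    hκ.contractionInner_eq hΓ hΓs hy b, coordVec_coordField c _ hy.1, coordVec_coordField c _ hy.1,
    (chartAt (Eu n) c).right_inv hp.1]
  rfl

variable [IsContMDiffRiemannianBundle (𝓡 n) ∞ (Eu n) (fun x : M ↦ TangentSpace (𝓡 n) x)]

lemma contDiffAt_gramB (b : Fin n → Eu n) {p : Eu n} (hp : p ∈ (chartAt (Eu n) c).target)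
    (i j : Fin n) : ContDiffAt ℝ ∞ (fun p ↦ gramB c b p i j) p :=
  (contDiffOn_gramB c b i j).contDiffAt ((chartAt (Eu n) c).open_target.mem_nhds hp)

lemma contDiffAt_gramB_inv (b : Module.Basis (Fin n) ℝ (Eu n)) {p : Eu n}
    (hp : p ∈ (chartAt (Eu n) c).target) (i j : Fin n) :
    ContDiffAt ℝ ∞ (fun p ↦ (gramB c b p)⁻¹ i j) p :=
  contDiffAt_inv_apply (contDiffAt_gramB b hp) (gramB_posDef c b hp).det_pos.ne' i j

lemma contDiffOn_sqrt_det_gramMatrix :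
    ContDiffOn ℝ ∞ (fun p ↦ Real.sqrt (gramMatrix c p).det) (chartAt (Eu n) c).target := by
  intro p hp
  have h1 : ContDiffAt ℝ ∞ (fun p ↦ Real.sqrt (gramB c (stdB n) p).det) p :=
    (contDiffAt_det (contDiffAt_gramB (stdB n) hp)).sqrt (gramB_posDef c (stdB n) hp).det_pos.ne'
  refine (h1.congr_of_eventuallyEq ?_).contDiffWithinAt
  filter_upwards [(chartAt (Eu n) c).open_target.mem_nhds hp] with q hq
  rw [gramMatrix_eq c hq]

lemma IsConstMetric.contDiffAt_tensorRep (hκ : IsConstMetric n V c κ) (hΓ : IsLocalRep cov c Γ)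
    (hΓs : ContDiffOn ℝ ∞ Γ (cdom n F V c)) (c₀ : ℝ) (u w : Eu n) :
    ContDiffAt ℝ ∞ (tensorRep c (stressTensor c₀ cov) u w) (chartAt (Eu n) c c) := by
  have hp := chart_mem_cdom (mem_dom_self (n := n) (F := F) (V := V) c)
  have hU := (isOpen_cdom (n := n) (F := F) (V := V) c).mem_nhds hp
  have hΓ' := hΓs.contDiffAt hU
  have hq := contDiffAt_normSq (H := endInner F V c κ) (contDiffAt_gramB_inv (frame c) hp.1)
    (R := curvMat Γ (frame c)) fun i j ↦ contDiffAt_curvA hΓ' _ _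
  have hm : ContDiffAt ℝ ∞ (metricRep c u w) (chartAt (Eu n) c c) :=
    (contDiffOn_inner_coordField c u w).contDiffAt ((chartAt (Eu n) c).open_target.mem_nhds hp.1)
  refine ContDiffAt.congr_of_eventuallyEq (f := fun p ↦ _) ?_ (Filter.eventually_of_mem hU fun p hp ↦
    hκ.tensorRep_stressTensor hΓ hΓs (frame c) c₀ hp u w)
  refine ((hq.div_const 2).exp.sub contDiffAt_const).mul hm |>.sub ((hq.div_const 2).exp.mul
    (ContDiffAt.sum fun j _ ↦ ContDiffAt.sum fun l _ ↦
      (contDiffAt_gramB_inv (frame c) hp.1 j l).mul ?_))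
  exact contDiffAt_bilin _ (contDiffAt_curvA hΓ' u _) (contDiffAt_curvA hΓ' w _)

/-- The conservation law at `c`, from the vanishing of the first variation under Lie derivatives
of the local connection form. -/
theorem IsConstMetric.divergence_stressTensor (hκ : IsConstMetric n V c κ)
    (hκs : ∀ s t, κ s t = κ t s) (hΓ : IsLocalRep cov c Γ)
    (hΓs : ContDiffOn ℝ ∞ Γ (cdom n F V c)) (c₀ c₁ : ℝ)
    (hcrit : ∀ (m : Fin n) (ψ : Eu n → ℝ), ContDiff ℝ ∞ ψ → HasCompactSupport ψ →
      tsupport ψ ⊆ cdom n F V c → HasDerivAt (fun t : ℝ ↦ ∫ p in tsupport ψ,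
        (Real.exp (normSq (endInner F V c κ) (gramB c (frame c) p)⁻¹
          (curvMat (Γ + t • lieVar Γ (frame c m) ψ) (frame c) p) / 2) - c₁)
            * Real.sqrt (gramMatrix c p).det) 0 0) (w : TangentSpace (𝓡 n) c) :
    divergence (stressTensor c₀ cov) c w = 0 := by
  have hp := chart_mem_cdom (mem_dom_self (n := n) (F := F) (V := V) c)
  have hUo := isOpen_cdom (n := n) (F := F) (V := V) c
  have hU := hUo.mem_nhds hp
  have hS (u w : Eu n) : DifferentiableAt ℝ (tensorRep c (stressTensor c₀ cov) u w)
      (chartAt (Eu n) c c) := (hκ.contDiffAt_tensorRep hΓ hΓs c₀ u w).differentiableAt (by simp)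
  have hlin (y : M) (hy : y ∈ dom n F V c) :
      ∃ L : TangentSpace (𝓡 n) y →ₗ[ℝ] TangentSpace (𝓡 n) y →ₗ[ℝ] ℝ,
        ∀ u w, stressTensor c₀ cov y u w = L u w := by
    obtain ⟨L, hL⟩ := hκ.exists_linear_contractionInner hΓ hΓs hy (frame c)
    refine ⟨(Real.exp (curvatureNormSq cov y / 2) - c₀) • innerₗ (TangentSpace (𝓡 n) y)
      - Real.exp (curvatureNormSq cov y / 2) • L, fun u w ↦ ?_⟩
    simp only [stressTensor, hL]
    simp [innerₗ_apply_apply]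
  have hlin' := Filter.eventually_of_mem ((isOpen_dom (n := n) (F := F) (V := V) c).mem_nhds
    (mem_dom_self (n := n) (F := F) (V := V) c)) hlin
  refine divergence_eq_zero_of_onb hS hlin' (fun m ↦ ?_) w
  obtain ⟨L, hL⟩ := hlin'.self_of_nhds
  obtain ⟨a, ha, hρ⟩ := exists_sqrt_det_gramMatrix_eq c (frame (n := n) c)
  have hHs := endInner_comm (V := V) (c := c) hκs
  have hGs (p : Eu n) (i j : Fin n) : gramB c (frame c) p i j = gramB c (frame c) p j i :=
    metricRep_comm c (frame c i) (frame c j) p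
  have hhs (p : Eu n) (i j : Fin n) : (gramB c (frame c) p)⁻¹ i j = (gramB c (frame c) p)⁻¹ j i := by
    have h1 : (gramB c (frame c) p).IsSymm := Matrix.IsSymm.ext fun i j ↦ hGs p j i
    exact (h1.inv).apply j i
  -- Only `c₁`, the constant of the energy, enters here; `c₀`, the constant of the tensor, enters in
  -- `key` and is independent of it.
  have hid := divergence_identity (H := endInner F V c κ) (h := fun p ↦ (gramB c (frame c) p)⁻¹)
    (ρ := fun p ↦ Real.sqrt (gramMatrix c p).det) hUo hΓs
    (fun i j p hp ↦ (contDiffAt_gramB_inv (frame c) hp.1 i j).contDiffWithinAt)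
    ((contDiffOn_sqrt_det_gramMatrix (c := c)).mono fun p hp ↦ hp.1) hHs hhs c₁ (frame c)
    (onbIndex n c m) (hcrit _) _ hp
  have key := divergence_eq_zero_of_identity (H := endInner F V c κ) (G := gramB c (frame c))
    (h := fun p ↦ (gramB c (frame c) p)⁻¹) (frame c) (onbIndex n c m) c₀ a ha
    (contDiffAt_gramB (frame c) hp.1) (gramB_frame c) hGs (contDiffAt_gramB_inv (frame c) hp.1) hhs
    (Filter.eventually_of_mem hU fun p hp ↦ Matrix.nonsing_inv_mul _
      (gramB_posDef c (frame c) hp.1).det_pos.ne'.isUnit)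
    (Filter.eventually_of_mem hU fun p hp ↦ hρ p hp.1) (hΓs.contDiffAt hU) hHs hid
    (T := fun p i k ↦ _) (fun p i k ↦ rfl)
  have hTe (i k : Fin n) : tensorRep c (stressTensor c₀ cov) (frame c i) (frame c k)
      =ᶠ[𝓝 (chartAt (Eu n) c c)] fun p ↦
        (Real.exp (normSq (endInner F V c κ) (gramB c (frame c) p)⁻¹ (curvMat Γ (frame c) p) / 2) - c₀)
          * gramB c (frame c) p i k -
        Real.exp (normSq (endInner F V c κ) (gramB c (frame c) p)⁻¹ (curvMat Γ (frame c) p) / 2) *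
          contr (endInner F V c κ) (gramB c (frame c) p)⁻¹ (curvMat Γ (frame c) p) i k :=
    Filter.eventually_of_mem hU fun p hp ↦
      hκ.tensorRep_stressTensor hΓ hΓs (frame c) c₀ hp (frame c i) (frame c k)
  have hT0 (u w : TangentSpace (𝓡 n) c) : stressTensor c₀ cov c u w =
      tensorRep c (stressTensor c₀ cov) (coordVec c c u) (coordVec c c w) (chartAt (Eu n) c c) := by
    have hl := (chartAt (Eu n) c).left_inv (mem_chart_source (Eu n) c)
    rw [tensorRep, hl, coordField_coordVec c (mem_chart_source _ c),
      coordField_coordVec c (mem_chart_source _ c)]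
  -- The divergence is summed over the index type of the orthonormal basis and `key` over `Fin n`;
  -- `onbIndex` matches the two sums.
  rw [divergence, ← key, ← (onbIndex n c).sum_comp]
  refine Finset.sum_congr rfl fun i _ ↦ ?_
  rw [covDerivTensor_eq hS hL, ← frame_apply, ← frame_apply, (hTe _ _).fderiv_eq]
  congr 1
  · congr 1
    rw [← (onbIndex n c).sum_comp]
    refine Finset.sum_congr rfl fun l _ ↦ ?_
    rw [hT0, ← frame_apply, ← frame_apply, (hTe _ _).self_of_nhds]
    rfl
  · rw [← (onbIndex n c).sum_comp]
    refine Finset.sum_congr rfl fun l _ ↦ ?_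
    rw [hT0, ← frame_apply, ← frame_apply, (hTe _ _).self_of_nhds]
    rfl

end Stress

/-! ### Extension by zero of local sections -/

section Extension

variable {n : ℕ} {M : Type*} [TopologicalSpace M] [ChartedSpace (Eu n) M] [IsManifold (𝓡 n) ∞ M]
  {F : Type*} [NormedAddCommGroup F] [NormedSpace ℝ F]
  {V : M → Type*} [TopologicalSpace (Bundle.TotalSpace F V)]
  [∀ x, TopologicalSpace (V x)] [∀ x, AddCommGroup (V x)] [∀ x, Module ℝ (V x)]
  [∀ x, IsTopologicalAddGroup (V x)] [∀ x, ContinuousSMul ℝ (V x)]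
  [FiberBundle F V] [VectorBundle ℝ F V]

lemma isCompact_chart_symm_image {c : M} {K : Set (Eu n)} (hK : IsCompact K)
    (hKs : K ⊆ (chartAt (Eu n) c).target) : IsCompact ((chartAt (Eu n) c).symm '' K) :=
  hK.image_of_continuousOn ((chartAt (Eu n) c).continuousOn_symm.mono hKs)

lemma chart_notMem {c y : M} (hy : y ∈ (chartAt (Eu n) c).source) {K : Set (Eu n)}
    (h : y ∉ (chartAt (Eu n) c).symm '' K) : chartAt (Eu n) c y ∉ K :=
  fun h' ↦ h ⟨_, h', (chartAt (Eu n) c).left_inv hy⟩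

variable [ContMDiffVectorBundle ∞ F V (𝓡 n)]

open Classical in
/-- A smooth function with compact support in the image of a bundle chart is the local
representative of a smooth section. -/
lemma exists_contMDiff_section [T2Space M] {c : M} {f : Eu n → F}
    (hf : ContDiffOn ℝ ∞ f (cdom n F V c)) {K : Set (Eu n)} (hK : IsCompact K)
    (hKs : K ⊆ cdom n F V c) (hfK : ∀ p ∉ K, f p = 0) :
    ∃ σ : Π x, V x,
      ContMDiff (𝓡 n) ((𝓡 n).prod 𝓘(ℝ, F)) ∞ (fun x ↦ Bundle.TotalSpace.mk' F x (σ x)) ∧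
      (∀ y ∈ dom n F V c, fibVec F c y (σ y) = f (chartAt (Eu n) c y)) ∧
      ∀ y ∉ (chartAt (Eu n) c).symm '' K, σ y = 0 := by
  let σ : Π x, V x := fun y ↦
    if y ∈ dom n F V c then fibSec V c (f (chartAt (Eu n) c y)) y else 0
  have h1 : ∀ y ∈ dom n F V c, fibVec F c y (σ y) = f (chartAt (Eu n) c y) := fun y hy ↦ by
    simp only [σ, if_pos hy]
    exact fibVec_fibSec hy.2 _
  have h0 : ∀ y ∉ (chartAt (Eu n) c).symm '' K, σ y = 0 := fun y hy ↦ by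
    by_cases h : y ∈ dom n F V c
    · simp only [σ, if_pos h, hfK _ (chart_notMem h.1 hy)]
      exact map_zero _
    · simp only [σ, if_neg h]
  refine ⟨σ, fun y ↦ ?_, h1, h0⟩
  by_cases hy : y ∈ dom n F V c
  · refine (contMDiffAt_sec_iff hy).2 ?_
    have hp := chart_mem_cdom hy
    refine (hf.contDiffAt ((isOpen_cdom c).mem_nhds hp)).congr_of_eventuallyEq ?_
    filter_upwards [(isOpen_cdom c).mem_nhds hp] with q hq
    rw [locSec, h1 _ (chart_symm_mem_dom hq), (chartAt (Eu n) c).right_inv hq.1]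
  · have hKc := isCompact_chart_symm_image (c := c) hK fun p hp ↦ (hKs hp).1
    refine (Bundle.contMDiff_zeroSection ℝ V y).congr_of_eventuallyEq ?_
    filter_upwards [hKc.isClosed.isOpen_compl.mem_nhds fun h ↦ hy (by
      obtain ⟨p, hp, rfl⟩ := h
      exact chart_symm_mem_dom (hKs hp))] with z hz
    rw [h0 z hz]
    rfl

end Extension

/-! ### From critical points to the conservation law -/

section Energies

variable {n : ℕ} {M : Type*} [TopologicalSpace M] [ChartedSpace (Eu n) M] [IsManifold (𝓡 n) ∞ M]
  [Bundle.RiemannianBundle (fun x : M ↦ TangentSpace (𝓡 n) x)]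
  [MeasurableSpace M] [BorelSpace M] [T2Space M]
  {F : Type*} [NormedAddCommGroup F] [NormedSpace ℝ F]
  {V : M → Type*} [TopologicalSpace (Bundle.TotalSpace F V)]
  [∀ x, TopologicalSpace (V x)] [∀ x, AddCommGroup (V x)] [∀ x, Module ℝ (V x)]
  [∀ x, IsTopologicalAddGroup (V x)] [∀ x, ContinuousSMul ℝ (V x)]
  [FiberBundle F V] [VectorBundle ℝ F V]
  [∀ x, FiniteDimensional ℝ (V x)] [Bundle.RiemannianBundle V]
  [FiniteDimensional ℝ F] [ContMDiffVectorBundle ∞ F V (𝓡 n)]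
  [IsContMDiffRiemannianBundle (𝓡 n) ∞ (Eu n) (fun x : M ↦ TangentSpace (𝓡 n) x)]

/-- The integral of `exp (‖R‖² / 2) - c₁` over `K`. -/
def shiftedEnergy (c₁ : ℝ) (K : Set M) (cov : CovariantDerivative (𝓡 n) F V) : ℝ :=
  ∫ x in K, (Real.exp (curvatureNormSq cov x / 2) - c₁) ∂(riemannianVolume n M)

lemma expEnergy_eq : expEnergy = shiftedEnergy (n := n) (M := M) (F := F) (V := V) 0 := by
  ext K cov
  simp [expEnergy, shiftedEnergy]

lemma normalizedExpEnergy_eq :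
    normalizedExpEnergy = shiftedEnergy (n := n) (M := M) (F := F) (V := V) 1 := rfl

/-- On a compact set inside one domain the global energy becomes a Lebesgue integral. Smoothness of
`Γ` makes the integrand continuous there. -/
lemma IsConstMetric.shiftedEnergy_eq {cov : CovariantDerivative (𝓡 n) F V} {c : M}
    {κ : F →L[ℝ] F →L[ℝ] ℝ} {Γ : Eu n → (Eu n →L[ℝ] F →L[ℝ] F)} (hκ : IsConstMetric n V c κ)
    (hΓ : IsLocalRep cov c Γ) (hΓs : ContDiffOn ℝ ∞ Γ (cdom n F V c))
    (b : Module.Basis (Fin n) ℝ (Eu n)) (c₁ : ℝ) {K : Set (Eu n)} (hK : IsCompact K)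
    (hKs : K ⊆ cdom n F V c) :
    shiftedEnergy c₁ ((chartAt (Eu n) c).symm '' K) cov = ∫ p in K,
      (Real.exp (normSq (endInner F V c κ) (gramB c b p)⁻¹ (curvMat Γ b p) / 2) - c₁)
        * Real.sqrt (gramMatrix c p).det := by
  have hcont : ContinuousOn (fun p ↦ Real.exp (curvatureNormSq cov ((chartAt (Eu n) c).symm p) / 2)
      - c₁) K := by
    have h1 : ContinuousOn (fun p ↦ Real.exp (normSq (endInner F V c κ) (gramB c b p)⁻¹
        (curvMat Γ b p) / 2) - c₁) K := fun p hp ↦ by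
      have hΓ' := hΓs.contDiffAt ((isOpen_cdom c).mem_nhds (hKs hp))
      have hq := contDiffAt_normSq (H := endInner F V c κ) (contDiffAt_gramB_inv b (hKs hp).1)
        (R := curvMat Γ b) fun i j ↦ contDiffAt_curvA hΓ' _ _
      exact ((hq.div_const 2).exp.sub contDiffAt_const).continuousAt.continuousWithinAt
    refine h1.congr fun p hp ↦ ?_
    rw [hκ.exp_curvatureNormSq hΓ hΓs b (hKs hp)]
  rw [shiftedEnergy, setIntegral_riemannianVolume c hK (fun p hp ↦ (hKs hp).1) hcont]
  refine setIntegral_congr_fun hK.measurableSet fun p hp ↦ ?_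
  simp only [hκ.exp_curvatureNormSq hΓ hΓs b (hKs hp)]

/-- A connection on a bundle with locally constant metric satisfies the conservation law if the
energy is stationary under a class of variations that contains the Lie derivatives of the local
connection forms along compactly supported vector fields. -/
theorem eConservationLaw_of_isCriticalPoint {κ : F →L[ℝ] F →L[ℝ] ℝ} (hκs : ∀ s t, κ s t = κ t s)
    (hκ : ∀ c, IsConstMetric n V c κ) (cov : CovariantDerivative (𝓡 n) F V)
    [cov.ContMDiffCovariantDerivative ∞]
    {𝒜 : Set (Π x : M, V x →L[ℝ] TangentSpace (𝓡 n) x →L[ℝ] V x)}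
    (hvar : ∀ (c : M) (Γ : Eu n → (Eu n →L[ℝ] F →L[ℝ] F)), IsLocalRep cov c Γ →
      ContDiffOn ℝ ∞ Γ (cdom n F V c) → ∀ (v : Eu n) (ψ : Eu n → ℝ), ContDiff ℝ ∞ ψ →
      HasCompactSupport ψ → tsupport ψ ⊆ cdom n F V c → ∃ A ∈ 𝒜,
        (∀ y ∈ dom n F V c, ∀ (u : Eu n) (s : V y), fibVec F c y (A y s (coordField c u y)) =
          lieVar Γ v ψ (chartAt (Eu n) c y) u (fibVec F c y s)) ∧
        ∀ x ∉ (chartAt (Eu n) c).symm '' tsupport ψ, A x = 0)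
    (hcrit : IsCriticalPoint normalizedExpEnergy 𝒜 cov ∨ IsCriticalPoint expEnergy 𝒜 cov) :
    EConservationLaw cov := by
  -- Both functionals are treated at once: `c₁` is `1` for the normalized energy and `0` for the
  -- other.
  obtain ⟨c₁, hc₁⟩ : ∃ c₁, IsCriticalPoint (shiftedEnergy c₁) 𝒜 cov := by
    rw [normalizedExpEnergy_eq, expEnergy_eq] at hcrit
    exact hcrit.elim (fun h ↦ ⟨1, h⟩) fun h ↦ ⟨0, h⟩
  -- Here `c₀` is arbitrary and unrelated to `c₁`, so one kind of critical point yields both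
  -- conservation laws.
  have main (c₀ : ℝ) : IsDivergenceFree (stressTensor c₀ cov) := by
    refine ⟨fun c u w ↦ ?_, fun c w ↦ ?_⟩
    · obtain ⟨Γ, hΓ⟩ := exists_isLocalRep cov c
      have hΓs := contDiffOn_of_isLocalRep hΓ
      exact mdifferentiableAt_tensor u w
        (((hκ c).contDiffAt_tensorRep hΓ hΓs c₀ _ _).differentiableAt (by simp))
    · obtain ⟨Γ, hΓ⟩ := exists_isLocalRep cov c
      have hΓs := contDiffOn_of_isLocalRep hΓ
      refine (hκ c).divergence_stressTensor hκs hΓ hΓs c₀ c₁ (fun m ψ hψ hψc hψs ↦ ?_) w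
      obtain ⟨A, hA𝒜, hA, hA0⟩ := hvar c Γ hΓ hΓs (frame c m) ψ hψ hψc hψs
      -- The energy is computed on the image of the support of `ψ`, outside of which `A` vanishes.
      -- On it `∇ + tA` has the local form `Γ + t • lieVar`, so the functions of `t` coincide.
      refine (hc₁ A hA𝒜 _ (isCompact_chart_symm_image hψc fun p hp ↦ (hψs hp).1)
        hA0).congr_of_eventuallyEq (.of_forall fun t ↦ ?_)
      have hL : ContDiffOn ℝ ∞ (lieVar Γ (frame c m) ψ) (cdom n F V c) := fun p hp ↦
        (contDiffAt_lieVar (hΓs.contDiffAt ((isOpen_cdom c).mem_nhds hp)) _ hψ).contDiffWithinAt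
      refine ((hκ c).shiftedEnergy_eq (hΓ.addOneForm (A' := t • lieVar Γ (frame c m) ψ) ?_)
        (hΓs.add (hL.const_smul t)) (frame c) c₁ hψc hψs).symm
      intro y hy u s
      simp only [smul_apply, map_smul, hA y hy u s, Pi.smul_apply]
  refine ⟨?_, ?_⟩
  · rw [normalizedStressEnergy_eq]
    exact main 1
  · rw [stressEnergy_eq]
    exact main 0

end Energies

section

set_option synthInstance.maxHeartbeats 200000

/-! ### One-forms with prescribed local representatives -/

section HomBundle

/-- Needed because local connection forms take the tangent vector first, whereas the elements of
`endForms` take the fibre vector first. -/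
lemma contDiffOn_flip {X E F W : Type*} [NormedAddCommGroup X] [NormedSpace ℝ X]
    [NormedAddCommGroup E] [NormedSpace ℝ E] [NormedAddCommGroup F] [NormedSpace ℝ F]
    [NormedAddCommGroup W] [NormedSpace ℝ W] [FiniteDimensional ℝ E] [FiniteDimensional ℝ F]
    {f : X → (E →L[ℝ] F →L[ℝ] W)} {s : Set X}
    (hf : ContDiffOn ℝ ∞ f s) : ContDiffOn ℝ ∞ (fun x ↦ (f x).flip) s := by
  rw [contDiffOn_clm_apply]
  intro v
  rw [contDiffOn_clm_apply]
  intro u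
  exact (hf.clm_apply contDiffOn_const).clm_apply contDiffOn_const

variable {n : ℕ} {M : Type*} [TopologicalSpace M] [ChartedSpace (Eu n) M] [IsManifold (𝓡 n) ∞ M]
  {F₁ : Type*} [NormedAddCommGroup F₁] [NormedSpace ℝ F₁]
  {V₁ : M → Type*} [TopologicalSpace (Bundle.TotalSpace F₁ V₁)]
  [∀ x, TopologicalSpace (V₁ x)] [∀ x, AddCommGroup (V₁ x)] [∀ x, Module ℝ (V₁ x)]
  [FiberBundle F₁ V₁] [VectorBundle ℝ F₁ V₁]
  {F : Type*} [NormedAddCommGroup F] [NormedSpace ℝ F]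
  {V : M → Type*} [TopologicalSpace (Bundle.TotalSpace F V)]
  [∀ x, TopologicalSpace (V x)] [∀ x, AddCommGroup (V x)] [∀ x, Module ℝ (V x)]
  [∀ x, IsTopologicalAddGroup (V x)] [∀ x, ContinuousSMul ℝ (V x)]
  [FiberBundle F V] [VectorBundle ℝ F V]

/-- The preferred trivialization of a bundle of homomorphisms is conjugation by those of the two
factors. -/
lemma fibVec_hom {c y : M} (hy : y ∈ (trivializationAt F₁ V₁ c).baseSet)
    (hy' : y ∈ (trivializationAt F V c).baseSet) (L : V₁ y →L[ℝ] V y) (s : F₁) :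
    fibVec (F₁ →L[ℝ] F) (V := fun x ↦ V₁ x →L[ℝ] V x) c y L s =
      fibVec F c y (L (fibSec V₁ c s y)) := by
  have h : y ∈ (trivializationAt (F₁ →L[ℝ] F) (fun x ↦ V₁ x →L[ℝ] V x) c).baseSet := ⟨hy, hy'⟩
  unfold fibVec
  rw [Bundle.Trivialization.continuousLinearMapAt_apply_of_mem ℝ _ h, hom_trivializationAt_apply]
  rfl

/-- The tangent trivialization at `c` is defined exactly on the chart domain, already part of `dom`,
so passing to forms does not shrink the domain. -/
lemma dom_oneForms (c : M) :
    dom n (Eu n →L[ℝ] F) (fun x ↦ TangentSpace (𝓡 n) x →L[ℝ] V x) c = dom n F V c := by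
  ext y
  simp only [dom, hom_trivializationAt_baseSet, TangentBundle.trivializationAt_baseSet,
    Set.mem_inter_iff]
  tauto

lemma dom_endForms (c : M) :
    dom n (F →L[ℝ] Eu n →L[ℝ] F) (fun x ↦ V x →L[ℝ] TangentSpace (𝓡 n) x →L[ℝ] V x) c =
      dom n F V c := by
  ext y
  simp only [dom, hom_trivializationAt_baseSet, TangentBundle.trivializationAt_baseSet,
    Set.mem_inter_iff]
  tauto

lemma cdom_eq_of_dom_eq {F' : Type*} [NormedAddCommGroup F'] [NormedSpace ℝ F']
    {V' : M → Type*} [TopologicalSpace (Bundle.TotalSpace F' V')]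
    [∀ x, TopologicalSpace (V' x)] [∀ x, AddCommGroup (V' x)] [∀ x, Module ℝ (V' x)]
    [FiberBundle F' V'] [VectorBundle ℝ F' V'] {c : M} (h : dom n F' V' c = dom n F V c) :
    cdom n F' V' c = cdom n F V c := by
  have key : ∀ p ∈ (chartAt (Eu n) c).target, (p ∈ cdom n F' V' c ↔ p ∈ cdom n F V c) := by
    intro p hp
    have := Set.ext_iff.1 h ((chartAt (Eu n) c).symm p)
    simpa [dom, cdom, hp, (chartAt (Eu n) c).map_target hp] using this
  ext p
  by_cases hp : p ∈ (chartAt (Eu n) c).target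
  · exact key p hp
  · exact iff_of_false (fun h ↦ hp h.1) fun h ↦ hp h.1

variable [ContMDiffVectorBundle ∞ F V (𝓡 n)] [T2Space M] [FiniteDimensional ℝ F]

/-- The endomorphism valued one-form with a given local representative. -/
lemma exists_contMDiff_endForm {c : M} {A' : Eu n → (Eu n →L[ℝ] F →L[ℝ] F)}
    (hA' : ContDiffOn ℝ ∞ A' (cdom n F V c)) {K : Set (Eu n)} (hK : IsCompact K)
    (hKs : K ⊆ cdom n F V c) (hAK : ∀ p ∉ K, A' p = 0) :
    ∃ A : Π x : M, V x →L[ℝ] TangentSpace (𝓡 n) x →L[ℝ] V x,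
      ContMDiff (𝓡 n) ((𝓡 n).prod 𝓘(ℝ, F →L[ℝ] Eu n →L[ℝ] F)) ∞
        (fun x ↦ Bundle.TotalSpace.mk' (F →L[ℝ] Eu n →L[ℝ] F)
          (E := fun x : M ↦ V x →L[ℝ] TangentSpace (𝓡 n) x →L[ℝ] V x) x (A x)) ∧
      (∀ y ∈ dom n F V c, ∀ (u : Eu n) (s : V y),
        fibVec F c y (A y s (coordField c u y)) = A' (chartAt (Eu n) c y) u (fibVec F c y s)) ∧
      ∀ x ∉ (chartAt (Eu n) c).symm '' K, A x = 0 := by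
  have hd := dom_endForms (n := n) (F := F) (V := V) c
  have hcd := cdom_eq_of_dom_eq hd
  obtain ⟨A, hA, hloc, h0⟩ := exists_contMDiff_section
    (V := fun x : M ↦ V x →L[ℝ] TangentSpace (𝓡 n) x →L[ℝ] V x) (c := c)
    (f := fun p ↦ (A' p).flip) (K := K)
    (by
      rw [hcd]
      exact contDiffOn_flip hA')
    hK (by rwa [hcd]) (fun p hp ↦ by rw [hAK p hp]; rfl)
  refine ⟨A, hA, fun y hy u s ↦ ?_, h0⟩
  have hT : y ∈ (trivializationAt (Eu n) (TangentSpace (𝓡 n) : M → Type _) c).baseSet := by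
    simpa using hy.1
  have h1 := hloc y (by rwa [hd])
  have h2 := congrArg (fun L : F →L[ℝ] Eu n →L[ℝ] F ↦ L (fibVec F c y s) u) h1
  refine Eq.trans ?_ h2
  beta_reduce
  have hTV : y ∈ (trivializationAt (Eu n →L[ℝ] F)
      (fun x ↦ TangentSpace (𝓡 n) x →L[ℝ] V x) c).baseSet := by
    rw [hom_trivializationAt_baseSet]
    exact ⟨hT, hy.2⟩
  have h3 := fibVec_hom (F := Eu n →L[ℝ] F) (V := fun x ↦ TangentSpace (𝓡 n) x →L[ℝ] V x)
    hy.2 hTV (A y)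
    (fibVec F c y s)
  rw [fibSec_fibVec hy.2] at h3
  refine Eq.trans ?_ (congrArg (fun L : Eu n →L[ℝ] F ↦ L u) h3).symm
  exact (fibVec_hom (V := V) hT hy.2 (A y s) u).symm

/-- The one-form with values in the bundle with a given local representative. -/
lemma exists_contMDiff_oneForm {c : M} {a' : Eu n → (Eu n →L[ℝ] F)}
    (ha' : ContDiffOn ℝ ∞ a' (cdom n F V c)) {K : Set (Eu n)} (hK : IsCompact K)
    (hKs : K ⊆ cdom n F V c) (haK : ∀ p ∉ K, a' p = 0) :
    ∃ a : Π x : M, TangentSpace (𝓡 n) x →L[ℝ] V x,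
      ContMDiff (𝓡 n) ((𝓡 n).prod 𝓘(ℝ, Eu n →L[ℝ] F)) ∞
        (fun x ↦ Bundle.TotalSpace.mk' (Eu n →L[ℝ] F)
          (E := fun x : M ↦ TangentSpace (𝓡 n) x →L[ℝ] V x) x (a x)) ∧
      (∀ y ∈ dom n F V c, ∀ u : Eu n,
        fibVec F c y (a y (coordField c u y)) = a' (chartAt (Eu n) c y) u) ∧
      ∀ x ∉ (chartAt (Eu n) c).symm '' K, a x = 0 := by
  have hd := dom_oneForms (n := n) (F := F) (V := V) c
  have hcd := cdom_eq_of_dom_eq hd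
  obtain ⟨a, ha, hloc, h0⟩ := exists_contMDiff_section
    (V := fun x : M ↦ TangentSpace (𝓡 n) x →L[ℝ] V x) (c := c)
    (f := a') (K := K) (by rwa [hcd]) hK (by rwa [hcd]) haK
  refine ⟨a, ha, fun y hy u ↦ ?_, h0⟩
  have hT : y ∈ (trivializationAt (Eu n) (TangentSpace (𝓡 n) : M → Type _) c).baseSet := by
    simpa using hy.1
  have h1 := hloc y (by rwa [hd])
  refine Eq.trans ?_ (congrArg (fun L : Eu n →L[ℝ] F ↦ L u) h1)
  exact (fibVec_hom (V := V) hT hy.2 (a y) u).symm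

end HomBundle

end

section

set_option synthInstance.maxHeartbeats 200000

/-! ### Equivariance of the Lie bracket -/

section AdEquivariance

variable {d : ℕ} {G : Type*} [TopologicalSpace G] [ChartedSpace (Eu d) G] [Group G]
  [LieGroup (𝓡 d) ∞ G]

lemma Ad_inv_Ad (g : G) (η : Eu d) : Ad g⁻¹ (Ad g η : Eu d) = η := by
  have h := Ad_mul (d := d) g⁻¹ g
  rw [inv_mul_cancel, Ad_one] at h
  exact (congrArg (fun L : Eu d →L[ℝ] Eu d ↦ L η) h).symm

/-- The bracket of the Lie algebra is equivariant under the adjoint representation. -/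
lemma Ad_ad (g : G) (ξ η : Eu d) :
    (Ad g (ad G ξ η) : Eu d) = ad G (Ad g ξ : Eu d) (Ad g η : Eu d) := by
  -- `T` is conjugation by `Ad g`. The claim is the derivative at `h = 1` of `Ad (g h g⁻¹) = T (Ad
  -- h)`, computed in two ways.
  let T : (Eu d →L[ℝ] Eu d) →L[ℝ] (Eu d →L[ℝ] Eu d) :=
    (ContinuousLinearMap.compL ℝ (Eu d) (Eu d) (Eu d) (Ad g)).comp
      ((ContinuousLinearMap.compL ℝ (Eu d) (Eu d) (Eu d)).flip (Ad g⁻¹))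
  have hAd : MDifferentiableAt (𝓡 d) 𝓘(ℝ, Eu d →L[ℝ] Eu d)
      (Ad : G → Eu d →L[ℝ] Eu d) 1 := contMDiff_Ad.mdifferentiable (by simp) 1
  have hc : MDifferentiableAt (𝓡 d) (𝓡 d) (fun h : G ↦ g * h * g⁻¹) 1 :=
    (contMDiff_conj g).mdifferentiable (by simp) 1
  have h1 : g * 1 * g⁻¹ = 1 := by simp
  have e : (fun h : G ↦ (Ad (g * h * g⁻¹) : Eu d →L[ℝ] Eu d)) = fun h ↦ T (Ad h) := by
    ext1 h
    rw [Ad_mul, Ad_mul]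
    rfl
  have k1 : HasMFDerivAt (𝓡 d) 𝓘(ℝ, Eu d →L[ℝ] Eu d)
      (fun h : G ↦ (Ad (g * h * g⁻¹) : Eu d →L[ℝ] Eu d)) 1
      ((ad (d := d) G).comp (Ad g : Eu d →L[ℝ] Eu d)) := by
    refine HasMFDerivAt.comp (1 : G) (g := (Ad : G → Eu d →L[ℝ] Eu d)) ?_ hc.hasMFDerivAt
    rw [h1]
    exact hAd.hasMFDerivAt
  have k2 : HasMFDerivAt (𝓡 d) 𝓘(ℝ, Eu d →L[ℝ] Eu d)
      (fun h : G ↦ T (Ad h)) 1 (T.comp (ad (d := d) G)) :=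
    HasMFDerivAt.comp (1 : G) (g := T) T.hasMFDerivAt hAd.hasMFDerivAt
  rw [e] at k1
  have key := congrArg (fun L : Eu d →L[ℝ] Eu d →L[ℝ] Eu d ↦ L ξ (Ad g η))
    (hasMFDerivAt_unique k1 k2)
  refine Eq.trans ?_ key.symm
  change _ = (Ad g) ((ad G ξ) (Ad g⁻¹ (Ad g η : Eu d)))
  rw [Ad_inv_Ad]

end AdEquivariance

/-! ### Values in the image of a linear map -/

section LinearAlgebra

/-- A linear map between finite dimensional spaces has a right inverse on its range. -/
lemma exists_rightInverse_range {E W : Type*} [NormedAddCommGroup E] [NormedSpace ℝ E]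
    [NormedAddCommGroup W] [NormedSpace ℝ W] [FiniteDimensional ℝ W] (L : E →L[ℝ] W) :
    ∃ r : W →L[ℝ] E, ∀ x, L (r (L x)) = L x := by
  obtain ⟨s, hs⟩ := L.toLinearMap.rangeRestrict.exists_rightInverse_of_surjective
    L.toLinearMap.range_rangeRestrict
  obtain ⟨t, ht⟩ := LinearMap.exists_extend s
  refine ⟨LinearMap.toContinuousLinearMap t, fun x ↦ ?_⟩
  have h1 : t (L x) = s ⟨L x, x, rfl⟩ := by rw [← ht]; rfl
  have h2 := congrArg Subtype.val (LinearMap.congr_fun hs ⟨L x, x, rfl⟩)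
  rw [LinearMap.coe_toContinuousLinearMap', h1]
  exact h2

/-- The Lie derivative of a form whose values are fixed by a linear map. -/
lemma map_lieVar_of_eventually {n : ℕ} {E : Type*} [NormedRing E] [NormedAlgebra ℝ E]
    (T : E →L[ℝ] E) {Γ : Eu n → (Eu n →L[ℝ] E)} {p : Eu n} (hΓ : DifferentiableAt ℝ Γ p)
    (h : ∀ᶠ q in 𝓝 p, ∀ u, T (Γ q u) = Γ q u) (v : Eu n) (ψ : Eu n → ℝ) (u : Eu n) :
    T (lieVar Γ v ψ p u) = lieVar Γ v ψ p u := by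
  have h1 : fderiv ℝ (fun q ↦ T (Γ q u)) p v = T (fderiv ℝ Γ p v u) := by
    have h2 := T.hasFDerivAt.comp p (hΓ.clm_apply (differentiableAt_const u)).hasFDerivAt
    have h3 := congrArg (fun L : Eu n →L[ℝ] E ↦ L v) h2.fderiv
    refine h3.trans ?_
    rw [ContinuousLinearMap.comp_apply, fderiv_fderiv_apply hΓ]
  have h2 : (fun q ↦ T (Γ q u)) =ᶠ[𝓝 p] fun q ↦ Γ q u := h.mono fun q hq ↦ hq u
  rw [h2.fderiv_eq, fderiv_fderiv_apply hΓ] at h1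
  rw [lieVar_apply, map_add, map_smul, map_smul, ← h1, h.self_of_nhds v]

end LinearAlgebra

/-! ### Induced connections and admissible variations on the adjoint bundle -/

section AdjointBundle

variable {n m d : ℕ} {M : Type*} [TopologicalSpace M] [ChartedSpace (Eu n) M]
  {G : Type*} [TopologicalSpace G] [ChartedSpace (Eu d) G] [Group G] [LieGroup (𝓡 d) ∞ G]
  {P : Type*} [TopologicalSpace P] [ChartedSpace (Eu m) P] [MulAction Gᵐᵒᵖ P]
  (Q : PrincipalBundle n m d M G P) (κ : AdInvariantInner d G)

namespace PrincipalBundle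

/-- The preferred trivialization at `c` is by construction the one of the bundle chart chosen at
`c`. -/
lemma fibVec_AdP {c y : M} (hy : y ∈ (trivializationAt (Eu d) (Q.AdP κ) c).baseSet)
    (u : Q.AdP κ y) : fibVec (Eu d) c y u = Q.coord κ (Q.adjointCore.indexAt c) u := by
  unfold fibVec
  rw [Bundle.Trivialization.continuousLinearMapAt_apply_of_mem ℝ _ hy]
  rfl

/-- Components are obtained by applying some `Ad g`, which preserves the bracket. -/
lemma fibVec_bracket {c y : M} (hy : y ∈ (trivializationAt (Eu d) (Q.AdP κ) c).baseSet)
    (ξ u : Q.AdP κ y) : fibVec (Eu d) c y (Q.bracket κ ξ u) =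
      ad G (fibVec (Eu d) c y ξ) (fibVec (Eu d) c y u) := by
  rw [Q.fibVec_AdP κ hy, Q.fibVec_AdP κ hy, Q.fibVec_AdP κ hy]
  exact Ad_ad _ ξ u

/-- Components are obtained by applying some `Ad g`, and the inner product is `Ad`-invariant. -/
lemma isConstMetric_AdP (c : M) : IsConstMetric n (Q.AdP κ) c κ.form := by
  intro y hy u v
  rw [Q.fibVec_AdP κ hy.2, Q.fibVec_AdP κ hy.2]
  exact (κ.invariant _ u v).symm

variable {Q κ} [IsManifold (𝓡 n) ∞ M] [IsManifold (𝓡 m) ∞ P]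

/-- The local connection form of an induced connection takes values in the image of the adjoint
representation. -/
lemma IsInducedBy.exists_ad_eq {cov : CovariantDerivative (𝓡 n) (Eu d) (Q.AdP κ)}
    {θ : Q.Connection} (hθ : Q.IsInducedBy κ cov θ) {c : M}
    {Γ : Eu n → (Eu n →L[ℝ] Eu d →L[ℝ] Eu d)} (hΓ : IsLocalRep cov c Γ) {p : Eu n}
    (hp : p ∈ cdom n (Eu d) (Q.AdP κ) c) (u : Eu n) : ∃ ξ : Eu d, Γ p u = ad G ξ := by
  set y := (chartAt (Eu n) c).symm p with hydef
  have hy : y ∈ dom n (Eu d) (Q.AdP κ) c := chart_symm_mem_dom hp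
  have hpy : chartAt (Eu n) c y = p := (chartAt (Eu n) c).right_inv hp.1
  refine ⟨θ.form ((Q.adjointCore.indexAt c).localSection y)
    (mfderiv (𝓡 n) (𝓡 m) (Q.adjointCore.indexAt c).localSection y (coordField c u y)),
    ContinuousLinearMap.ext fun s ↦ ?_⟩
  -- A section with constant components has no derivative term in either formula, so comparing them
  -- identifies `Γ p u` with `ad` of the pulled back connection form.
  have hs : MDiffS n (Eu d) (fibSec (Q.AdP κ) c s) y := mdiffS_fibSec s hy
  have h1 := hΓ _ y hy hs u
  have h2 := hθ _ y hs (Q.adjointCore.indexAt c) hy.2 (coordField c u y)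
  rw [(locSec_fibSec_eventuallyEq s hy).fderiv_eq, hpy, fibVec_fibSec hy.2,
    Q.fibVec_AdP κ hy.2] at h1
  have h3 : mvfderiv (𝓡 n) (fun z ↦ Q.coord κ (Q.adjointCore.indexAt c)
      (fibSec (Q.AdP κ) c s z)) y (coordField c u y) = 0 := by
    have h4 : (fun z ↦ Q.coord κ (Q.adjointCore.indexAt c) (fibSec (Q.AdP κ) c s z)) =ᶠ[𝓝 y]
        fun _ ↦ s := by
      filter_upwards [(isOpen_dom (n := n) (F := Eu d) (V := Q.AdP κ) c).mem_nhds hy] with z hz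
      rw [← Q.fibVec_AdP κ hz.2, fibVec_fibSec hz.2]
    have h5 := (hasMFDerivAt_const (I := 𝓡 n) (I' := 𝓘(ℝ, Eu d)) s y).congr_of_eventuallyEq h4
    exact congrArg (fun L : TangentSpace (𝓡 n) y →L[ℝ] Eu d ↦ L (coordField c u y)) h5.mfderiv
  have h4 : Q.coord κ (Q.adjointCore.indexAt c) (fibSec (Q.AdP κ) c s y) = s := by
    rw [← Q.fibVec_AdP κ hy.2, fibVec_fibSec hy.2]
  rw [h3, h4] at h2
  have h5 := h1.symm.trans h2
  simpa using h5

/-- The variation by a Lie derivative of the local connection form of an induced connection comes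
from a one-form with values in the adjoint bundle. -/
lemma IsInducedBy.exists_mem_adForms [T2Space M]
    {cov : CovariantDerivative (𝓡 n) (Eu d) (Q.AdP κ)}
    {θ : Q.Connection} (hθ : Q.IsInducedBy κ cov θ) {c : M}
    {Γ : Eu n → (Eu n →L[ℝ] Eu d →L[ℝ] Eu d)} (hΓ : IsLocalRep cov c Γ)
    (hΓs : ContDiffOn ℝ ∞ Γ (cdom n (Eu d) (Q.AdP κ) c)) (v : Eu n) {ψ : Eu n → ℝ}
    (hψ : ContDiff ℝ ∞ ψ) (hψc : HasCompactSupport ψ)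
    (hψs : tsupport ψ ⊆ cdom n (Eu d) (Q.AdP κ) c) :
    ∃ A ∈ Q.adForms κ, (∀ y ∈ dom n (Eu d) (Q.AdP κ) c, ∀ (u : Eu n) (s : Q.AdP κ y),
        fibVec (Eu d) c y (A y s (coordField c u y)) =
          lieVar Γ v ψ (chartAt (Eu n) c y) u (fibVec (Eu d) c y s)) ∧
      ∀ x ∉ (chartAt (Eu n) c).symm '' tsupport ψ, A x = 0 := by
  -- `ad` may have a kernel, so the lift to the Lie algebra is not unique; a fixed linear section
  -- `r` on the image keeps it smooth and of the same support.
  obtain ⟨r, hr⟩ := exists_rightInverse_range (ad (d := d) G)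
  have hL {p : Eu n} (hp : p ∈ cdom n (Eu d) (Q.AdP κ) c) : ContDiffAt ℝ ∞ (lieVar Γ v ψ) p :=
    contDiffAt_lieVar (hΓs.contDiffAt ((isOpen_cdom c).mem_nhds hp)) v hψ
  obtain ⟨a, ha, hloc, h0⟩ := exists_contMDiff_oneForm (V := Q.AdP κ) (c := c)
    (a' := fun p ↦ r.comp (lieVar Γ v ψ p)) (K := tsupport ψ)
    (fun p hp ↦ (contDiffAt_const.clm_comp (hL hp)).contDiffWithinAt) hψc hψs
    fun p hp ↦ by rw [lieVar_eq_zero_of_notMem v hp, ContinuousLinearMap.comp_zero]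
  -- `ad ∘ r` fixes the image of `ad`, where `Γ` takes its values near `p`. A fixed linear map
  -- commutes with differentiation, so it fixes the values of the Lie derivative as well.
  have hfix {p : Eu n} (hp : p ∈ cdom n (Eu d) (Q.AdP κ) c) (u : Eu n) :
      ad G (r (lieVar Γ v ψ p u)) = lieVar Γ v ψ p u := by
    refine map_lieVar_of_eventually ((ad (d := d) G).comp r)
      ((hΓs.contDiffAt ((isOpen_cdom c).mem_nhds hp)).differentiableAt (by simp)) ?_ v ψ u
    filter_upwards [(isOpen_cdom c).mem_nhds hp] with q hq w
    obtain ⟨ξ, hξ⟩ := hθ.exists_ad_eq hΓ hq w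
    rw [hξ]
    exact hr ξ
  -- Fibres of `Ad(P)` and tangent spaces are the model spaces by definition, which lets the bracket
  -- be composed as a continuous linear map.
  let A : Π x : M, Q.AdP κ x →L[ℝ] TangentSpace (𝓡 n) x →L[ℝ] Q.AdP κ x := fun x ↦
    (show Eu d →L[ℝ] Eu n →L[ℝ] Eu d from
      ((ad (d := d) G).comp (show Eu n →L[ℝ] Eu d from a x)).flip)
  have hA (x : M) (s : Q.AdP κ x) (w : TangentSpace (𝓡 n) x) :
      A x s w = Q.bracket κ (a x w) s := rfl
  refine ⟨A, ⟨a, ha, hA⟩, fun y hy u s ↦ ?_, fun x hx ↦ ?_⟩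
  · rw [hA, Q.fibVec_bracket κ hy.2, hloc y hy, ContinuousLinearMap.comp_apply,
      hfix (chart_mem_cdom hy)]
  · refine ContinuousLinearMap.ext fun s ↦ ContinuousLinearMap.ext fun w ↦ ?_
    rw [hA, h0 x hx]
    exact congrArg (fun L : Eu d →L[ℝ] Eu d ↦ L s) (map_zero (ad (d := d) G))

end PrincipalBundle

end AdjointBundle

end

end ExpYangMills

end

theorem theorem3p11 {n m d : ℕ}
    -- the Riemannian manifold `M`
    {M : Type*} [TopologicalSpace M] [T2Space M] [SecondCountableTopology M]
    [ChartedSpace (Eu n) M] [IsManifold (𝓡 n) ∞ M] [MeasurableSpace M] [BorelSpace M]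
    [Bundle.RiemannianBundle (fun x : M ↦ TangentSpace (𝓡 n) x)]
    [IsContMDiffRiemannianBundle (𝓡 n) ∞ (Eu n) (fun x : M ↦ TangentSpace (𝓡 n) x)]
    -- the compact Lie group `G`
    {G : Type*} [TopologicalSpace G] [ChartedSpace (Eu d) G] [Group G] [LieGroup (𝓡 d) ∞ G]
    [CompactSpace G]
    -- the principal bundle `P` and the inner product on the Lie algebra of `G`
    {P : Type*} [TopologicalSpace P] [ChartedSpace (Eu m) P] [IsManifold (𝓡 m) ∞ P]
    [MulAction Gᵐᵒᵖ P] (Q : PrincipalBundle n m d M G P) (κ : AdInvariantInner d G)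
    -- a smooth connection on the adjoint bundle
    (cov : CovariantDerivative (𝓡 n) (Eu d) (Q.AdP κ))
    [CovariantDerivative.ContMDiffCovariantDerivative cov ∞]
    -- the connection is a critical point of one of the two functionals, either among all smooth
    -- connections on the adjoint bundle, or among those that come from connections on `P`
    (hcrit :
      (IsCriticalPoint normalizedExpEnergy (endForms n (Eu d) (Q.AdP κ)) cov ∨
        IsCriticalPoint expEnergy (endForms n (Eu d) (Q.AdP κ)) cov) ∨
      ((∃ θ : Q.Connection, Q.IsInducedBy κ cov θ) ∧
        (IsCriticalPoint normalizedExpEnergy (Q.adForms κ) cov ∨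
          IsCriticalPoint expEnergy (Q.adForms κ) cov))) :
    EConservationLaw cov := by
  rcases hcrit with hcrit | ⟨⟨θ, hθ⟩, hcrit⟩
  · refine eConservationLaw_of_isCriticalPoint κ.symm (Q.isConstMetric_AdP κ) cov
      (fun c Γ hΓ hΓs v ψ hψ hψc hψs ↦ ?_) hcrit
    -- Among all smooth connections, the Lie derivative of the local form extended by zero is
    -- already admissible.
    exact exists_contMDiff_endForm (fun p hp ↦ (contDiffAt_lieVar
      (hΓs.contDiffAt ((isOpen_cdom c).mem_nhds hp)) v hψ).contDiffWithinAt) hψc hψs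
      fun p hp ↦ lieVar_eq_zero_of_notMem v hp
  · exact eConservationLaw_of_isCriticalPoint κ.symm (Q.isConstMetric_AdP κ) cov
      (fun c Γ hΓ hΓs v ψ hψ hψc hψs ↦ hθ.exists_mem_adForms hΓ hΓs v hψ hψc hψs) hcrit
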